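/- Fix finite sets $\Sigma_V$ (vertex labels) and $\Sigma_E$ (edge labels). A finite fuzzy graph is a triple $G=\langle V,E,L\rangle$ with $V$ finite, $E:V\times\Sigma_E\times V\to[0,1]$ and $L:V\to(\Sigma_V\to[0,1])$; let $|E|$ be the number of triples $\langle x,r,y\rangle$ with $E(x,r,y)>0$. A (crisp) simulation between $G=\langle V,E,L\rangle$ and $G'=\langle V',E',L'\rangle$ is a set $Z\subseteq V\times V'$ such that, whenever $\langle x,x'\rangle\in Z$: (i) $L(x)(p)\le L'(x')(p)$ for all $p\in\Sigma_V$; (ii) if $E(x,r,y)>0$, then there is $y'\in V'$ with $\langle y,y'\rangle\in Z$ and $E(x,r,y)\le E'(x',r,y')$. The algorithm ComputeSimulationEfficiently works on numbered vertices and labels and is given the label degrees of the vertices and the list of the nonzero edges with their degrees. Write $\mathrm{Prev}_r(y)=\{x: E(x,r,y)>0\}$, $\mathrm{Prev}'_r(y')=\{x': E'(x',r,y')>0\}$ and $\mathrm{Next}'_r(x')=\{y': E'(x',r,y')>0\}$. * Initialization. Construct $E$, $E'$, the vectors $\mathrm{Prev}[r,y]$, $\mathrm{Prev}'[r,y']$,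 $\mathrm{Next}'[r,x']$ and distinct IDs $\mathrm{EdgeID}'[x',r,y']\in\{0,\dots,|E'|-1\}$ of the nonzero edges of $G'$. Set $Z[x,x']$ to the truth value of $L(x)\le L'(x')$, and let the queue $\mathit{remove}_Z$ be empty. Sort every $\mathrm{Next}'[r,x']$ in ascending order with respect to $E'[x',r,\cdot]$ and every $\mathrm{Prev}[r,y]$ with respect to $E[\cdot,r,y]$. Set all $\mathrm{rcNextElem}'[y,e']$ to null. For all $\langle r,y,x'\rangle\in\Sigma_E\times V\times V'$, let $\mathrm{rcPrev}[r,y,x']$ be the vector of those $x$ in $\mathrm{Prev}[r,y]$ for which $Z[x,x']$ holds and $\mathrm{rcNext}'[r,y,x']$ the doubly linked list of those $y'$ in $\mathrm{Next}'[r,x']$ for which $Z[y,y']$ holds, both in the given order, and store in $\mathrm{rcNextElem}'[y,\mathrm{EdgeID}'[x',r,y']]$ a reference to the list element with key $y'$. Then call $\mathrm{UpdateRcPrev}(r,y,x')$ for all $\langle r,y,x'\rangle$. * $\mathrm{UpdateRcPrev}(r,y,x')$. Let $d=0$ if $\mathrm{rcNext}'[r,y,x']$ is empty, and otherwise $d=E'[x',r,z']$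 for the key $z'$ of its last element. As long as $\mathrm{rcPrev}[r,y,x']$ is nonempty and its last element $x$ has $E[x,r,y]>d$, delete $x$ from that vector and, if $Z[x,x']$ holds, set $Z[x,x']$ to false and add $\langle x,x'\rangle$ to $\mathit{remove}_Z$. * Main loop. While $\mathit{remove}_Z$ is nonempty, extract a pair $\langle y,y'\rangle$ from it, and for all $r\in\Sigma_E$ and all $x'$ in $\mathrm{Prev}'[r,y']$: delete from $\mathrm{rcNext}'[r,y,x']$ the element referenced by $\mathrm{rcNextElem}'[y,\mathrm{EdgeID}'[x',r,y']]$, set this reference to null, and call $\mathrm{UpdateRcPrev}(r,y,x')$. Finally return the relation $\{\langle x,x'\rangle : Z[x,x']\}$. Theorem. Given finite fuzzy graphs $G=\langle V,E,L\rangle$ and $G'=\langle V',E',L'\rangle$ over $\Sigma_V$ and $\Sigma_E$, the algorithm ComputeSimulationEfficiently, implemented on a random access machine with unit-cost copying and comparison of fuzzy degrees, terminates and returns the largest simulation between $G$ and $G'$. Its running time is $O((m+n)n)$, where $n=|V|+|V'|$ and $m=|E|+|E'|$: there is a constant $C$, depending only on $\Sigma_V$ and $\Sigma_E$, such that for all such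 $G$ and $G'$ the number of steps is at most $C\cdot\max\{1,(m+n)n\}$. -/

import Mathlib

namespace FuzzySim

/-! ## Fuzzy labeled graphs and crisp simulations -/

/-- A fuzzy labeled graph with vertices `V`, edge labels `SE` and vertex labels `SV`; all degrees
lie in `[0,1]`. -/
structure FuzzyGraph (V SE SV : Type*) where
  E : V → SE → V → unitInterval
  L : V → SV → unitInterval

/-- `|E|`: the number of triples `(x, r, y)` with `E(x,r,y) > 0`. -/
noncomputable def FuzzyGraph.numEdges {V SE SV : Type*} (G : FuzzyGraph V SE SV) : ℕ :=
  Set.ncard {t : V × SE × V | 0 < G.E t.1 t.2.1 t.2.2}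

/-- `Z` is a (crisp) simulation between `G` and `G'`. -/
structure IsSimulation {V V' SE SV : Type*} (G : FuzzyGraph V SE SV) (G' : FuzzyGraph V' SE SV)
    (Z : Set (V × V')) : Prop where
  label_le : ∀ x x', (x, x') ∈ Z → ∀ s, G.L x s ≤ G'.L x' s
  forth : ∀ x x' r y, (x, x') ∈ Z → 0 < G.E x r y →
    ∃ y', (y, y') ∈ Z ∧ G.E x r y ≤ G'.E x' r y'

/-! ## A random access machine with a step count

A machine state consists of finitely many registers and arrays that hold natural numbers, and of
finitely many registers and arrays that hold real numbers (fuzzy degrees). The only operations on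
natural numbers are `+1`, `-1` and comparison; the only operations on reals are copying and
comparison. Array cells are addressed by tuples of registers. Every operation, every operand and
every array index costs one step. -/

/-- Registers holding natural numbers. A final `P` stands for a prime. -/
inductive Reg
  | numV | numVP | numSE | numSV | numE | numEP
  | r | s | x | y | xP | yP | zP | e
  | u | pr | nx | free
  | i | j | jPred | cur | other | len | go
  | head | tail | outLen
  deriving DecidableEq

/-- The register holding a real number. -/
inductive RReg
  | d
  deriving DecidableEq

/-- Arrays of natural numbers. A final `P` stands for a prime. The arrays `srcE`, ..., `dstEP` hold
the input edges. `nextP`, `prev`, `prevP` and `rcPrev` hold the elements of vectors (the last index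
is the position in the vector) whose lengths are held by the corresponding arrays `...Len`.
`rcFirst` and `rcLast` hold references to the first and to the last element of the doubly linked
lists `rcNext'[r,y,x']`, whose elements have the fields `key`, `succ` and `pred`.
The number `0` is the null reference. `queueFst` and `queueSnd` hold the pairs of the queue
`remove_Z`, `outFst` and `outSnd` those of the returned relation. -/
inductive Arr
  | srcE | lblE | dstE | srcEP | lblEP | dstEP
  | nextP | nextPLen | prev | prevLen | prevP | prevPLen | edgeIdP
  | Z | queueFst | queueSnd
  | rcPrev | rcPrevLen | rcFirst | rcLast | key | succ | pred | rcNextElemP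
  | outFst | outSnd
  deriving DecidableEq

/-- Arrays of reals: the input degrees of edges and of vertex labels, and the matrices
`E[x,r,y]` and `E'[x',r,y']`. -/
inductive RArr
  | degE | degEP | L | LP | E | EP
  deriving DecidableEq

structure State where
  reg : Reg → ℕ
  arr : Arr → List ℕ → ℕ
  rreg : RReg → ℝ
  rarr : RArr → List ℕ → ℝ

namespace State

def setReg (σ : State) (v : Reg) (n : ℕ) : State :=
  { σ with reg := Function.update σ.reg v n }

def setArr (σ : State) (a : Arr) (ix : List ℕ) (n : ℕ) : State :=
  { σ with arr := Function.update σ.arr a (Function.update (σ.arr a) ix n) }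

def setRReg (σ : State) (v : RReg) (q : ℝ) : State :=
  { σ with rreg := Function.update σ.rreg v q }

def setRArr (σ : State) (a : RArr) (ix : List ℕ) (q : ℝ) : State :=
  { σ with rarr := Function.update σ.rarr a (Function.update (σ.rarr a) ix q) }

end State

/-- Expressions for natural numbers. -/
inductive NExp
  | lit (n : ℕ)
  | reg (v : Reg)
  | get (a : Arr) (ix : List Reg)
  | succ (t : NExp)
  | pred (t : NExp)

def NExp.eval (σ : State) : NExp → ℕ
  | .lit n => n
  | .reg v => σ.reg v
  | .get a ix => σ.arr a (ix.map σ.reg)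
  | .succ t => t.eval σ + 1
  | .pred t => t.eval σ - 1

def NExp.cost : NExp → ℕ
  | .lit _ => 1
  | .reg _ => 1
  | .get _ ix => 1 + ix.length
  | .succ t => 1 + t.cost
  | .pred t => 1 + t.cost

/-- Expressions for reals. -/
inductive RExp
  | zero
  | reg (v : RReg)
  | get (a : RArr) (ix : List Reg)

noncomputable def RExp.eval (σ : State) : RExp → ℝ
  | .zero => 0
  | .reg v => σ.rreg v
  | .get a ix => σ.rarr a (ix.map σ.reg)

def RExp.cost : RExp → ℕ
  | .zero => 1
  | .reg _ => 1
  | .get _ ix => 1 + ix.length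

/-- Tests. -/
inductive Test
  | lt (t₁ t₂ : NExp)
  | eq (t₁ t₂ : NExp)
  | rle (t₁ t₂ : RExp)

def Test.Holds (σ : State) : Test → Prop
  | .lt t₁ t₂ => t₁.eval σ < t₂.eval σ
  | .eq t₁ t₂ => t₁.eval σ = t₂.eval σ
  | .rle t₁ t₂ => t₁.eval σ ≤ t₂.eval σ

def Test.cost : Test → ℕ
  | .lt t₁ t₂ => 1 + t₁.cost + t₂.cost
  | .eq t₁ t₂ => 1 + t₁.cost + t₂.cost
  | .rle t₁ t₂ => 1 + t₁.cost + t₂.cost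

/-- Programs. -/
inductive Cmd
  | skip
  | set (v : Reg) (t : NExp)
  | put (a : Arr) (ix : List Reg) (t : NExp)
  | rset (v : RReg) (t : RExp)
  | rput (a : RArr) (ix : List Reg) (t : RExp)
  | seq (c₁ c₂ : Cmd)
  | ite (b : Test) (c₁ c₂ : Cmd)
  | while (b : Test) (c : Cmd)

/-- `Exec c σ τ n`: started in the state `σ`, the program `c` terminates in the state `τ` after
exactly `n` steps. -/
inductive Exec : Cmd → State → State → ℕ → Prop
  | skip (σ : State) : Exec .skip σ σ 1
  | set (σ : State) (v : Reg) (t : NExp) :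
      Exec (.set v t) σ (σ.setReg v (t.eval σ)) (1 + t.cost)
  | put (σ : State) (a : Arr) (ix : List Reg) (t : NExp) :
      Exec (.put a ix t) σ (σ.setArr a (ix.map σ.reg) (t.eval σ)) (1 + ix.length + t.cost)
  | rset (σ : State) (v : RReg) (t : RExp) :
      Exec (.rset v t) σ (σ.setRReg v (t.eval σ)) (1 + t.cost)
  | rput (σ : State) (a : RArr) (ix : List Reg) (t : RExp) :
      Exec (.rput a ix t) σ (σ.setRArr a (ix.map σ.reg) (t.eval σ)) (1 + ix.length + t.cost)
  | seq {c₁ c₂ : Cmd} {σ₁ σ₂ σ₃ : State} {n₁ n₂ : ℕ} :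
      Exec c₁ σ₁ σ₂ n₁ → Exec c₂ σ₂ σ₃ n₂ → Exec (.seq c₁ c₂) σ₁ σ₃ (n₁ + n₂)
  | ite_true {b : Test} {c₁ c₂ : Cmd} {σ τ : State} {n : ℕ} :
      b.Holds σ → Exec c₁ σ τ n → Exec (.ite b c₁ c₂) σ τ (b.cost + n)
  | ite_false {b : Test} {c₁ c₂ : Cmd} {σ τ : State} {n : ℕ} :
      ¬ b.Holds σ → Exec c₂ σ τ n → Exec (.ite b c₁ c₂) σ τ (b.cost + n)
  | while_true {b : Test} {c : Cmd} {σ₁ σ₂ σ₃ : State} {n₁ n₂ : ℕ} :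
      b.Holds σ₁ → Exec c σ₁ σ₂ n₁ → Exec (.while b c) σ₂ σ₃ n₂ →
      Exec (.while b c) σ₁ σ₃ (b.cost + n₁ + n₂)
  | while_false {b : Test} {c : Cmd} {σ : State} :
      ¬ b.Holds σ → Exec (.while b c) σ σ b.cost

/-- The machine is deterministic: the final state and the number of steps are unique. -/
theorem Exec.deterministic {c : Cmd} {σ τ₁ τ₂ : State} {n₁ n₂ : ℕ}
    (h₁ : Exec c σ τ₁ n₁) (h₂ : Exec c σ τ₂ n₂) : τ₁ = τ₂ ∧ n₁ = n₂ := by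
  induction h₁ generalizing τ₂ n₂ with
  | skip σ => cases h₂; exact ⟨rfl, rfl⟩
  | set σ v t => cases h₂; exact ⟨rfl, rfl⟩
  | put σ a ix t => cases h₂; exact ⟨rfl, rfl⟩
  | rset σ v t => cases h₂; exact ⟨rfl, rfl⟩
  | rput σ a ix t => cases h₂; exact ⟨rfl, rfl⟩
  | seq _ _ ih₁ ih₂ =>
    cases h₂ with
    | seq k₁ k₂ =>
      obtain ⟨rfl, rfl⟩ := ih₁ k₁
      obtain ⟨rfl, rfl⟩ := ih₂ k₂
      exact ⟨rfl, rfl⟩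
  | ite_true hb _ ih =>
    cases h₂ with
    | ite_true _ k => obtain ⟨rfl, rfl⟩ := ih k; exact ⟨rfl, rfl⟩
    | ite_false hb' _ => exact absurd hb hb'
  | ite_false hb _ ih =>
    cases h₂ with
    | ite_true hb' _ => exact absurd hb' hb
    | ite_false _ k => obtain ⟨rfl, rfl⟩ := ih k; exact ⟨rfl, rfl⟩
  | while_true hb _ _ ih₁ ih₂ =>
    cases h₂ with
    | while_true _ k₁ k₂ =>
      obtain ⟨rfl, rfl⟩ := ih₁ k₁
      obtain ⟨rfl, rfl⟩ := ih₂ k₂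
      exact ⟨rfl, rfl⟩
    | while_false hb' => exact absurd hb hb'
  | while_false hb =>
    cases h₂ with
    | while_true hb' _ _ => exact absurd hb' hb
    | while_false _ => exact ⟨rfl, rfl⟩

/-! ## Derived program constructs -/

namespace Cmd

/-- Sequential composition of a list of programs. -/
def block : List Cmd → Cmd
  | [] => skip
  | [c] => c
  | c :: c' :: cs => seq c (block (c' :: cs))

/-- `if b then c`. -/
def when (b : Test) (c : Cmd) : Cmd := ite b c skip

/-- `for v = 0, ..., t - 1 do c`. -/
def forBelow (v : Reg) (t : NExp) (c : Cmd) : Cmd :=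
  block [
    set v (.lit 0),
    .while (.lt (.reg v) t) (block [c, set v (.succ (.reg v))])]

/-- Append the value of `v` at the end of the vector `a[ix]`, whose length is `aLen[ix]`. -/
def push (a aLen : Arr) (ix : List Reg) (v : Reg) : Cmd :=
  block [
    set .len (.get aLen ix),
    put a (ix ++ [.len]) (.reg v),
    put aLen ix (.succ (.reg .len))]

/-- Sort the vector `a[ix]`, whose length is `aLen[ix]`, in ascending order with respect to the
degree `deg v` of the element `v` (insertion sort). -/
def sortVec (a aLen : Arr) (ix : List Reg) (deg : Reg → RExp) : Cmd :=
  forBelow .i (.get aLen ix) (block [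
    set .cur (.get a (ix ++ [.i])),
    set .j (.reg .i),
    set .go (.lit 1),
    .while (.eq (.reg .go) (.lit 1))
      (ite (.eq (.reg .j) (.lit 0))
        (set .go (.lit 0))
        (block [
          set .jPred (.pred (.reg .j)),
          set .other (.get a (ix ++ [.jPred])),
          ite (.rle (deg .other) (deg .cur))
            (set .go (.lit 0))
            (block [
              put a (ix ++ [.j]) (.reg .other),
              set .j (.reg .jPred)])])),
    put a (ix ++ [.j]) (.reg .cur)])

/-- Append a new element with key `yP` at the end of the doubly linked list `rcNext'[r,y,x']`. -/
def appendElem : Cmd :=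
  block [
    set .u (.reg .free),
    set .free (.succ (.reg .free)),
    put .key [.u] (.reg .yP),
    set .pr (.get .rcLast [.r, .y, .xP]),
    put .pred [.u] (.reg .pr),
    put .succ [.u] (.lit 0),
    ite (.eq (.reg .pr) (.lit 0))
      (put .rcFirst [.r, .y, .xP] (.reg .u))
      (put .succ [.pr] (.reg .u)),
    put .rcLast [.r, .y, .xP] (.reg .u)]

/-- Delete the element `u` from the doubly linked list `rcNext'[r,y,x']`. -/
def deleteElem : Cmd :=
  block [
    set .pr (.get .pred [.u]),
    set .nx (.get .succ [.u]),
    ite (.eq (.reg .pr) (.lit 0))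
      (put .rcFirst [.r, .y, .xP] (.reg .nx))
      (put .succ [.pr] (.reg .nx)),
    ite (.eq (.reg .nx) (.lit 0))
      (put .rcLast [.r, .y, .xP] (.reg .pr))
      (put .pred [.nx] (.reg .pr))]

/-! ## The algorithm -/

/-- `UpdateRcPrev(r, y, x')`; leaving the loop is implemented by the register `go`. -/
def updateRcPrev : Cmd :=
  block [
    ite (.eq (.get .rcLast [.r, .y, .xP]) (.lit 0))
      (rset .d .zero)
      (block [
        set .u (.get .rcLast [.r, .y, .xP]),
        set .zP (.get .key [.u]),
        rset .d (.get .EP [.xP, .r, .zP])]),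
    set .go (.lit 1),
    .while (.eq (.reg .go) (.lit 1))
      (ite (.eq (.get .rcPrevLen [.r, .y, .xP]) (.lit 0))
        (set .go (.lit 0))
        (block [
          set .len (.pred (.get .rcPrevLen [.r, .y, .xP])),
          set .x (.get .rcPrev [.r, .y, .xP, .len]),
          ite (.rle (.get .E [.x, .r, .y]) (.reg .d))
            (set .go (.lit 0))
            (block [
              put .rcPrevLen [.r, .y, .xP] (.reg .len),
              when (.eq (.get .Z [.x, .xP]) (.lit 1)) (block [
                put .Z [.x, .xP] (.lit 0),
                put .queueFst [.tail] (.reg .x),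
                put .queueSnd [.tail] (.reg .xP),
                set .tail (.succ (.reg .tail))])])]))]

/-- Construct `Next'`, `Prev`, `Prev'`, `E`, `E'` and `EdgeID'` from the input. -/
def constructArrays : Cmd :=
  block [
    forBelow .r (.reg .numSE) (block [
      forBelow .y (.reg .numV) (block [
        put .prevLen [.r, .y] (.lit 0),
        forBelow .x (.reg .numV) (rput .E [.x, .r, .y] .zero)]),
      forBelow .yP (.reg .numVP) (block [
        put .nextPLen [.r, .yP] (.lit 0),
        put .prevPLen [.r, .yP] (.lit 0),
        forBelow .xP (.reg .numVP) (rput .EP [.xP, .r, .yP] .zero)])]),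
    forBelow .e (.reg .numE) (block [
      set .x (.get .srcE [.e]),
      set .r (.get .lblE [.e]),
      set .y (.get .dstE [.e]),
      rput .E [.x, .r, .y] (.get .degE [.e]),
      push .prev .prevLen [.r, .y] .x]),
    forBelow .e (.reg .numEP) (block [
      set .xP (.get .srcEP [.e]),
      set .r (.get .lblEP [.e]),
      set .yP (.get .dstEP [.e]),
      rput .EP [.xP, .r, .yP] (.get .degEP [.e]),
      put .edgeIdP [.xP, .r, .yP] (.reg .e),
      push .nextP .nextPLen [.r, .xP] .yP,
      push .prevP .prevPLen [.r, .yP] .xP])]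

/-- `Z[x,x'] := (L(x) ≤ L'(x'))` for all `x` and `x'`. -/
def initZ : Cmd :=
  forBelow .x (.reg .numV) (forBelow .xP (.reg .numVP) (block [
    put .Z [.x, .xP] (.lit 1),
    forBelow .s (.reg .numSV)
      (ite (.rle (.get .L [.x, .s]) (.get .LP [.xP, .s]))
        skip
        (put .Z [.x, .xP] (.lit 0)))]))

/-- Construct the vector `rcPrev[r,y,x']` and the list `rcNext'[r,y,x']`, and store references to
the elements of that list in `rcNextElem'`. -/
def constructRc : Cmd :=
  block [
    put .rcPrevLen [.r, .y, .xP] (.lit 0),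
    forBelow .i (.get .prevLen [.r, .y]) (block [
      set .x (.get .prev [.r, .y, .i]),
      when (.eq (.get .Z [.x, .xP]) (.lit 1)) (push .rcPrev .rcPrevLen [.r, .y, .xP] .x)]),
    put .rcFirst [.r, .y, .xP] (.lit 0),
    put .rcLast [.r, .y, .xP] (.lit 0),
    forBelow .i (.get .nextPLen [.r, .xP]) (block [
      set .yP (.get .nextP [.r, .xP, .i]),
      when (.eq (.get .Z [.y, .yP]) (.lit 1)) appendElem]),
    set .u (.get .rcFirst [.r, .y, .xP]),
    .while (.lt (.lit 0) (.reg .u)) (block [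
      set .yP (.get .key [.u]),
      set .e (.get .edgeIdP [.xP, .r, .yP]),
      put .rcNextElemP [.y, .e] (.reg .u),
      set .u (.get .succ [.u])])]

/-- `Initialize()`. -/
def initializeAll : Cmd :=
  block [
    constructArrays,
    initZ,
    set .head (.lit 0),
    set .tail (.lit 0),
    forBelow .r (.reg .numSE) (forBelow .xP (.reg .numVP)
      (sortVec .nextP .nextPLen [.r, .xP] (fun v => .get .EP [.xP, .r, v]))),
    forBelow .r (.reg .numSE) (forBelow .y (.reg .numV)
      (sortVec .prev .prevLen [.r, .y] (fun v => .get .E [v, .r, .y]))),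
    forBelow .y (.reg .numV) (forBelow .e (.reg .numEP) (put .rcNextElemP [.y, .e] (.lit 0))),
    set .free (.lit 1),
    forBelow .r (.reg .numSE) (forBelow .y (.reg .numV) (forBelow .xP (.reg .numVP)
      constructRc)),
    forBelow .r (.reg .numSE) (forBelow .y (.reg .numV) (forBelow .xP (.reg .numVP)
      updateRcPrev))]

/-- Return the relation corresponding to `Z`, as a list of pairs. -/
def returnZ : Cmd :=
  block [
    set .outLen (.lit 0),
    forBelow .x (.reg .numV) (forBelow .xP (.reg .numVP)
      (when (.eq (.get .Z [.x, .xP]) (.lit 1)) (block [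
        put .outFst [.outLen] (.reg .x),
        put .outSnd [.outLen] (.reg .xP),
        set .outLen (.succ (.reg .outLen))])))]

/-- The algorithm `ComputeSimulationEfficiently`. -/
def computeSimulationEfficiently : Cmd :=
  block [
    initializeAll,
    .while (.lt (.reg .head) (.reg .tail)) (block [
      set .y (.get .queueFst [.head]),
      set .yP (.get .queueSnd [.head]),
      set .head (.succ (.reg .head)),
      forBelow .r (.reg .numSE) (forBelow .i (.get .prevPLen [.r, .yP]) (block [
        set .xP (.get .prevP [.r, .yP, .i]),
        set .e (.get .edgeIdP [.xP, .r, .yP]),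
        set .u (.get .rcNextElemP [.y, .e]),
        deleteElem,
        put .rcNextElemP [.y, .e] (.lit 0),
        updateRcPrev]))]),
    returnZ]

end Cmd

/-! ## Input and output -/

/-- A numbering of the elements of a finite set by `0, ..., |α| - 1`. -/
abbrev Numbering (α : Type*) [Fintype α] := α ≃ Fin (Fintype.card α)

/-- The graph `G` is stored in the state `σ`: register `nV` holds the number of vertices, `nE` the
number of nonzero edges, the arrays `src`, `lbl`, `dst`, `deg` list the nonzero edges with their
degrees (in any order, each edge once), and `lab` holds the labels of the vertices. -/
structure GraphLoaded {V SE SV : Type*} [Fintype V] [Fintype SE] [Fintype SV]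
    (νV : Numbering V) (νE : Numbering SE) (νL : Numbering SV) (G : FuzzyGraph V SE SV)
    (nV nE : Reg) (src lbl dst : Arr) (deg lab : RArr) (σ : State) : Prop where
  card_eq : σ.reg nV = Fintype.card V
  edges : ∃ es : List (V × SE × V), es.Nodup ∧
    (∀ x r y, (x, r, y) ∈ es ↔ 0 < G.E x r y) ∧
    σ.reg nE = es.length ∧
    ∀ (i : ℕ) (hi : i < es.length),
      σ.arr src [i] = (νV es[i].1 : ℕ) ∧
      σ.arr lbl [i] = (νE es[i].2.1 : ℕ) ∧
      σ.arr dst [i] = (νV es[i].2.2 : ℕ) ∧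
      σ.rarr deg [i] = (G.E es[i].1 es[i].2.1 es[i].2.2 : ℝ)
  labels : ∀ x s, σ.rarr lab [(νV x : ℕ), (νL s : ℕ)] = (G.L x s : ℝ)

/-- The state `σ` holds the input `G`, `G'`; registers and arrays that do not belong to the input
have arbitrary contents. -/
structure InputLoaded {V V' SE SV : Type*} [Fintype V] [Fintype V'] [Fintype SE] [Fintype SV]
    (νV : Numbering V) (νV' : Numbering V') (νE : Numbering SE) (νL : Numbering SV)
    (G : FuzzyGraph V SE SV) (G' : FuzzyGraph V' SE SV) (σ : State) : Prop where
  numSE_eq : σ.reg .numSE = Fintype.card SE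
  numSV_eq : σ.reg .numSV = Fintype.card SV
  left : GraphLoaded νV νE νL G .numV .numE .srcE .lblE .dstE .degE .L σ
  right : GraphLoaded νV' νE νL G' .numVP .numEP .srcEP .lblEP .dstEP .degEP .LP σ

/-- The list of pairs returned in the state `σ` consists of (the numbers of) exactly the pairs
in `Z`. -/
def Returns {V V' : Type*} [Fintype V] [Fintype V'] (νV : Numbering V) (νV' : Numbering V')
    (σ : State) (Z : Set (V × V')) : Prop :=
  ∀ a b : ℕ, (∃ i < σ.reg .outLen, σ.arr .outFst [i] = a ∧ σ.arr .outSnd [i] = b) ↔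
    ∃ x x', (x, x') ∈ Z ∧ (νV x : ℕ) = a ∧ (νV' x' : ℕ) = b

end FuzzySim

/-!
The algorithm is correct and fast enough for three reasons.

* A pair is removed from `Z` only if no simulation contains it: for some edge `(x,r,y)` no edge
  `(x',r,y')` with a key `y'` of `rcNext'[r,y,x']` has a sufficient degree, and these keys comprise
  all successors `y'` of `x'` with `Z[y,y']`. So every simulation remains a part of `Z` (`WorkInv`).
* The keys of `rcNext'[r,y,x']` are those successors `y'` of `x'` for which `Z[y,y']` holds or
  `(y,y')` still waits in the queue (`Pending`); each edge `(x,r,y)` with `Z[x,x']` is matched by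
  an edge from `x'` to such a key (`LoopInv`). When the queue is empty, the keys satisfy
  `Z[y,y']`, hence `Z` is a simulation, and by the first item the largest one (`runs_mainLoop`).
* As `rcNext'[r,y,x']` is sorted, its last element has the largest degree, and as `rcPrev[r,y,x']`
  is sorted, the elements to be deleted from it form a final segment. So `UpdateRcPrev` spends a
  bounded number of steps besides those for the deleted elements (`runs_updateRcPrev`).

The deletions in `UpdateRcPrev` are paid for by a potential, the total length of all vectors
`rcPrev[r,y,x']`, which is at most `|V'| * |E|` initially. A pair enters the queue at most once, so
the main loop handles at most `|V|` pairs `(y,y')` for each vertex `y'` and calls `UpdateRcPrev` at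
most `|V| * |E'|` times. Insertion sort of a vector of length `l` takes `O(l * l)` steps, and the
lengths of the vectors `Next'[r,x']` and `Prev[r,y]` are bounded by the numbers of vertices and sum
up to `|E'|` and `|E|`, so that sorting takes `O(|E'| * |V'| + |E| * |V|)` steps. The remaining
loops run over edges, over pairs of a vertex and an edge, or over pairs of vertices and labels.

The programs are verified by rules for total correctness (`Runs`) that carry a bound on the number
of steps, such as `Runs.while` and `Runs.forBelow`; what a program does not assign to is unchanged
(`Exec.frame`). All invariants refer to graphs on initial segments of the natural numbers
(`NumberedPair`). The doubly linked lists are described by the sets of the addresses of their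
elements (`IsDll`, `RcLists`); addresses increase along every list, since elements are only ever
appended with fresh addresses.
-/

namespace FuzzySim

/-! ### Frame conditions -/

namespace Cmd

/-- Whether the program contains an assignment to the register `v`. -/
def writesReg : Cmd → Reg → Bool
  | set w _, v => decide (v = w)
  | seq c₁ c₂, v => c₁.writesReg v || c₂.writesReg v
  | ite _ c₁ c₂, v => c₁.writesReg v || c₂.writesReg v
  | .while _ c, v => c.writesReg v
  | _, _ => false

/-- Whether the program contains an assignment to a cell of the array `a`. -/
def writesArr : Cmd → Arr → Bool
  | put b _ _, a => decide (a = b)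
  | seq c₁ c₂, a => c₁.writesArr a || c₂.writesArr a
  | ite _ c₁ c₂, a => c₁.writesArr a || c₂.writesArr a
  | .while _ c, a => c.writesArr a
  | _, _ => false

/-- Whether the program contains an assignment to a cell of the real array `a`. -/
def writesRArr : Cmd → RArr → Bool
  | rput b _ _, a => decide (a = b)
  | seq c₁ c₂, a => c₁.writesRArr a || c₂.writesRArr a
  | ite _ c₁ c₂, a => c₁.writesRArr a || c₂.writesRArr a
  | .while _ c, a => c.writesRArr a
  | _, _ => false

/-- Whether the program contains an assignment to a real register. -/
def writesRReg : Cmd → Bool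
  | rset _ _ => true
  | seq c₁ c₂ => c₁.writesRReg || c₂.writesRReg
  | ite _ c₁ c₂ => c₁.writesRReg || c₂.writesRReg
  | .while _ c => c.writesRReg
  | _ => false

end Cmd

/-- The states `σ` and `τ` agree on everything that `c` does not assign to. -/
structure Frame (c : Cmd) (σ τ : State) : Prop where
  reg : ∀ v, c.writesReg v = false → τ.reg v = σ.reg v
  arr : ∀ a, c.writesArr a = false → τ.arr a = σ.arr a
  rarr : ∀ a, c.writesRArr a = false → τ.rarr a = σ.rarr a
  rreg : ∀ v, c.writesRReg = false → τ.rreg v = σ.rreg v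

theorem Frame.refl (c : Cmd) (σ : State) : Frame c σ σ :=
  ⟨fun _ _ => rfl, fun _ _ => rfl, fun _ _ => rfl, fun _ _ => rfl⟩

theorem Frame.trans {c : Cmd} {σ τ ρ : State} (h₁ : Frame c σ τ) (h₂ : Frame c τ ρ) :
    Frame c σ ρ :=
  ⟨fun v h => (h₂.reg v h).trans (h₁.reg v h), fun v h => (h₂.arr v h).trans (h₁.arr v h),
    fun v h => (h₂.rarr v h).trans (h₁.rarr v h), fun v h => (h₂.rreg v h).trans (h₁.rreg v h)⟩

/-- A frame condition for a program is one for every program that writes at least as much. -/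
theorem Frame.weaken {c c' : Cmd} {σ τ : State} (h : Frame c σ τ)
    (h₁ : ∀ v, c'.writesReg v = false → c.writesReg v = false)
    (h₂ : ∀ v, c'.writesArr v = false → c.writesArr v = false)
    (h₃ : ∀ v, c'.writesRArr v = false → c.writesRArr v = false)
    (h₄ : c'.writesRReg = false → c.writesRReg = false) : Frame c' σ τ :=
  ⟨fun v k => h.reg v (h₁ v k), fun v k => h.arr v (h₂ v k), fun v k => h.rarr v (h₃ v k),
    fun v k => h.rreg v (h₄ k)⟩

/-- A program changes nothing that it does not assign to. -/
theorem Exec.frame {c : Cmd} {σ τ : State} {n : ℕ} (h : Exec c σ τ n) : Frame c σ τ := by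
  induction h with
  | skip σ => exact .refl _ _
  | set σ v t =>
    refine ⟨fun w h => ?_, fun _ _ => rfl, fun _ _ => rfl, fun _ _ => rfl⟩
    simp only [Cmd.writesReg, decide_eq_false_iff_not] at h
    simp [State.setReg, h]
  | put σ a ix t =>
    refine ⟨fun _ _ => rfl, fun w h => ?_, fun _ _ => rfl, fun _ _ => rfl⟩
    simp only [Cmd.writesArr, decide_eq_false_iff_not] at h
    simp [State.setArr, h]
  | rset σ v t => exact ⟨fun _ _ => rfl, fun _ _ => rfl, fun _ _ => rfl, fun _ h => by cases h⟩
  | rput σ a ix t =>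
    refine ⟨fun _ _ => rfl, fun _ _ => rfl, fun w h => ?_, fun _ _ => rfl⟩
    simp only [Cmd.writesRArr, decide_eq_false_iff_not] at h
    simp [State.setRArr, h]
  | seq _ _ ih₁ ih₂ =>
    refine (ih₁.weaken ?_ ?_ ?_ ?_).trans (ih₂.weaken ?_ ?_ ?_ ?_) <;>
      simp +contextual [Cmd.writesReg, Cmd.writesArr, Cmd.writesRArr, Cmd.writesRReg]
  | ite_true _ _ ih =>
    refine ih.weaken ?_ ?_ ?_ ?_ <;>
      simp +contextual [Cmd.writesReg, Cmd.writesArr, Cmd.writesRArr, Cmd.writesRReg]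
  | ite_false _ _ ih =>
    refine ih.weaken ?_ ?_ ?_ ?_ <;>
      simp +contextual [Cmd.writesReg, Cmd.writesArr, Cmd.writesRArr, Cmd.writesRReg]
  | while_true _ _ _ ih₁ ih₂ =>
    refine (ih₁.weaken ?_ ?_ ?_ ?_).trans ih₂ <;>
      simp [Cmd.writesReg, Cmd.writesArr, Cmd.writesRArr, Cmd.writesRReg]
  | while_false _ => exact .refl _ _

/-! ### Total correctness with a step count -/

/-- Started in `σ`, the program `c` terminates, and its final state and its number of steps
satisfy `Q`. -/
def Runs (c : Cmd) (σ : State) (Q : State → ℕ → Prop) : Prop :=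
  ∃ τ n, Exec c σ τ n ∧ Q τ n

/-- The consequence rule, which also makes the frame condition of the program available. -/
theorem Runs.mono {c : Cmd} {σ : State} {Q R : State → ℕ → Prop} (h : Runs c σ Q)
    (hQR : ∀ τ n, Frame c σ τ → Q τ n → R τ n) : Runs c σ R := by
  obtain ⟨τ, n, he, hq⟩ := h
  exact ⟨τ, n, he, hQR τ n he.frame hq⟩

theorem runs_skip {σ : State} {Q : State → ℕ → Prop} : Runs .skip σ Q ↔ Q σ 1 :=
  ⟨fun ⟨_, _, h, hq⟩ => by cases h; exact hq, fun h => ⟨_, _, .skip σ, h⟩⟩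

theorem runs_set {σ : State} {v : Reg} {t : NExp} {Q : State → ℕ → Prop} :
    Runs (.set v t) σ Q ↔ Q (σ.setReg v (t.eval σ)) (1 + t.cost) :=
  ⟨fun ⟨_, _, h, hq⟩ => by cases h; exact hq, fun h => ⟨_, _, .set σ v t, h⟩⟩

theorem runs_put {σ : State} {a : Arr} {ix : List Reg} {t : NExp} {Q : State → ℕ → Prop} :
    Runs (.put a ix t) σ Q ↔
      Q (σ.setArr a (ix.map σ.reg) (t.eval σ)) (1 + ix.length + t.cost) :=
  ⟨fun ⟨_, _, h, hq⟩ => by cases h; exact hq, fun h => ⟨_, _, .put σ a ix t, h⟩⟩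

theorem runs_rset {σ : State} {v : RReg} {t : RExp} {Q : State → ℕ → Prop} :
    Runs (.rset v t) σ Q ↔ Q (σ.setRReg v (t.eval σ)) (1 + t.cost) :=
  ⟨fun ⟨_, _, h, hq⟩ => by cases h; exact hq, fun h => ⟨_, _, .rset σ v t, h⟩⟩

theorem runs_rput {σ : State} {a : RArr} {ix : List Reg} {t : RExp} {Q : State → ℕ → Prop} :
    Runs (.rput a ix t) σ Q ↔
      Q (σ.setRArr a (ix.map σ.reg) (t.eval σ)) (1 + ix.length + t.cost) :=
  ⟨fun ⟨_, _, h, hq⟩ => by cases h; exact hq, fun h => ⟨_, _, .rput σ a ix t, h⟩⟩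

theorem runs_seq {σ : State} {c₁ c₂ : Cmd} {Q : State → ℕ → Prop} :
    Runs (.seq c₁ c₂) σ Q ↔ Runs c₁ σ (fun τ n => Runs c₂ τ (fun ρ m => Q ρ (n + m))) :=
  ⟨fun ⟨_, _, h, hq⟩ => by
    cases h with
    | seq h₁ h₂ => exact ⟨_, _, h₁, _, _, h₂, hq⟩,
  fun ⟨_, _, h₁, _, _, h₂, hq⟩ => ⟨_, _, .seq h₁ h₂, hq⟩⟩

theorem runs_ite {σ : State} {b : Test} {c₁ c₂ : Cmd} {Q : State → ℕ → Prop} :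
    Runs (.ite b c₁ c₂) σ Q ↔
      (b.Holds σ → Runs c₁ σ (fun τ n => Q τ (b.cost + n))) ∧
      (¬ b.Holds σ → Runs c₂ σ (fun τ n => Q τ (b.cost + n))) := by
  constructor
  · rintro ⟨_, _, h, hq⟩
    cases h with
    | ite_true hb h => exact ⟨fun _ => ⟨_, _, h, hq⟩, fun hb' => absurd hb hb'⟩
    | ite_false hb h => exact ⟨fun hb' => absurd hb' hb, fun _ => ⟨_, _, h, hq⟩⟩
  · rintro ⟨h₁, h₂⟩
    by_cases hb : b.Holds σ
    · obtain ⟨τ, n, h, hq⟩ := h₁ hb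
      exact ⟨_, _, .ite_true hb h, hq⟩
    · obtain ⟨τ, n, h, hq⟩ := h₂ hb
      exact ⟨_, _, .ite_false hb h, hq⟩

/-- Sequential composition, when a specification of the first program is known. -/
theorem Runs.seq {σ : State} {c₁ c₂ : Cmd} {Q₁ Q : State → ℕ → Prop} (h₁ : Runs c₁ σ Q₁)
    (h₂ : ∀ τ n, Frame c₁ σ τ → Q₁ τ n → Runs c₂ τ (fun ρ m => Q ρ (n + m))) :
    Runs (.seq c₁ c₂) σ Q :=
  runs_seq.2 (h₁.mono h₂)

theorem runs_block_cons {σ : State} {c c' : Cmd} {cs : List Cmd} {Q : State → ℕ → Prop} :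
    Runs (.block (c :: c' :: cs)) σ Q ↔ Runs (.seq c (.block (c' :: cs))) σ Q := Iff.rfl

theorem runs_block_cons_cons {σ : State} {c₁ c₂ c₃ : Cmd} {cs : List Cmd}
    {Q : State → ℕ → Prop} : Runs (.block (c₁ :: c₂ :: c₃ :: cs)) σ Q ↔
      Runs (.seq (.block [c₁, c₂]) (.block (c₃ :: cs))) σ Q := by
  simp only [Cmd.block, runs_seq, add_assoc]

theorem runs_block_cons_cons_cons {σ : State} {c₁ c₂ c₃ c₄ : Cmd} {cs : List Cmd}
    {Q : State → ℕ → Prop} : Runs (.block (c₁ :: c₂ :: c₃ :: c₄ :: cs)) σ Q ↔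
      Runs (.seq (.block [c₁, c₂, c₃]) (.block (c₄ :: cs))) σ Q := by
  simp only [Cmd.block, runs_seq, add_assoc]

/-- Loop rule: `I τ m` holds whenever the test is reached in the state `τ` after `m` steps.
Since every iteration costs at least one step, the bound `B` on the number of steps makes a
termination measure superfluous. -/
theorem Runs.while {σ : State} {b : Test} {c : Cmd} {Q : State → ℕ → Prop}
    (I : State → ℕ → Prop) (B : ℕ) (h0 : I σ 0) (hB : ∀ τ m, I τ m → m ≤ B)
    (hstep : ∀ τ m, Frame c σ τ → I τ m → b.Holds τ →
      Runs c τ (fun τ' k => I τ' (m + b.cost + k)))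
    (hpost : ∀ τ m, Frame c σ τ → I τ m → ¬ b.Holds τ → Q τ (m + b.cost)) :
    Runs (.while b c) σ Q := by
  have hc : 0 < b.cost := by cases b <;> simp [Test.cost]
  suffices H : ∀ d τ m, B - m ≤ d → Frame c σ τ → I τ m →
      Runs (.while b c) τ (fun ρ k => Q ρ (m + k)) by
    obtain ⟨τ, n, h, hq⟩ := H B σ 0 (by omega) (.refl _ _) h0
    exact ⟨τ, n, h, by simpa using hq⟩
  intro d
  induction d with
  | zero =>
    intro τ m hd hF hI
    by_cases hb : b.Holds τ
    · obtain ⟨τ', k, h, hI'⟩ := hstep τ m hF hI hb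
      have := hB _ _ hI'
      omega
    · exact ⟨τ, _, .while_false hb, hpost τ m hF hI hb⟩
  | succ d ih =>
    intro τ m hd hF hI
    by_cases hb : b.Holds τ
    · obtain ⟨τ', k, h, hI'⟩ := hstep τ m hF hI hb
      obtain ⟨ρ, j, h', hq⟩ := ih τ' _ (by have := hB _ _ hI'; omega) (hF.trans h.frame) hI'
      exact ⟨ρ, _, .while_true hb h h', by simpa only [add_assoc] using hq⟩
    · exact ⟨τ, _, .while_false hb, hpost τ m hF hI hb⟩

section StateLemmas

variable (σ : State)

@[simp] theorem setReg_reg (v w : Reg) (n : ℕ) :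
    (σ.setReg v n).reg w = if w = v then n else σ.reg w := by
  simp [State.setReg, Function.update_apply]
@[simp] theorem setReg_arr (v : Reg) (n : ℕ) : (σ.setReg v n).arr = σ.arr := rfl
@[simp] theorem setReg_rarr (v : Reg) (n : ℕ) : (σ.setReg v n).rarr = σ.rarr := rfl
@[simp] theorem setReg_rreg (v : Reg) (n : ℕ) : (σ.setReg v n).rreg = σ.rreg := rfl
@[simp] theorem setArr_reg (a : Arr) (ix : List ℕ) (n : ℕ) :
    (σ.setArr a ix n).reg = σ.reg := rfl
@[simp] theorem setArr_arr (a b : Arr) (ix : List ℕ) (n : ℕ) :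
    (σ.setArr a ix n).arr b = if b = a then Function.update (σ.arr b) ix n else σ.arr b := by
  by_cases h : b = a
  · subst h; simp [State.setArr]
  · simp [State.setArr, h]
@[simp] theorem setArr_rarr (a : Arr) (ix : List ℕ) (n : ℕ) :
    (σ.setArr a ix n).rarr = σ.rarr := rfl
@[simp] theorem setRReg_reg (v : RReg) (q : ℝ) : (σ.setRReg v q).reg = σ.reg := rfl
@[simp] theorem setRReg_arr (v : RReg) (q : ℝ) : (σ.setRReg v q).arr = σ.arr := rfl
@[simp] theorem setRReg_rreg (v : RReg) (q : ℝ) : (σ.setRReg v q).rreg v = q := by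
  simp [State.setRReg]
@[simp] theorem setRArr_reg (a : RArr) (ix : List ℕ) (q : ℝ) :
    (σ.setRArr a ix q).reg = σ.reg := rfl
@[simp] theorem setRArr_arr (a : RArr) (ix : List ℕ) (q : ℝ) :
    (σ.setRArr a ix q).arr = σ.arr := rfl
@[simp] theorem setRArr_rarr (a b : RArr) (ix : List ℕ) (q : ℝ) :
    (σ.setRArr a ix q).rarr b = if b = a then Function.update (σ.rarr b) ix q else σ.rarr b := by
  by_cases h : b = a
  · subst h; simp [State.setRArr]
  · simp [State.setRArr, h]

end StateLemmas

/-! ### Rules for counting loops -/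

/-- Loop rule for `forBelow`: besides an invariant it yields a bound on the number of steps,
amortized with respect to a potential `Φ` of the arrays. -/
theorem Runs.forBelow {v : Reg} {t : NExp} {c : Cmd} {σ : State} (n : ℕ)
    (I : ℕ → State → Prop) (f : ℕ → ℕ) (Φ : (Arr → List ℕ → ℕ) → ℕ)
    (hv : c.writesReg v = false)
    (ht : ∀ τ, Frame (.forBelow v t c) σ τ → t.eval τ = n)
    (h0 : I 0 (σ.setReg v 0))
    (hstep : ∀ k < n, ∀ τ, Frame (.forBelow v t c) σ τ → τ.reg v = k → I k τ →
      Runs c τ (fun τ' m => I (k + 1) (τ'.setReg v (k + 1)) ∧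
        m + Φ τ'.arr ≤ f k + Φ τ.arr)) :
    Runs (.forBelow v t c) σ (fun τ m => I n τ ∧
      m + Φ τ.arr ≤ (4 + t.cost + ∑ k ∈ Finset.range n, (f k + (5 + t.cost))) + Φ σ.arr) := by
  have hfr : Frame (.forBelow v t c) σ (σ.setReg v 0) := by
    refine ⟨fun w hw => ?_, fun _ _ => rfl, fun _ _ => rfl, fun _ _ => rfl⟩
    have : w ≠ v := by
      rintro rfl
      simp [Cmd.forBelow, Cmd.block, Cmd.writesReg] at hw
    simp [this]
  have hfr' : ∀ τ, Frame (.block [c, .set v (.succ (.reg v))]) (σ.setReg v 0) τ →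
      Frame (.forBelow v t c) σ τ := fun τ h => hfr.trans <| by
    refine h.weaken ?_ ?_ ?_ ?_ <;>
      simp [Cmd.forBelow, Cmd.block, Cmd.writesReg, Cmd.writesArr, Cmd.writesRArr, Cmd.writesRReg]
  rw [Cmd.forBelow, Cmd.block, Cmd.block, runs_seq, runs_set]
  refine Runs.while (fun τ m => ∃ k ≤ n, τ.reg v = k ∧ I k τ ∧
    m + Φ τ.arr ≤ (∑ k ∈ Finset.range k, (f k + (5 + t.cost))) + Φ σ.arr)
    ((∑ k ∈ Finset.range n, (f k + (5 + t.cost))) + Φ σ.arr) ?_ ?_ ?_ ?_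
  · exact ⟨0, by omega, by simp [NExp.eval], h0, by simp⟩
  · rintro τ m ⟨k, hk, -, -, hm⟩
    have := Finset.sum_le_sum_of_subset (f := fun k => f k + (5 + t.cost))
      (Finset.range_mono hk)
    omega
  · rintro τ m hF ⟨k, hk, hvk, hI, hm⟩ hb
    have hF' := hfr' τ hF
    simp only [Test.Holds, NExp.eval, hvk, ht τ hF'] at hb
    rw [Cmd.block, Cmd.block, runs_seq]
    refine (hstep k hb τ hF' hvk hI).mono ?_
    rintro τ' m' hF'' ⟨hI', hm'⟩
    rw [runs_set]
    have e : τ'.reg v = k := by rw [hF''.reg v hv, hvk]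
    refine ⟨k + 1, hb, by simp [NExp.eval, e], by simpa [NExp.eval, e] using hI', ?_⟩
    rw [Finset.sum_range_succ]
    simp only [Test.cost, NExp.cost, setReg_arr]
    omega
  · rintro τ m hF ⟨k, hk, hvk, hI, hm⟩ hb
    simp only [Test.Holds, NExp.eval, hvk, ht τ (hfr' τ hF)] at hb
    obtain rfl : k = n := by omega
    refine ⟨hI, ?_⟩
    simp only [Test.cost, NExp.cost]
    omega

theorem Frame.forBelow {v : Reg} {t : NExp} {c : Cmd} {σ τ : State} (h : Frame c σ τ) :
    Frame (.forBelow v t c) σ τ := by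
  refine h.weaken ?_ ?_ ?_ ?_ <;>
    simp +contextual [Cmd.forBelow, Cmd.block, Cmd.writesReg, Cmd.writesArr, Cmd.writesRArr,
      Cmd.writesRReg]

/-- Two nested counting loops: the invariant `I D` speaks about the set `D` of the pairs of
counter values that have been dealt with. -/
theorem Runs.forBelow₂ {v₁ v₂ : Reg} {t₁ t₂ : NExp} {c : Cmd} {σ : State} (n₁ n₂ : ℕ)
    (I : Set (ℕ × ℕ) → State → Prop) (f : ℕ → ℕ → ℕ) (Φ : (Arr → List ℕ → ℕ) → ℕ)
    (hv₁ : (Cmd.forBelow v₂ t₂ c).writesReg v₁ = false) (hv₂ : c.writesReg v₂ = false)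
    (ht₁ : ∀ τ, Frame (.forBelow v₁ t₁ (.forBelow v₂ t₂ c)) σ τ → t₁.eval τ = n₁)
    (ht₂ : ∀ τ, Frame (.forBelow v₁ t₁ (.forBelow v₂ t₂ c)) σ τ → t₂.eval τ = n₂)
    (hset : ∀ D τ k, I D τ → I D (τ.setReg v₁ k) ∧ I D (τ.setReg v₂ k))
    (h0 : I ∅ σ)
    (hstep : ∀ a < n₁, ∀ b < n₂, ∀ D τ, Frame (.forBelow v₁ t₁ (.forBelow v₂ t₂ c)) σ τ →
      τ.reg v₁ = a → τ.reg v₂ = b → (a, b) ∉ D → (∀ p ∈ D, p.1 < n₁ ∧ p.2 < n₂) → I D τ →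
      Runs c τ (fun τ' m => I (insert (a, b) D) τ' ∧ m + Φ τ'.arr ≤ f a b + Φ τ.arr)) :
    Runs (.forBelow v₁ t₁ (.forBelow v₂ t₂ c)) σ (fun τ m => I {p | p.1 < n₁ ∧ p.2 < n₂} τ ∧
      m + Φ τ.arr ≤ (4 + t₁.cost + ∑ a ∈ Finset.range n₁,
        ((4 + t₂.cost + ∑ b ∈ Finset.range n₂, (f a b + (5 + t₂.cost))) + (5 + t₁.cost)))
          + Φ σ.arr) := by
  have e0 : ({p | p.1 < 0 ∧ p.2 < n₂} : Set (ℕ × ℕ)) = ∅ := by ext; simp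
  refine Runs.forBelow n₁ (fun k τ => I {p | p.1 < k ∧ p.2 < n₂} τ) _ Φ hv₁ ht₁
    (by simpa only [e0] using (hset _ _ 0 h0).1) fun a ha τ hF hva hI => ?_
  have e1 : ({p | p.1 < a ∧ p.2 < n₂ ∨ p.1 = a ∧ p.2 < 0} : Set (ℕ × ℕ)) =
      {p | p.1 < a ∧ p.2 < n₂} := by ext; simp
  have e2 : ({p | p.1 < a ∧ p.2 < n₂ ∨ p.1 = a ∧ p.2 < n₂} : Set (ℕ × ℕ)) =
      {p | p.1 < a + 1 ∧ p.2 < n₂} := by ext; simp; omega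
  refine (Runs.forBelow n₂ (fun k τ => I {p | p.1 < a ∧ p.2 < n₂ ∨ p.1 = a ∧ p.2 < k} τ)
    (f a) Φ hv₂ (fun τ' hF' => ht₂ τ' (hF.trans hF'.forBelow))
    (by simpa only [e1] using (hset _ _ 0 hI).2) fun b hb τ' hF' hvb hI' => ?_).mono ?_
  · have e3 : insert (a, b) ({p | p.1 < a ∧ p.2 < n₂ ∨ p.1 = a ∧ p.2 < b} : Set (ℕ × ℕ)) =
        {p | p.1 < a ∧ p.2 < n₂ ∨ p.1 = a ∧ p.2 < b + 1} := by
      ext ⟨x, y⟩; simp only [Set.mem_insert_iff, Prod.mk.injEq, Set.mem_ofPred_eq]; omega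
    refine (hstep a ha b hb _ τ' (hF.trans hF'.forBelow) ((hF'.reg _ hv₁).trans hva) hvb
      (by simp) (by rintro ⟨x, y⟩ h; simp only [Set.mem_ofPred_eq] at h ⊢; omega) hI').mono ?_
    rintro ρ m hF'' ⟨h, hm⟩
    rw [e3] at h
    exact ⟨(hset _ _ _ h).2, hm⟩
  · rintro ρ m hF'' ⟨h, hm⟩
    rw [e2] at h
    exact ⟨(hset _ _ _ h).1, hm⟩

/-- Three nested counting loops: the invariant `I D` speaks about the set `D` of the triples of
counter values that have been dealt with. -/
theorem Runs.forBelow₃ {v₁ v₂ v₃ : Reg} {t₁ t₂ t₃ : NExp} {c : Cmd} {σ : State} (n₁ n₂ n₃ : ℕ)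
    (I : Set (ℕ × ℕ × ℕ) → State → Prop) (f : ℕ → ℕ → ℕ → ℕ) (Φ : (Arr → List ℕ → ℕ) → ℕ)
    (hv₁ : (Cmd.forBelow v₂ t₂ (.forBelow v₃ t₃ c)).writesReg v₁ = false)
    (hv₂ : (Cmd.forBelow v₃ t₃ c).writesReg v₂ = false) (hv₃ : c.writesReg v₃ = false)
    (ht₁ : ∀ τ, Frame (.forBelow v₁ t₁ (.forBelow v₂ t₂ (.forBelow v₃ t₃ c))) σ τ →
      t₁.eval τ = n₁)
    (ht₂ : ∀ τ, Frame (.forBelow v₁ t₁ (.forBelow v₂ t₂ (.forBelow v₃ t₃ c))) σ τ →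
      t₂.eval τ = n₂)
    (ht₃ : ∀ τ, Frame (.forBelow v₁ t₁ (.forBelow v₂ t₂ (.forBelow v₃ t₃ c))) σ τ →
      t₃.eval τ = n₃)
    (hset : ∀ D τ k, I D τ →
      I D (τ.setReg v₁ k) ∧ I D (τ.setReg v₂ k) ∧ I D (τ.setReg v₃ k))
    (h0 : I ∅ σ)
    (hstep : ∀ a < n₁, ∀ b < n₂, ∀ d < n₃, ∀ D τ,
      Frame (.forBelow v₁ t₁ (.forBelow v₂ t₂ (.forBelow v₃ t₃ c))) σ τ →
      τ.reg v₁ = a → τ.reg v₂ = b → τ.reg v₃ = d → (a, b, d) ∉ D →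
      (∀ p ∈ D, p.1 < n₁ ∧ p.2.1 < n₂ ∧ p.2.2 < n₃) → I D τ →
      Runs c τ (fun τ' m => I (insert (a, b, d) D) τ' ∧ m + Φ τ'.arr ≤ f a b d + Φ τ.arr)) :
    Runs (.forBelow v₁ t₁ (.forBelow v₂ t₂ (.forBelow v₃ t₃ c))) σ (fun τ m =>
      I {p | p.1 < n₁ ∧ p.2.1 < n₂ ∧ p.2.2 < n₃} τ ∧
      m + Φ τ.arr ≤ (4 + t₁.cost + ∑ a ∈ Finset.range n₁,
        ((4 + t₂.cost + ∑ b ∈ Finset.range n₂,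
          ((4 + t₃.cost + ∑ d ∈ Finset.range n₃, (f a b d + (5 + t₃.cost))) + (5 + t₂.cost)))
          + (5 + t₁.cost))) + Φ σ.arr) := by
  have e0 : ({p | p.1 < 0 ∧ p.2.1 < n₂ ∧ p.2.2 < n₃} : Set (ℕ × ℕ × ℕ)) = ∅ := by ext; simp
  refine Runs.forBelow n₁ (fun k τ => I {p | p.1 < k ∧ p.2.1 < n₂ ∧ p.2.2 < n₃} τ) _ Φ hv₁ ht₁
    (by simpa only [e0] using (hset _ _ 0 h0).1) fun a ha τ hF hva hI => ?_
  let J : Set (ℕ × ℕ) → Set (ℕ × ℕ × ℕ) := fun D =>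
    {p | p.1 < a ∧ p.2.1 < n₂ ∧ p.2.2 < n₃ ∨ p.1 = a ∧ p.2 ∈ D}
  have e1 : J ∅ = {p | p.1 < a ∧ p.2.1 < n₂ ∧ p.2.2 < n₃} := by ext; simp [J]
  have e2 : J {p | p.1 < n₂ ∧ p.2 < n₃} = {p | p.1 < a + 1 ∧ p.2.1 < n₂ ∧ p.2.2 < n₃} := by
    ext; simp [J]; omega
  refine (Runs.forBelow₂ n₂ n₃ (fun D τ => I (J D) τ) (f a) Φ hv₂ hv₃
    (fun τ' hF' => ht₂ τ' (hF.trans hF'.forBelow)) (fun τ' hF' => ht₃ τ' (hF.trans hF'.forBelow))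
    (fun D τ k h => (hset _ τ k h).2) (by simpa only [e1] using hI)
    fun b hb d hd D τ' hF' hvb hvd hD hD' hI' => ?_).mono ?_
  · have e3 : insert (a, b, d) (J D) = J (insert (b, d) D) := by
      ext ⟨x, y⟩
      simp only [J, Set.mem_insert_iff, Prod.mk.injEq, Set.mem_ofPred_eq]
      grind
    refine (hstep a ha b hb d hd _ τ' (hF.trans hF'.forBelow) ((hF'.reg _ hv₁).trans hva) hvb hvd
      (by simp [J, hD]) ?_ hI').mono ?_
    · rintro ⟨x, y, z⟩ h
      simp only [J, Set.mem_ofPred_eq] at h ⊢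
      grind
    · rintro ρ m hF'' ⟨h, hm⟩
      rw [e3] at h
      exact ⟨h, hm⟩
  · rintro ρ m hF'' ⟨h, hm⟩
    rw [e2] at h
    exact ⟨(hset _ _ _ h).1, hm⟩

/-! ### Vectors -/

/-- The first `n` elements of the vector `f` enumerate the set `P` without repetition. -/
structure Enumerates (f : ℕ → ℕ) (n : ℕ) (P : ℕ → Prop) : Prop where
  mem : ∀ k < n, P (f k)
  inj : ∀ j < n, ∀ k < n, f j = f k → j = k
  surj : ∀ x, P x → ∃ k < n, f k = x

theorem Enumerates.congr {f g : ℕ → ℕ} {n : ℕ} {P R : ℕ → Prop} (h : Enumerates f n P)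
    (hfg : ∀ k < n, f k = g k) (hPR : ∀ x, P x ↔ R x) : Enumerates g n R where
  mem k hk := by rw [← hfg k hk, ← hPR]; exact h.mem k hk
  inj j hj k hk e := h.inj j hj k hk (by rw [hfg j hj, hfg k hk, e])
  surj x hx := by
    obtain ⟨k, hk, e⟩ := h.surj x ((hPR x).2 hx)
    exact ⟨k, hk, by rw [← hfg k hk, e]⟩

/-- Appending the element `v` to a vector. -/
theorem Enumerates.push {f g : ℕ → ℕ} {n v : ℕ} {P R : ℕ → Prop} (h : Enumerates f n P)
    (hv : ¬ P v) (hfg : ∀ k < n, g k = f k) (hn : g n = v) (hR : ∀ x, R x ↔ P x ∨ x = v) :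
    Enumerates g (n + 1) R := by
  obtain ⟨h1, h2, h3⟩ := h
  refine ⟨fun k hk => ?_, fun j hj k hk e => ?_, fun x hx => ?_⟩
  · grind
  · grind
  · rcases (hR x).1 hx with hx | hx
    · obtain ⟨k, hk, e⟩ := h3 x hx
      exact ⟨k, by omega, by grind⟩
    · exact ⟨n, by omega, by grind⟩

theorem Enumerates.le_of_lt {f : ℕ → ℕ} {n N : ℕ} {P : ℕ → Prop} (h : Enumerates f n P)
    (hP : ∀ x, P x → x < N) : n ≤ N := by
  have := Finset.card_le_card_of_injOn (s := Finset.range n) (t := Finset.range N) f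
    (fun k hk => by simpa using hP _ (h.mem k (by simpa using hk)))
    (fun j hj k hk e => h.inj j (by simpa using hj) k (by simpa using hk) e)
  simpa using this

/-- The vector obtained from `f` by moving the element at position `i` to the position `j ≤ i`. -/
theorem Enumerates.insert {f g : ℕ → ℕ} {n i j : ℕ} {P : ℕ → Prop} (h : Enumerates f n P)
    (hi : i < n) (hj : j ≤ i) (h1 : ∀ k < j, g k = f k) (h2 : g j = f i)
    (h3 : ∀ k, j < k → k ≤ i → g k = f (k - 1)) (h4 : ∀ k, i < k → g k = f k) :
    Enumerates g n P := by
  -- `g = f ∘ p` for a permutation `p` of the positions with inverse `q`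
  let p : ℕ → ℕ := fun k => if k < j then k else if k = j then i else if k ≤ i then k - 1 else k
  let q : ℕ → ℕ := fun k => if k < j then k else if k < i then k + 1 else if k = i then j else k
  have hp : ∀ k, g k = f (p k) := by
    intro k
    simp only [p]
    split_ifs with a b c
    · exact h1 k a
    · rw [b, h2]
    · exact h3 k (by omega) c
    · exact h4 k (by omega)
  have hpn : ∀ k < n, p k < n := by intro k hk; simp only [p]; split_ifs <;> omega
  have hqn : ∀ k < n, q k < n := by intro k hk; simp only [q]; split_ifs <;> omega
  have hqp : ∀ k, q (p k) = k := by intro k; simp only [p, q]; split_ifs <;> omega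
  have hpq : ∀ k, p (q k) = k := by intro k; simp only [p, q]; split_ifs <;> omega
  refine ⟨fun k hk => hp k ▸ h.mem _ (hpn k hk), fun a ha b hb e => ?_, fun x hx => ?_⟩
  · rw [hp, hp] at e
    rw [← hqp a, h.inj _ (hpn a ha) _ (hpn b hb) e, hqp]
  · obtain ⟨k, hk, e⟩ := h.surj x hx
    exact ⟨q k, hqn k hk, by rw [hp, hpq, e]⟩

attribute [simp] runs_skip runs_set runs_put runs_rset runs_rput runs_seq runs_ite
attribute [simp] Cmd.block Cmd.when NExp.eval NExp.cost RExp.eval RExp.cost Test.Holds Test.cost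

/-! ### Pairs of numbered graphs -/

/-- Two fuzzy graphs whose vertices and labels are natural numbers below the given bounds. -/
structure NumberedPair where
  /-- the number of vertices of the first graph -/
  nV : ℕ
  /-- the number of vertices of the second graph -/
  nVP : ℕ
  /-- the number of edge labels -/
  nSE : ℕ
  /-- the number of vertex labels -/
  nSV : ℕ
  /-- the degrees of the edges of the first graph -/
  E : ℕ → ℕ → ℕ → ℝ
  /-- the degrees of the edges of the second graph -/
  EP : ℕ → ℕ → ℕ → ℝ
  /-- the degrees of the vertex labels of the first graph -/
  L : ℕ → ℕ → ℝ
  /-- the degrees of the vertex labels of the second graph -/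
  LP : ℕ → ℕ → ℝ
  E_range : ∀ x r y, 0 < E x r y → x < nV ∧ r < nSE ∧ y < nV
  EP_range : ∀ x r y, 0 < EP x r y → x < nVP ∧ r < nSE ∧ y < nVP

namespace NumberedPair

variable (P : NumberedPair)

/-- Simulations between the graphs of a numbered pair. -/
structure IsSim (R : ℕ → ℕ → Prop) : Prop where
  range : ∀ x x', R x x' → x < P.nV ∧ x' < P.nVP
  label_le : ∀ x x', R x x' → ∀ s < P.nSV, P.L x s ≤ P.LP x' s
  forth : ∀ x x' r y, R x x' → 0 < P.E x r y → ∃ y', R y y' ∧ P.E x r y ≤ P.EP x' r y'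

/-- The indices of the vectors `rcPrev[r,y,x']`. -/
def triples : Finset (List ℕ) :=
  (Finset.range P.nSE ×ˢ Finset.range P.nV ×ˢ Finset.range P.nVP).image
    fun p => [p.1, p.2.1, p.2.2]

theorem mem_triples {r y x' : ℕ} :
    [r, y, x'] ∈ P.triples ↔ r < P.nSE ∧ y < P.nV ∧ x' < P.nVP := by
  simp [triples]

/-- The total length of the vectors `rcPrev[r,y,x']`; every iteration of the loop of
`UpdateRcPrev` that deletes an element is paid for by a decrease of this potential. -/
def potential (arr : Arr → List ℕ → ℕ) : ℕ := ∑ ix ∈ P.triples, arr .rcPrevLen ix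

end NumberedPair

theorem sum_update_add {ι : Type*} [DecidableEq ι] {s : Finset ι} {i : ι} (hi : i ∈ s)
    (f : ι → ℕ) (n : ℕ) : ∑ j ∈ s, Function.update f i n j + f i = ∑ j ∈ s, f j + n := by
  have := Finset.sum_erase_add s f hi
  rw [Finset.sum_update_of_mem hi, Finset.sdiff_singleton_eq_erase]
  omega

/-- The lookup tables of the algorithm are in place. Degrees are only claimed for nonzero edges. -/
structure Tables (P : NumberedPair) (σ : State) : Prop where
  numV : σ.reg .numV = P.nV
  numVP : σ.reg .numVP = P.nVP
  numSE : σ.reg .numSE = P.nSE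
  E : ∀ x r y, 0 < P.E x r y → σ.rarr .E [x, r, y] = P.E x r y
  EP : ∀ x r y, 0 < P.EP x r y → σ.rarr .EP [x, r, y] = P.EP x r y
  edgeId_inj : ∀ x r y x₂ r₂ y₂, 0 < P.EP x r y → 0 < P.EP x₂ r₂ y₂ →
    σ.arr .edgeIdP [x, r, y] = σ.arr .edgeIdP [x₂, r₂, y₂] → x = x₂ ∧ r = r₂ ∧ y = y₂
  prevP : ∀ r < P.nSE, ∀ y < P.nVP, Enumerates (fun k => σ.arr .prevP [r, y, k])
    (σ.arr .prevPLen [r, y]) (fun x => 0 < P.EP x r y)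

theorem Tables.of_frame {P : NumberedPair} {c : Cmd} {σ τ : State} (h : Tables P σ)
    (hF : Frame c σ τ) (h1 : c.writesReg .numV = false) (h2 : c.writesReg .numVP = false)
    (h3 : c.writesReg .numSE = false) (h4 : c.writesRArr .E = false)
    (h5 : c.writesRArr .EP = false) (h6 : c.writesArr .edgeIdP = false)
    (h7 : c.writesArr .prevP = false) (h8 : c.writesArr .prevPLen = false) : Tables P τ := by
  obtain ⟨a1, a2, a3, a4, a5, a6, a7⟩ := h
  rw [← hF.reg _ h1] at a1
  rw [← hF.reg _ h2] at a2
  rw [← hF.reg _ h3] at a3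
  rw [← hF.rarr _ h4] at a4
  rw [← hF.rarr _ h5] at a5
  rw [← hF.arr _ h6] at a6
  rw [← hF.arr _ h7, ← hF.arr _ h8] at a7
  exact ⟨a1, a2, a3, a4, a5, a6, a7⟩

/-! ### `UpdateRcPrev` -/

/-- The pair `(a, b)` waits in the queue. -/
def Queued (σ : State) (a b : ℕ) : Prop :=
  ∃ i, σ.reg .head ≤ i ∧ i < σ.reg .tail ∧ σ.arr .queueFst [i] = a ∧ σ.arr .queueSnd [i] = b

/-- `Z[a,b]` holds or `(a, b)` waits in the queue: a deletion of the pair `(a, b)` from `Z` has not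
yet had its effect on the lists `rcNext'[r,a,x']`. -/
def Pending (σ : State) (a b : ℕ) : Prop := σ.arr .Z [a, b] = 1 ∨ Queued σ a b

/-- The part of the invariant of the algorithm that concerns `Z`, the queue and the vectors
`rcPrev[r,y,x']`. The queue consists of the cells from `head` to `tail - 1`; the cells below `head`
hold the pairs extracted so far, and by `queue_inj` no pair enters the queue twice. -/
structure WorkInv (P : NumberedPair) (σ : State) : Prop where
  head_le : σ.reg .head ≤ σ.reg .tail
  queue : ∀ i < σ.reg .tail, σ.arr .queueFst [i] < P.nV ∧ σ.arr .queueSnd [i] < P.nVP ∧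
    σ.arr .Z [σ.arr .queueFst [i], σ.arr .queueSnd [i]] ≠ 1
  queue_inj : ∀ i < σ.reg .tail, ∀ j < σ.reg .tail, σ.arr .queueFst [i] = σ.arr .queueFst [j] →
    σ.arr .queueSnd [i] = σ.arr .queueSnd [j] → i = j
  rc_mem : ∀ r < P.nSE, ∀ y < P.nV, ∀ x' < P.nVP, ∀ k < σ.arr .rcPrevLen [r, y, x'],
    0 < P.E (σ.arr .rcPrev [r, y, x', k]) r y
  rc_sorted : ∀ r < P.nSE, ∀ y < P.nV, ∀ x' < P.nVP, ∀ k < σ.arr .rcPrevLen [r, y, x'],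
    ∀ j < k, P.E (σ.arr .rcPrev [r, y, x', j]) r y ≤ P.E (σ.arr .rcPrev [r, y, x', k]) r y
  rc_complete : ∀ x' < P.nVP, ∀ x r y, σ.arr .Z [x, x'] = 1 → 0 < P.E x r y →
    ∃ k < σ.arr .rcPrevLen [r, y, x'], σ.arr .rcPrev [r, y, x', k] = x
  label_le : ∀ x < P.nV, ∀ x' < P.nVP, σ.arr .Z [x, x'] = 1 → ∀ s < P.nSV, P.L x s ≤ P.LP x' s
  maximal : ∀ R, P.IsSim R → ∀ x x', R x x' → σ.arr .Z [x, x'] = 1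

theorem WorkInv.congr {P : NumberedPair} {σ τ : State} (h : WorkInv P σ)
    (hreg : ∀ v ∈ [Reg.head, Reg.tail], τ.reg v = σ.reg v)
    (harr : ∀ a ∈ [Arr.Z, .queueFst, .queueSnd, .rcPrev, .rcPrevLen], τ.arr a = σ.arr a) :
    WorkInv P τ ∧ ∀ a b, Pending τ a b ↔ Pending σ a b := by
  simp only [List.mem_cons, List.not_mem_nil, or_false, forall_eq_or_imp, forall_eq] at hreg harr
  obtain ⟨h1, h2⟩ := hreg
  obtain ⟨a1, a2, a3, a4, a5⟩ := harr
  refine ⟨?_, fun a b => by simp [Pending, Queued, h1, h2, a1, a2, a3]⟩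
  obtain ⟨c1, c2, c3, c4, c5, c6, c7, c8⟩ := h
  rw [← h1, ← h2] at c1
  rw [← h2, ← a1, ← a2, ← a3] at c2
  rw [← h2, ← a2, ← a3] at c3
  rw [← a4, ← a5] at c4 c5
  rw [← a1, ← a4, ← a5] at c6
  rw [← a1] at c7 c8
  exact ⟨c1, c2, c3, c4, c5, c6, c7, c8⟩

/-- Deleting the last element `x` of `rcPrev[r,y,x']`, where `Z[x,x']` does not hold. -/
theorem WorkInv.pop {P : NumberedPair} {σ τ : State} {r y x' l : ℕ} (h : WorkInv P σ)
    (hl : σ.arr .rcPrevLen [r, y, x'] = l + 1)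
    (hZ : σ.arr .Z [σ.arr .rcPrev [r, y, x', l], x'] ≠ 1)
    (hreg : ∀ v ∈ [Reg.head, Reg.tail], τ.reg v = σ.reg v)
    (harr : ∀ a ∈ [Arr.Z, .queueFst, .queueSnd, .rcPrev], τ.arr a = σ.arr a)
    (hlen : τ.arr .rcPrevLen = Function.update (σ.arr .rcPrevLen) [r, y, x'] l) :
    WorkInv P τ := by
  have h1 := hreg .head (by simp)
  have h2 := hreg .tail (by simp)
  have a1 := harr .Z (by simp)
  have a2 := harr .queueFst (by simp)
  have a3 := harr .queueSnd (by simp)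
  have a4 := harr .rcPrev (by simp)
  have hle : ∀ ix, τ.arr .rcPrevLen ix ≤ σ.arr .rcPrevLen ix := by
    intro ix
    rw [hlen, Function.update_apply]
    split_ifs with e
    · rw [e, hl]; omega
    · rfl
  obtain ⟨c1, c2, c3, c4, c5, c6, c7, c8⟩ := h
  constructor
  · rwa [h1, h2]
  · rw [h2, a1, a2, a3]; exact c2
  · rw [h2, a2, a3]; exact c3
  · rw [a4]; exact fun r hr y hy x' hx' k hk => c4 r hr y hy x' hx' k (hk.trans_le (hle _))
  · rw [a4]; exact fun r hr y hy x' hx' k hk => c5 r hr y hy x' hx' k (hk.trans_le (hle _))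
  · rw [a4, a1, hlen]
    intro z' hz' x s w hz hE
    obtain ⟨k, hk, e⟩ := c6 z' hz' x s w hz hE
    refine ⟨k, ?_, e⟩
    rw [Function.update_apply]
    split_ifs with e'
    · simp only [List.cons.injEq, and_true] at e'
      obtain ⟨rfl, rfl, rfl⟩ := e'
      have : k ≠ l := by rintro rfl; exact hZ (e ▸ hz)
      omega
    · exact hk
  · rw [a1]; exact c7
  · rw [a1]; exact c8

/-- Setting `Z[x,x']` to false and adding the pair to the queue is sound if no simulation
contains the pair. -/
theorem WorkInv.enqueue {P : NumberedPair} {σ τ : State} {x x' : ℕ} (h : WorkInv P σ)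
    (hx : x < P.nV) (hx' : x' < P.nVP) (hZ : σ.arr .Z [x, x'] = 1)
    (hno : ∀ R, P.IsSim R → ¬ R x x')
    (hhead : τ.reg .head = σ.reg .head) (htail : τ.reg .tail = σ.reg .tail + 1)
    (harr : ∀ a ∈ [Arr.rcPrev, .rcPrevLen], τ.arr a = σ.arr a)
    (hz : τ.arr .Z = Function.update (σ.arr .Z) [x, x'] 0)
    (hqf : τ.arr .queueFst = Function.update (σ.arr .queueFst) [σ.reg .tail] x)
    (hqs : τ.arr .queueSnd = Function.update (σ.arr .queueSnd) [σ.reg .tail] x') :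
    WorkInv P τ ∧ ∀ a b, Pending τ a b ↔ Pending σ a b := by
  have a1 := harr .rcPrev (by simp)
  have a2 := harr .rcPrevLen (by simp)
  obtain ⟨c1, c2, c3, c4, c5, c6, c7, c8⟩ := h
  have hz1 : ∀ a b, τ.arr .Z [a, b] = 1 ↔ σ.arr .Z [a, b] = 1 ∧ ¬ (a = x ∧ b = x') := by
    intro a b
    rw [hz, Function.update_apply]
    split_ifs with e <;> simp at e <;> simp [e]
    intro _ h; exact e h
  have hq1 : ∀ i, τ.arr .queueFst [i] = if i = σ.reg .tail then x else σ.arr .queueFst [i] := by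
    intro i; rw [hqf, Function.update_apply]; simp
  have hq2 : ∀ i, τ.arr .queueSnd [i] = if i = σ.reg .tail then x' else σ.arr .queueSnd [i] := by
    intro i; rw [hqs, Function.update_apply]; simp
  refine ⟨⟨by omega, ?_, ?_, ?_, ?_, ?_, ?_, ?_⟩, ?_⟩
  · intro i hi
    rw [hq1, hq2, ne_eq, hz1]
    split_ifs with e
    · simp [hx, hx']
    · have := c2 i (by omega)
      exact ⟨this.1, this.2.1, fun h => this.2.2 h.1⟩
  · intro i hi j hj
    rw [hq1, hq2, hq1, hq2]
    have hne : ∀ k < σ.reg .tail, ¬ (σ.arr .queueFst [k] = x ∧ σ.arr .queueSnd [k] = x') := by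
      rintro k hk ⟨e1, e2⟩
      have := (c2 k hk).2.2
      rw [e1, e2] at this
      exact this hZ
    split_ifs with e1 e2 e2
    · intros; omega
    · intro f1 f2; exact absurd ⟨f1.symm, f2.symm⟩ (hne j (by omega))
    · intro f1 f2; exact absurd ⟨f1, f2⟩ (hne i (by omega))
    · exact c3 i (by omega) j (by omega)
  · rw [a1, a2]; exact c4
  · rw [a1, a2]; exact c5
  · rw [a1, a2]
    intro z' hz' z s w h
    exact c6 z' hz' z s w ((hz1 _ _).1 h).1
  · intro a ha b hb h
    exact c7 a ha b hb ((hz1 _ _).1 h).1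
  · intro R hR a b hab
    refine (hz1 _ _).2 ⟨c8 R hR a b hab, ?_⟩
    rintro ⟨rfl, rfl⟩
    exact hno R hR hab
  · intro a b
    rw [Pending, Pending, hz1]
    constructor
    · rintro (h | ⟨i, hi, hi', e1, e2⟩)
      · exact .inl h.1
      · rw [hq1] at e1
        rw [hq2] at e2
        split_ifs at e1 e2 with e
        · subst e1 e2; exact .inl hZ
        · exact .inr ⟨i, by omega, by omega, e1, e2⟩
    · rintro (h | ⟨i, hi, hi', e1, e2⟩)
      · by_cases e : a = x ∧ b = x'
        · obtain ⟨rfl, rfl⟩ := e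
          exact .inr ⟨σ.reg .tail, by omega, by omega, by simp [hq1], by simp [hq2]⟩
        · exact .inl ⟨h, e⟩
      · refine .inr ⟨i, by omega, by omega, ?_, ?_⟩
        · rw [hq1, if_neg (by omega), e1]
        · rw [hq2, if_neg (by omega), e2]

/-- The loop of `UpdateRcPrev(r,y,x')`, where `B` is the set of the keys of `rcNext'[r,y,x']` and
the register `d` holds the maximal degree of an edge from `x'` to such a key, or `0` if there is
none. An iteration that deletes an element takes at most `60` steps and lowers the potential by
`1`. -/
theorem runs_updateRcPrev_loop {P : NumberedPair} {σ : State} {r y x' : ℕ} {B : ℕ → Prop}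
    (hT : Tables P σ) (hW : WorkInv P σ)
    (hr : σ.reg .r = r) (hy : σ.reg .y = y) (hx' : σ.reg .xP = x')
    (hrn : r < P.nSE) (hyn : y < P.nV) (hxn : x' < P.nVP)
    (hgo : σ.reg .go = 1)
    (hZB : ∀ y', σ.arr .Z [y, y'] = 1 → 0 < P.EP x' r y' → B y')
    (hdB : ∀ y', B y' → P.EP x' r y' ≤ σ.rreg .d)
    (hBd : 0 < σ.rreg .d → ∃ y', B y' ∧ σ.rreg .d ≤ P.EP x' r y') :
    Runs (.while (.eq (.reg .go) (.lit 1))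
      (.ite (.eq (.get .rcPrevLen [.r, .y, .xP]) (.lit 0))
        (.set .go (.lit 0))
        (.block [
          .set .len (.pred (.get .rcPrevLen [.r, .y, .xP])),
          .set .x (.get .rcPrev [.r, .y, .xP, .len]),
          .ite (.rle (.get .E [.x, .r, .y]) (.reg .d))
            (.set .go (.lit 0))
            (.block [
              .put .rcPrevLen [.r, .y, .xP] (.reg .len),
              .when (.eq (.get .Z [.x, .xP]) (.lit 1)) (.block [
                .put .Z [.x, .xP] (.lit 0),
                .put .queueFst [.tail] (.reg .x),
                .put .queueSnd [.tail] (.reg .xP),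
                .set .tail (.succ (.reg .tail))])])]))) σ (fun τ m =>
      WorkInv P τ ∧ (∀ a b, Pending τ a b ↔ Pending σ a b) ∧
      (∀ a b, τ.arr .Z [a, b] = 1 → σ.arr .Z [a, b] = 1) ∧
      (∀ x, τ.arr .Z [x, x'] = 1 → 0 < P.E x r y → ∃ y', B y' ∧ P.E x r y ≤ P.EP x' r y') ∧
      m + 60 * P.potential τ.arr ≤ 60 + 60 * P.potential σ.arr) := by
  refine Runs.while (fun τ m => WorkInv P τ ∧ (∀ a b, Pending τ a b ↔ Pending σ a b) ∧
    (∀ a b, τ.arr .Z [a, b] = 1 → σ.arr .Z [a, b] = 1) ∧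
    (τ.reg .go = 1 ∧ m + 60 * P.potential τ.arr ≤ 60 * P.potential σ.arr ∨
      τ.reg .go ≠ 1 ∧ m + 60 * P.potential τ.arr ≤ 50 + 60 * P.potential σ.arr ∧
      ∀ k < τ.arr .rcPrevLen [r, y, x'], P.E (τ.arr .rcPrev [r, y, x', k]) r y ≤ σ.rreg .d))
    (50 + 60 * P.potential σ.arr) ⟨hW, by simp, by simp, .inl ⟨hgo, by simp⟩⟩ ?_ ?_ ?_
  · rintro τ m ⟨-, -, -, h⟩
    omega
  · rintro τ m hF ⟨hWτ, hPend, hmono, h⟩ hb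
    have hgo' : τ.reg .go = 1 := by simpa using hb
    obtain ⟨-, hm⟩ : τ.reg .go = 1 ∧ _ := h.resolve_right (fun h => h.1 hgo')
    have er := hF.reg .r rfl
    have ey := hF.reg .y rfl
    have ex := hF.reg .xP rfl
    have ed := hF.rreg .d rfl
    have eE := hF.rarr .E rfl
    have eP := hF.arr .rcPrev rfl
    rw [hr] at er
    rw [hy] at ey
    rw [hx'] at ex
    simp [er, ey, ex, ed, eE]
    constructor
    · intro hlen
      refine ⟨⟨hWτ.1, hWτ.2, hWτ.3, hWτ.4, hWτ.5, hWτ.6, hWτ.7, hWτ.8⟩, hPend, hmono, by omega,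
        by omega⟩
    · intro hlen
      obtain ⟨l, hl⟩ := Nat.exists_eq_succ_of_ne_zero hlen
      obtain ⟨x, hx⟩ : ∃ x, τ.arr .rcPrev [r, y, x', l] = x := ⟨_, rfl⟩
      have hEx : 0 < P.E x r y := hx ▸ hWτ.rc_mem r hrn y hyn x' hxn l (by omega)
      have hpot : ∀ arr, arr .rcPrevLen = Function.update (τ.arr .rcPrevLen) [r, y, x'] l →
          P.potential arr + 1 = P.potential τ.arr := by
        intro arr h
        have := sum_update_add (P.mem_triples.2 ⟨hrn, hyn, hxn⟩) (τ.arr .rcPrevLen) l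
        rw [NumberedPair.potential, NumberedPair.potential, h]
        omega
      simp only [hl, Nat.succ_eq_add_one, Nat.add_sub_cancel, hx, hT.E x r y hEx]
      refine ⟨fun hle => ⟨⟨hWτ.1, hWτ.2, hWτ.3, hWτ.4, hWτ.5, hWτ.6, hWτ.7, hWτ.8⟩, hPend, hmono,
        by omega, fun k hk => ?_⟩, fun hlt => ?_⟩
      -- the loop stops: by the order of `rcPrev[r,y,x']` no remaining element exceeds `d`
      · refine le_trans ?_ hle
        rcases (Nat.lt_succ_iff.1 hk).eq_or_lt with e | hkl
        · rw [e, hx]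
        · exact hx ▸ hWτ.rc_sorted r hrn y hyn x' hxn l (by omega) k hkl
      -- a simulation with `(x, x')` would contain some `(y, y')` with `E(x,r,y) ≤ E'(x',r,y') ≤ d`
      have hno : ∀ R, P.IsSim R → ¬ R x x' := by
        intro R hR hxx
        obtain ⟨y', hy', hEE⟩ := hR.forth x x' r y hxx hEx
        exact absurd (hEE.trans (hdB y' (hZB y' (hW.maximal R hR y y' hy') (hEx.trans_le hEE))))
          (not_le.2 hlt)
      refine ⟨fun hz => ?_, fun hz => ?_⟩
      · obtain ⟨hW₁, hPend₁⟩ := hWτ.enqueue (τ := (((τ.setArr .Z [x, x'] 0).setArr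
          .queueFst [τ.reg .tail] x).setArr .queueSnd [τ.reg .tail] x').setReg .tail
            (τ.reg .tail + 1)) (P.E_range _ _ _ hEx).1 hxn hz hno (by simp) (by simp) (by simp)
            (by simp) (by simp) (by simp)
        refine ⟨hW₁.pop (r := r) (y := y) (x' := x') (l := l) (by simp [hl]) (by simp [hx])
          (by simp) (by simp) (by simp), fun a b => ?_, fun a b h => ?_, .inl ⟨hgo', ?_⟩⟩
        · rw [← hPend, ← hPend₁]
          simp [Pending, Queued]
        · rw [Function.update_apply] at h
          split_ifs at h
          exact hmono a b h
        · have := hpot _ (show _ = _ from by simp : ((((((((τ.setReg .len l).setReg .x x).setArr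
            .rcPrevLen [r, y, x'] l).setArr .Z [x, x'] 0).setArr .queueFst [τ.reg .tail] x).setArr
            .queueSnd [τ.reg .tail] x').setReg .tail (τ.reg .tail + 1)).arr .rcPrevLen) = _)
          simp only [setReg_arr] at this ⊢
          omega
      · refine ⟨hWτ.pop (r := r) (y := y) (x' := x') (l := l) hl (by simpa [hx] using hz)
          (by simp) (by simp) (by simp), fun a b => ?_, hmono, .inl ⟨hgo', ?_⟩⟩
        · rw [← hPend]
          simp [Pending, Queued]
        · have := hpot _ (show _ = _ from by simp : ((((τ.setReg .len l).setReg .x x).setArr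
            .rcPrevLen [r, y, x'] l).arr .rcPrevLen) = _)
          omega
  · rintro τ m hF ⟨hWτ, hPend, hmono, h⟩ hb
    have hgo' : τ.reg .go ≠ 1 := by simpa using hb
    obtain ⟨-, hm, hk⟩ : τ.reg .go ≠ 1 ∧ _ := h.resolve_left (fun h => hgo' h.1)
    refine ⟨hWτ, hPend, hmono, ?_, ?_⟩
    · intro x hx hE
      obtain ⟨k, hk', rfl⟩ := hWτ.rc_complete x' hxn x r y hx hE
      have hle := hk k hk'
      obtain ⟨y', hy', hd'⟩ := hBd (hE.trans_le hle)
      exact ⟨y', hy', hle.trans hd'⟩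
    · simp only [Test.cost, NExp.cost]; omega

/-- After `UpdateRcPrev(r,y,x')` every edge `(x,r,y)` with `Z[x,x']` is matched by an edge from
`x'` to a key of `rcNext'[r,y,x']`; the set of these keys is `B`. -/
theorem runs_updateRcPrev {P : NumberedPair} {σ : State} {r y x' : ℕ} {B : ℕ → Prop}
    (hT : Tables P σ) (hW : WorkInv P σ)
    (hr : σ.reg .r = r) (hy : σ.reg .y = y) (hx' : σ.reg .xP = x')
    (hrn : r < P.nSE) (hyn : y < P.nV) (hxn : x' < P.nVP)
    (hZB : ∀ y', σ.arr .Z [y, y'] = 1 → 0 < P.EP x' r y' → B y')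
    (hB : ∀ y', B y' → 0 < P.EP x' r y')
    (hlast0 : σ.arr .rcLast [r, y, x'] = 0 → ∀ y', ¬ B y')
    (hlast : ∀ u, σ.arr .rcLast [r, y, x'] = u → u ≠ 0 → B (σ.arr .key [u]) ∧
      ∀ y', B y' → P.EP x' r y' ≤ P.EP x' r (σ.arr .key [u])) :
    Runs .updateRcPrev σ (fun τ m =>
      WorkInv P τ ∧ (∀ a b, Pending τ a b ↔ Pending σ a b) ∧
      (∀ a b, τ.arr .Z [a, b] = 1 → σ.arr .Z [a, b] = 1) ∧
      (∀ x, τ.arr .Z [x, x'] = 1 → 0 < P.E x r y → ∃ y', B y' ∧ P.E x r y ≤ P.EP x' r y') ∧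
      m + 60 * P.potential τ.arr ≤ 100 + 60 * P.potential σ.arr) := by
  rw [Cmd.updateRcPrev, runs_block_cons_cons]
  refine Runs.seq (Q₁ := fun τ m => m ≤ 40 ∧ τ.reg .r = r ∧ τ.reg .y = y ∧ τ.reg .xP = x' ∧
    τ.reg .go = 1 ∧ (∀ v ∈ [Reg.head, .tail], τ.reg v = σ.reg v) ∧ τ.arr = σ.arr ∧
    (∀ y', B y' → P.EP x' r y' ≤ τ.rreg .d) ∧
    (0 < τ.rreg .d → ∃ y', B y' ∧ τ.rreg .d ≤ P.EP x' r y')) ?_ ?_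
  · simp [hr, hy, hx']
    refine ⟨fun h0 => fun y' hy' => absurd hy' (hlast0 h0 y'), fun h0 => ?_⟩
    obtain ⟨h1, h2⟩ := hlast _ rfl h0
    rw [hT.EP _ _ _ (hB _ h1)]
    exact ⟨h2, fun _ => ⟨_, h1, le_rfl⟩⟩
  · rintro τ n hF ⟨hn, er, ey, ex, ego, ereg, earr, hdB, hBd⟩
    obtain ⟨hWτ, hP⟩ := hW.congr ereg (fun a _ => by rw [earr])
    rw [← earr] at hZB
    refine (runs_updateRcPrev_loop (hT.of_frame hF rfl rfl rfl rfl rfl rfl rfl rfl)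
      hWτ er ey ex hrn hyn hxn ego hZB hdB hBd).mono ?_
    rintro ρ m - ⟨h1, h2, h3, h4, h5⟩
    refine ⟨h1, fun a b => (h2 a b).trans (hP a b), fun a b h => earr ▸ h3 a b h, h4, ?_⟩
    rw [earr] at h5
    omega

/-! ### Doubly linked lists -/

/-- `w` is the successor of `u` in the set `D` of addresses; `0` is the null reference. -/
def IsNext (D : ℕ → Prop) (u w : ℕ) : Prop :=
  w = 0 ∧ (∀ v, D v → v ≤ u) ∨ D w ∧ u < w ∧ ∀ v, D v → u < v → w ≤ v

/-- The references form a doubly linked list of the elements with addresses in `D`. Elements are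
allocated in the order in which they are appended, so that the order of the list is the order of
the addresses and the set of the addresses determines the list. -/
structure IsDll (D : ℕ → Prop) (first last : ℕ) (succ pred : ℕ → ℕ) : Prop where
  pos : ∀ u, D u → 0 < u
  first : IsNext D 0 first
  last : (last = 0 ∨ D last) ∧ ∀ v, D v → v ≤ last
  succ : ∀ u, D u → IsNext D u (succ u)
  pred : ∀ u, D u → (pred u = 0 ∨ D (pred u)) ∧ pred u < u ∧ ∀ v, D v → v < u → v ≤ pred u

theorem IsDll.congr {D : ℕ → Prop} {f l f' l' : ℕ} {s p s' p' : ℕ → ℕ} (h : IsDll D f l s p)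
    (hf : f' = f) (hl : l' = l) (hs : ∀ v, D v → s' v = s v) (hp : ∀ v, D v → p' v = p v) :
    IsDll D f' l' s' p' := by
  obtain ⟨h1, h2, h3, h4, h5⟩ := h
  subst hf hl
  exact ⟨h1, h2, h3, fun u hu => hs u hu ▸ h4 u hu, fun u hu => hp u hu ▸ h5 u hu⟩

theorem IsDll.empty (s p : ℕ → ℕ) : IsDll (fun _ => False) 0 0 s p :=
  ⟨by simp, by simp [IsNext], by simp, by simp, by simp⟩

/-- Appending an element whose address `u` exceeds all addresses in `D`. -/
theorem IsDll.append {D : ℕ → Prop} {f l f' u : ℕ} {s p s' p' : ℕ → ℕ} (h : IsDll D f l s p)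
    (hu : 0 < u) (hlt : ∀ v, D v → v < u) (hf : f' = if l = 0 then u else f)
    (hsu : s' u = 0) (hs : ∀ v, D v → s' v = if v = l then u else s v)
    (hpu : p' u = l) (hp : ∀ v, D v → p' v = p v) :
    IsDll (fun v => D v ∨ v = u) f' u s' p' := by
  obtain ⟨h1, h2, h3, h4, h5⟩ := h
  have hl : l < u := by
    rcases h3.1 with h | h
    · omega
    · exact hlt l h
  refine ⟨?_, ?_, ?_, ?_, ?_⟩
  · rintro v (hv | rfl)
    · exact h1 v hv
    · exact hu
  · right
    by_cases hl0 : l = 0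
    · rw [hf, if_pos hl0]
      refine ⟨.inr rfl, hu, ?_⟩
      rintro v (hv | rfl) _
      · have := h1 v hv
        have := h3.2 v hv
        omega
      · exact le_rfl
    · rw [hf, if_neg hl0]
      rcases h2 with ⟨-, k⟩ | ⟨k1, k2, k3⟩
      · have := k l (h3.1.resolve_left hl0)
        omega
      · refine ⟨.inl k1, k2, ?_⟩
        rintro v (hv | rfl) h
        · exact k3 v hv h
        · exact (hlt f k1).le
  · exact ⟨.inr (.inr rfl), by rintro v (hv | rfl); exacts [(hlt v hv).le, le_rfl]⟩
  · rintro v (hv | rfl)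
    · rw [hs v hv]
      split_ifs with e
      · refine .inr ⟨.inr rfl, hlt v hv, ?_⟩
        rintro w (hw | rfl) h
        · have := h3.2 w hw
          omega
        · exact le_rfl
      · have hv0 := h1 v hv
        have hvl := h3.2 v hv
        rcases h4 v hv with ⟨-, k⟩ | ⟨k1, k2, k3⟩
        · have := k l (h3.1.resolve_left (by omega))
          omega
        · refine .inr ⟨.inl k1, k2, ?_⟩
          rintro w (hw | rfl) h
          · exact k3 w hw h
          · exact (hlt _ k1).le
    · refine .inl ⟨hsu, ?_⟩
      rintro w (hw | rfl)
      exacts [(hlt w hw).le, le_rfl]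
  · rintro v (hv | rfl)
    · obtain ⟨k1, k2, k3⟩ := h5 v hv
      rw [hp v hv]
      refine ⟨k1.imp_right .inl, k2, ?_⟩
      rintro w (hw | rfl) h
      · exact k3 w hw h
      · have := hlt v hv
        omega
    · rw [hpu]
      refine ⟨h3.1.imp_right .inl, hl, ?_⟩
      rintro w (hw | rfl) h
      · exact h3.2 w hw
      · omega

/-- Unlinking the element `u` by redirecting the references of its neighbours. -/
theorem IsDll.delete {D : ℕ → Prop} {f l f' l' u : ℕ} {s p s' p' : ℕ → ℕ} (h : IsDll D f l s p)
    (hu : D u) (hf : f' = if p u = 0 then s u else f) (hl : l' = if s u = 0 then p u else l)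
    (hs : ∀ v, D v → s' v = if v = p u then s u else s v)
    (hp : ∀ v, D v → p' v = if v = s u then p u else p v) :
    IsDll (fun v => D v ∧ v ≠ u) f' l' s' p' := by
  obtain ⟨h1, h2, h3, h4, h5⟩ := h
  have a1 := h1 u hu
  have a4 := h4 u hu
  have a5 := h5 u hu
  refine ⟨fun v hv => h1 v hv.1, ?_, ?_, ?_, ?_⟩
  · rw [hf]
    split_ifs with e
    · have hlow : ∀ v, D v → v ≠ u → u < v := fun v hv hvu => by
        have := h1 v hv
        have := a5.2.2 v hv
        omega
      rcases a4 with ⟨k1, k2⟩ | ⟨k1, k2, k3⟩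
      · refine .inl ⟨k1, fun v hv => ?_⟩
        have := hlow v hv.1 hv.2
        have := k2 v hv.1
        omega
      · exact .inr ⟨⟨k1, k2.ne'⟩, by omega, fun v hv _ => k3 v hv.1 (hlow v hv.1 hv.2)⟩
    · have hD := a5.1.resolve_left e
      rcases h2 with ⟨-, k⟩ | ⟨k1, k2, k3⟩
      · have := k u hu
        omega
      · have := k3 _ hD (h1 _ hD)
        exact .inr ⟨⟨k1, by omega⟩, k2, fun v hv h => k3 v hv.1 h⟩
  · rw [hl]
    split_ifs with e
    · have k := (a4.resolve_right (by rintro ⟨-, h, -⟩; omega)).2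
      refine ⟨a5.1.imp_right fun h => ⟨h, by omega⟩, fun v hv => a5.2.2 v hv.1 ?_⟩
      have := k v hv.1
      have := hv.2
      omega
    · obtain ⟨k1, k2, k3⟩ := a4.resolve_left fun h => e h.1
      have := h3.2 _ k1
      exact ⟨.inr ⟨h3.1.resolve_left (by omega), by omega⟩, fun v hv => h3.2 v hv.1⟩
  · rintro v ⟨hv, hvu⟩
    rw [hs v hv]
    split_ifs with e
    · have hw : ∀ w, D w → w ≠ u → v < w → u < w := fun w hw hwu h => by
        have := a5.2.2 w hw
        omega
      rcases a4 with ⟨k1, k2⟩ | ⟨k1, k2, k3⟩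
      · refine .inl ⟨k1, fun w hw' => ?_⟩
        have := hw w hw'.1 hw'.2
        have := k2 w hw'.1
        omega
      · exact .inr ⟨⟨k1, k2.ne'⟩, by omega, fun w hw' h => k3 w hw'.1 (hw w hw'.1 hw'.2 h)⟩
    · rcases h4 v hv with ⟨k1, k2⟩ | ⟨k1, k2, k3⟩
      · exact .inl ⟨k1, fun w hw => k2 w hw.1⟩
      · refine .inr ⟨⟨k1, fun h => ?_⟩, k2, fun w hw => k3 w hw.1⟩
        -- otherwise `v` would be the predecessor of `u`
        have := h1 v hv
        have := a5.2.2 v hv (by omega)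
        have := k3 _ (a5.1.resolve_left (by omega)) (by omega)
        omega
  · rintro v ⟨hv, hvu⟩
    obtain ⟨b1, b2, b3⟩ := h5 v hv
    rw [hp v hv]
    split_ifs with e
    · have := h1 v hv
      obtain ⟨k1, k2, k3⟩ := a4.resolve_left fun h => by have := h.1; omega
      refine ⟨a5.1.imp_right fun h => ⟨h, by omega⟩, by omega, fun w hw h => a5.2.2 w hw.1 ?_⟩
      have := k3 w hw.1
      have := hw.2
      omega
    · refine ⟨?_, b2, fun w hw => b3 w hw.1⟩
      refine b1.imp_right fun h => ⟨h, fun h' => ?_⟩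
      -- otherwise `v` would be the successor of `u`
      rcases a4 with ⟨k1, k2⟩ | ⟨k1, k2, k3⟩
      · have := k2 v hv
        omega
      · have := k3 v hv (by omega)
        have := b3 _ k1 (by omega)
        omega

/-- The lists `rcNext'[r,y,x']` for the triples `(r,y,x')` in `D`. Here `N r y x'` is the set of
the addresses of the elements of the list, and `A r y x'` the set of their keys. The entries of
`rcNextElem'` refer to the elements of the lists; only entries for keys in `A` are specified. -/
structure RcLists (P : NumberedPair) (A : ℕ → ℕ → ℕ → ℕ → Prop) (N : ℕ → ℕ → ℕ → ℕ → Prop)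
    (D : Set (ℕ × ℕ × ℕ)) (σ : State) : Prop where
  disj : ∀ r y x r₂ y₂ x₂ u, N r y x u → N r₂ y₂ x₂ u → r = r₂ ∧ y = y₂ ∧ x = x₂
  dll : ∀ r y x, (r, y, x) ∈ D → IsDll (N r y x) (σ.arr .rcFirst [r, y, x])
    (σ.arr .rcLast [r, y, x]) (fun u => σ.arr .succ [u]) (fun u => σ.arr .pred [u])
  entry : ∀ r y x u, N r y x u → A r y x (σ.arr .key [u]) ∧
    σ.arr .rcNextElemP [y, σ.arr .edgeIdP [x, r, σ.arr .key [u]]] = u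
  complete : ∀ r y x y', A r y x y' →
    N r y x (σ.arr .rcNextElemP [y, σ.arr .edgeIdP [x, r, y']]) ∧
    σ.arr .key [σ.arr .rcNextElemP [y, σ.arr .edgeIdP [x, r, y']]] = y'
  edge : ∀ r y x y', A r y x y' → 0 < P.EP x r y'
  mem : ∀ r y x y', A r y x y' → (r, y, x) ∈ D
  sorted : ∀ r y x u v, N r y x u → N r y x v → u < v →
    P.EP x r (σ.arr .key [u]) ≤ P.EP x r (σ.arr .key [v])

theorem RcLists.of_arr {P : NumberedPair} {A A' N : ℕ → ℕ → ℕ → ℕ → Prop} {D : Set (ℕ × ℕ × ℕ)}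
    {σ τ : State} (h : RcLists P A N D σ) (hA : ∀ r y x y', A' r y x y' ↔ A r y x y')
    (harr : ∀ a ∈ [Arr.rcFirst, .rcLast, .succ, .pred, .key, .rcNextElemP, .edgeIdP],
      τ.arr a = σ.arr a) : RcLists P A' N D τ := by
  obtain rfl : A' = A := by
    funext r y x y'
    exact propext (hA r y x y')
  obtain ⟨h1, h2, h3, h4, h5, h6, h7⟩ := h
  simp only [List.mem_cons, List.not_mem_nil, or_false, forall_eq_or_imp, forall_eq] at harr
  obtain ⟨a1, a2, a3, a4, a5, a6, a7⟩ := harr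
  constructor
  · exact h1
  · rw [a1, a2, a3, a4]; exact h2
  · rw [a5, a6, a7]; exact h3
  · rw [a5, a6, a7]; exact h4
  · exact h5
  · exact h6
  · rw [a5]; exact h7

theorem runs_deleteElem {σ : State} {r y x u : ℕ}
    (hr : σ.reg .r = r) (hy : σ.reg .y = y) (hx : σ.reg .xP = x) (hu : σ.reg .u = u) :
    Runs .deleteElem σ (fun τ m => m ≤ 40 ∧
      τ.arr .rcFirst = (if σ.arr .pred [u] = 0 then
        Function.update (σ.arr .rcFirst) [r, y, x] (σ.arr .succ [u]) else σ.arr .rcFirst) ∧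
      τ.arr .succ = (if σ.arr .pred [u] = 0 then σ.arr .succ else
        Function.update (σ.arr .succ) [σ.arr .pred [u]] (σ.arr .succ [u])) ∧
      τ.arr .rcLast = (if σ.arr .succ [u] = 0 then
        Function.update (σ.arr .rcLast) [r, y, x] (σ.arr .pred [u]) else σ.arr .rcLast) ∧
      τ.arr .pred = (if σ.arr .succ [u] = 0 then σ.arr .pred else
        Function.update (σ.arr .pred) [σ.arr .succ [u]] (σ.arr .pred [u]))) := by
  by_cases h1 : σ.arr .pred [u] = 0 <;> by_cases h2 : σ.arr .succ [u] = 0 <;>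
    simp [Cmd.deleteElem, hr, hy, hx, hu, h1, h2]

/-- Deleting the element with key `y'` from `rcNext'[r,y,x']`. -/
theorem RcLists.delete {P : NumberedPair} {A N : ℕ → ℕ → ℕ → ℕ → Prop} {D : Set (ℕ × ℕ × ℕ)}
    {σ τ : State} {r y x y' u : ℕ} (h : RcLists P A N D σ)
    (hinj : ∀ x r y x₂ r₂ y₂, 0 < P.EP x r y → 0 < P.EP x₂ r₂ y₂ →
      σ.arr .edgeIdP [x, r, y] = σ.arr .edgeIdP [x₂, r₂, y₂] → x = x₂ ∧ r = r₂ ∧ y = y₂)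
    (hA : A r y x y') (hu : σ.arr .rcNextElemP [y, σ.arr .edgeIdP [x, r, y']] = u)
    (e1 : τ.arr .rcFirst = if σ.arr .pred [u] = 0 then
        Function.update (σ.arr .rcFirst) [r, y, x] (σ.arr .succ [u]) else σ.arr .rcFirst)
    (e2 : τ.arr .succ = if σ.arr .pred [u] = 0 then σ.arr .succ else
        Function.update (σ.arr .succ) [σ.arr .pred [u]] (σ.arr .succ [u]))
    (e3 : τ.arr .rcLast = if σ.arr .succ [u] = 0 then
        Function.update (σ.arr .rcLast) [r, y, x] (σ.arr .pred [u]) else σ.arr .rcLast)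
    (e4 : τ.arr .pred = if σ.arr .succ [u] = 0 then σ.arr .pred else
        Function.update (σ.arr .pred) [σ.arr .succ [u]] (σ.arr .pred [u]))
    (e5 : τ.arr .rcNextElemP =
      Function.update (σ.arr .rcNextElemP) [y, σ.arr .edgeIdP [x, r, y']] 0)
    (e6 : τ.arr .key = σ.arr .key) (e7 : τ.arr .edgeIdP = σ.arr .edgeIdP) :
    RcLists P (fun a b c d => A a b c d ∧ ¬ (a = r ∧ b = y ∧ c = x ∧ d = y'))
      (fun a b c v => N a b c v ∧ v ≠ u) D τ := by
  obtain ⟨h1, h2, h3, h4, h5, h6, h7⟩ := h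
  obtain ⟨hN, hkey⟩ := h4 _ _ _ _ hA
  rw [hu] at hN hkey
  have hd := h2 _ _ _ (h6 _ _ _ _ hA)
  have hpr := hd.pred u hN
  have hnx := hd.succ u hN
  have hu0 := hd.pos u hN
  refine ⟨fun a b c a₂ b₂ c₂ v k k₂ => h1 a b c a₂ b₂ c₂ v k.1 k₂.1, ?_, ?_, ?_,
    fun a b c d k => h5 a b c d k.1, fun a b c d k => h6 a b c d k.1, ?_⟩
  · intro a b c habc
    have hd' := h2 a b c habc
    by_cases e : a = r ∧ b = y ∧ c = x
    · obtain ⟨rfl, rfl, rfl⟩ := e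
      refine hd.delete hN ?_ ?_ (fun v hv => ?_) (fun v hv => ?_)
      · rw [e1]; split_ifs <;> simp
      · rw [e3]; split_ifs <;> simp
      · have := hd.pos v hv
        simp only [e2]
        split_ifs with k1 k2 k2
        · omega
        · rfl
        · simp [k2]
        · simp [k2]
      · have := hd.pos v hv
        simp only [e4]
        split_ifs with k1 k2 k2
        · omega
        · rfl
        · simp [k2]
        · simp [k2]
    · have hne : ∀ v, N a b c v → ¬ N r y x v := fun v k k' => e (h1 _ _ _ _ _ _ _ k k')
      have hun : ∀ v, N a b c v → v ≠ u := by
        rintro v k rfl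
        exact hne _ k hN
      have : (fun v => N a b c v ∧ v ≠ u) = N a b c := by
        funext v
        exact propext ⟨And.left, fun k => ⟨k, hun v k⟩⟩
      rw [this]
      have hix : [a, b, c] ≠ [r, y, x] := by simpa using e
      refine hd'.congr ?_ ?_ (fun v hv => ?_) (fun v hv => ?_)
      · rw [e1]; split_ifs <;> simp [hix]
      · rw [e3]; split_ifs <;> simp [hix]
      · simp only [e2]
        split_ifs with k1
        · rfl
        · have : v ≠ σ.arr .pred [u] := by
            rintro rfl
            exact hne _ hv (hpr.1.resolve_left k1)
          simp [this]
      · simp only [e4]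
        split_ifs with k1
        · rfl
        · have : v ≠ σ.arr .succ [u] := by
            rintro rfl
            exact hne _ hv (hnx.resolve_left (fun k => k1 k.1)).1
          simp [this]
  · rintro a b c v ⟨hv, hvu⟩
    obtain ⟨k1, k2⟩ := h3 a b c v hv
    rw [e5, e6, e7]
    have : ¬ (a = r ∧ b = y ∧ c = x ∧ σ.arr .key [v] = y') := by
      rintro ⟨rfl, rfl, rfl, rfl⟩
      exact hvu (k2.symm.trans hu)
    refine ⟨⟨k1, this⟩, ?_⟩
    rw [Function.update_of_ne, k2]
    simp only [ne_eq, List.cons.injEq, and_true, not_and]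
    intro eb ee
    obtain ⟨rfl, rfl, e⟩ := hinj _ _ _ _ _ _ (h5 _ _ _ _ k1) (h5 _ _ _ _ hA) ee
    exact this ⟨rfl, eb, rfl, e⟩
  · rintro a b c d ⟨k1, hne⟩
    obtain ⟨k2, k3⟩ := h4 a b c d k1
    have hix : [b, σ.arr .edgeIdP [c, a, d]] ≠ [y, σ.arr .edgeIdP [x, r, y']] := by
      simp only [ne_eq, List.cons.injEq, and_true, not_and]
      intro eb ee
      obtain ⟨rfl, rfl, e⟩ := hinj _ _ _ _ _ _ (h5 _ _ _ _ k1) (h5 _ _ _ _ hA) ee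
      exact hne ⟨rfl, eb, rfl, e⟩
    rw [e5, e6, e7, Function.update_of_ne hix]
    refine ⟨⟨k2, fun e => ?_⟩, k3⟩
    obtain ⟨rfl, rfl, rfl⟩ := h1 _ _ _ _ _ _ _ k2 (e ▸ hN)
    rw [e, hkey] at k3
    exact hne ⟨rfl, rfl, rfl, k3.symm⟩
  · rintro a b c v w ⟨hv, -⟩ ⟨hw, -⟩ hvw
    rw [e6]
    exact h7 a b c v w hv hw hvw

/-! ### The main loop -/

/-- The triples `(r,y,x')` of numbers of an edge label and of vertices of the two graphs. -/
def NumberedPair.allTriples (P : NumberedPair) : Set (ℕ × ℕ × ℕ) :=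
  {p | p.1 < P.nSE ∧ p.2.1 < P.nV ∧ p.2.2 < P.nVP}

/-- The invariant of the main loop and of the loops in its body, where `A r y x'` is the set of
the keys of `rcNext'[r,y,x']`: it contains all `y'` with `Z[y,y']`, and the condition (ii) of
simulations holds for `Z` if the witnesses are taken from `A` instead of `Z`. -/
structure LoopInv (P : NumberedPair) (A : ℕ → ℕ → ℕ → ℕ → Prop) (σ : State) : Prop where
  tables : Tables P σ
  work : WorkInv P σ
  lists : ∃ N, RcLists P A N P.allTriples σ
  keys : ∀ r x y y', σ.arr .Z [y, y'] = 1 → 0 < P.EP x r y' → y < P.nV → A r y x y'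
  forth : ∀ x r y x', x' < P.nVP → σ.arr .Z [x, x'] = 1 → 0 < P.E x r y →
    ∃ y', A r y x' y' ∧ P.E x r y ≤ P.EP x' r y'

theorem LoopInv.congr {P : NumberedPair} {A A' : ℕ → ℕ → ℕ → ℕ → Prop} {σ : State}
    (h : LoopInv P A σ) (hA : ∀ r y x y', A' r y x y' ↔ A r y x y') : LoopInv P A' σ := by
  obtain rfl : A' = A := by
    funext r y x y'
    exact propext (hA r y x y')
  exact h

theorem pending_setReg {σ : State} {v : Reg} {k a b : ℕ} (hv : v ≠ .head ∧ v ≠ .tail) :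
    Pending (σ.setReg v k) a b ↔ Pending σ a b := by
  simp [Pending, Queued, hv.1.symm, hv.2.symm]

theorem LoopInv.setReg {P : NumberedPair} {A : ℕ → ℕ → ℕ → ℕ → Prop} {σ : State}
    (h : LoopInv P A σ) (v : Reg) (k : ℕ)
    (hv : v ∉ [Reg.head, .tail, .numV, .numVP, .numSE]) : LoopInv P A (σ.setReg v k) := by
  simp only [List.mem_cons, List.not_mem_nil, or_false, not_or, ← ne_eq] at hv
  obtain ⟨v1, v2, v3, v4, v5⟩ := hv
  obtain ⟨⟨t1, t2, t3, t4, t5, t6, t7⟩, hW, ⟨N, hL⟩, hk, hf⟩ := h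
  refine ⟨⟨?_, ?_, ?_, t4, t5, t6, t7⟩, (hW.congr (τ := σ.setReg v k) ?_ fun _ _ => rfl).1,
    ⟨N, hL.of_arr (fun _ _ _ _ => Iff.rfl) fun _ _ => rfl⟩, hk, hf⟩
  · simpa [v3.symm] using t1
  · simpa [v4.symm] using t2
  · simpa [v5.symm] using t3
  · simp [v1.symm, v2.symm]

/-- The references to the last elements of the lists as needed by `UpdateRcPrev`. -/
theorem RcLists.last {P : NumberedPair} {A N : ℕ → ℕ → ℕ → ℕ → Prop} {D : Set (ℕ × ℕ × ℕ)}
    {σ : State} (h : RcLists P A N D σ) {r y x : ℕ} (hD : (r, y, x) ∈ D) :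
    (σ.arr .rcLast [r, y, x] = 0 → ∀ y', ¬ A r y x y') ∧
    ∀ u, σ.arr .rcLast [r, y, x] = u → u ≠ 0 → A r y x (σ.arr .key [u]) ∧
      ∀ y', A r y x y' → P.EP x r y' ≤ P.EP x r (σ.arr .key [u]) := by
  have hd := h.dll r y x hD
  refine ⟨fun h0 y' hA => ?_, ?_⟩
  · have hN := (h.complete _ _ _ _ hA).1
    have := hd.pos _ hN
    have := hd.last.2 _ hN
    omega
  · rintro u rfl hu
    have hNu := hd.last.1.resolve_left hu
    refine ⟨(h.entry _ _ _ _ hNu).1, fun y' hA => ?_⟩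
    obtain ⟨hN, hk⟩ := h.complete _ _ _ _ hA
    rcases (hd.last.2 _ hN).eq_or_lt with e | hlt
    · rw [← e, hk]
    · have := h.sorted _ _ _ _ _ hN hNu hlt
      rwa [hk] at this

/-- The body of the main loop for one pair `(y,y')` and one edge `(x,r,y')`: the key `y'` is
removed from `rcNext'[r,y,x]`. -/
theorem runs_mainBody {P : NumberedPair} {A : ℕ → ℕ → ℕ → ℕ → Prop} {σ : State}
    {r y y' x i : ℕ} (h : LoopInv P A σ)
    (hr : σ.reg .r = r) (hy : σ.reg .y = y) (hy' : σ.reg .yP = y') (hi : σ.reg .i = i)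
    (hx : σ.arr .prevP [r, y', i] = x) (hZ : σ.arr .Z [y, y'] ≠ 1) (hA : A r y x y') :
    Runs (.block [
        .set .xP (.get .prevP [.r, .yP, .i]),
        .set .e (.get .edgeIdP [.xP, .r, .yP]),
        .set .u (.get .rcNextElemP [.y, .e]),
        .deleteElem,
        .put .rcNextElemP [.y, .e] (.lit 0),
        .updateRcPrev]) σ (fun τ m =>
      LoopInv P (fun a b c d => A a b c d ∧ ¬ (a = r ∧ b = y ∧ c = x ∧ d = y')) τ ∧
      (∀ a b, Pending τ a b ↔ Pending σ a b) ∧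
      (∀ a b, τ.arr .Z [a, b] = 1 → σ.arr .Z [a, b] = 1) ∧
      m + 60 * P.potential τ.arr ≤ 200 + 60 * P.potential σ.arr) := by
  obtain ⟨hT, hW, ⟨N, hL⟩, hkeys, hforth⟩ := h
  obtain ⟨u, hu⟩ : ∃ u, σ.arr .rcNextElemP [y, σ.arr .edgeIdP [x, r, y']] = u := ⟨_, rfl⟩
  have hD := hL.mem _ _ _ _ hA
  simp only [Cmd.block]
  rw [runs_seq, runs_set, runs_seq, runs_set, runs_seq, runs_set]
  simp [-not_and, hr, hy, hy', hi, hx, hu]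
  refine (runs_deleteElem (r := r) (y := y) (x := x) (u := u) (by simp [hr]) (by simp [hy])
    (by simp) (by simp)).mono ?_
  rintro τ n hF ⟨hn, e1, e2, e3, e4⟩
  have er : τ.reg .r = r := (hF.reg .r rfl).trans (by simp [hr])
  have ey : τ.reg .y = y := (hF.reg .y rfl).trans (by simp [hy])
  have ex : τ.reg .xP = x := (hF.reg .xP rfl).trans (by simp)
  have ee : τ.reg .e = σ.arr .edgeIdP [x, r, y'] := (hF.reg .e rfl).trans (by simp)
  have hF' := hF.arr
  have hTτ : Tables P τ := Tables.of_frame (σ := ((σ.setReg .xP x).setReg .e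
    (σ.arr .edgeIdP [x, r, y'])).setReg .u u) ⟨hT.1, hT.2, hT.3, hT.4, hT.5, hT.6, hT.7⟩ hF
    rfl rfl rfl rfl rfl rfl rfl rfl
  simp only [setReg_arr] at hF'
  rw [ey, ee]
  have hL' := hL.delete (τ := τ.setArr .rcNextElemP [y, σ.arr .edgeIdP [x, r, y']] 0)
    hT.edgeId_inj hA hu e1 e2 e3 e4 (by simp [hF' .rcNextElemP rfl]) (by simp [hF' .key rfl])
    (by simp [hF' .edgeIdP rfl])
  obtain ⟨hWτ, hP⟩ := hW.congr (τ := τ.setArr .rcNextElemP [y, σ.arr .edgeIdP [x, r, y']] 0)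
    (by simp [hF.reg .head rfl, hF.reg .tail rfl])
    (by simp [hF' .Z rfl, hF' .queueFst rfl, hF' .queueSnd rfl, hF' .rcPrev rfl,
      hF' .rcPrevLen rfl])
  obtain ⟨hlast0, hlast⟩ := hL'.last hD
  have hkeys' : ∀ a c b d, σ.arr .Z [b, d] = 1 → 0 < P.EP c a d → b < P.nV →
      A a b c d ∧ ¬ (a = r ∧ b = y ∧ c = x ∧ d = y') := fun a c b d hz hE hb =>
    ⟨hkeys a c b d hz hE hb, by rintro ⟨-, rfl, -, rfl⟩; exact hZ hz⟩
  have eZ : (τ.setArr .rcNextElemP [y, σ.arr .edgeIdP [x, r, y']] 0).arr .Z = σ.arr .Z := by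
    simp [hF' .Z rfl]
  have eL : (τ.setArr .rcNextElemP [y, σ.arr .edgeIdP [x, r, y']] 0).arr .rcPrevLen =
      σ.arr .rcPrevLen := by simp [hF' .rcPrevLen rfl]
  refine (runs_updateRcPrev (P := P)
    (σ := τ.setArr .rcNextElemP [y, σ.arr .edgeIdP [x, r, y']] 0) (r := r) (y := y) (x' := x)
    (B := fun d => A r y x d ∧ ¬ (r = r ∧ y = y ∧ x = x ∧ d = y'))
    ⟨hTτ.1, hTτ.2, hTτ.3, hTτ.4, hTτ.5, by simpa using hTτ.6, by simpa using hTτ.7⟩ hWτ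
    (by simpa using er) (by simpa using ey) (by simpa using ex) hD.1 hD.2.1 hD.2.2
    (fun d hz hE => hkeys' r x y d (by rwa [eZ] at hz) hE hD.2.1)
    (fun d hd => hL'.edge _ _ _ _ hd) hlast0 hlast).mono ?_
  rintro ρ k hFρ ⟨g1, g2, g3, g4, g5⟩
  rw [eZ] at g3
  refine ⟨⟨?_, g1, ⟨_, hL'.of_arr (fun _ _ _ _ => Iff.rfl) ?_⟩, ?_, ?_⟩,
    fun a b => (g2 a b).trans (hP a b), g3, ?_⟩
  · exact Tables.of_frame (σ := τ.setArr .rcNextElemP [y, σ.arr .edgeIdP [x, r, y']] 0)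
      ⟨hTτ.1, hTτ.2, hTτ.3, hTτ.4, hTτ.5, by simpa using hTτ.6, by simpa using hTτ.7⟩ hFρ
      rfl rfl rfl rfl rfl rfl rfl rfl
  · simp only [List.mem_cons, List.not_mem_nil, or_false, forall_eq_or_imp, forall_eq]
    exact ⟨hFρ.arr _ rfl, hFρ.arr _ rfl, hFρ.arr _ rfl, hFρ.arr _ rfl, hFρ.arr _ rfl,
      hFρ.arr _ rfl, hFρ.arr _ rfl⟩
  · exact fun a c b d hz => hkeys' a c b d (g3 _ _ hz)
  · intro z a b c hc hz hE
    by_cases e : a = r ∧ b = y ∧ c = x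
    · obtain ⟨rfl, rfl, rfl⟩ := e
      exact g4 z hz hE
    · obtain ⟨d, hd, hle⟩ := hforth z a b c hc (g3 _ _ hz) hE
      exact ⟨d, ⟨hd, fun h => e ⟨h.1, h.2.1, h.2.2.1⟩⟩, hle⟩
  · simp only [NumberedPair.potential, eL] at g5 ⊢
    omega

/-- A bound for the number of steps of one iteration of the main loop that extracts a pair
`(y,y')`, apart from those paid for by the potential; here `len r` is the number of edges with
label `r` that lead to `y'`. -/
def NumberedPair.mainCost (P : NumberedPair) (len : ℕ → ℕ) : ℕ :=
  40 + ∑ r ∈ Finset.range P.nSE, (13 + 208 * len r)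

/-- The loops of the body of the main loop, for an extracted pair `(y,y')`. Before them the lists
still contain the keys `y'` that belong to this pair, after them they do not. -/
theorem runs_mainFor {P : NumberedPair} {σ : State} {y y' : ℕ}
    (h : LoopInv P (fun r a x b => 0 < P.EP x r b ∧ a < P.nV ∧
      (Pending σ a b ∨ a = y ∧ b = y')) σ)
    (hy : σ.reg .y = y) (hy' : σ.reg .yP = y') (hyn : y < P.nV) (hyn' : y' < P.nVP)
    (hZ : σ.arr .Z [y, y'] ≠ 1) (hpend : ¬ Pending σ y y') :
    Runs (.forBelow .r (.reg .numSE) (.forBelow .i (.get .prevPLen [.r, .yP]) (.block [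
        .set .xP (.get .prevP [.r, .yP, .i]),
        .set .e (.get .edgeIdP [.xP, .r, .yP]),
        .set .u (.get .rcNextElemP [.y, .e]),
        .deleteElem,
        .put .rcNextElemP [.y, .e] (.lit 0),
        .updateRcPrev]))) σ (fun τ m =>
      LoopInv P (fun r a x b => 0 < P.EP x r b ∧ a < P.nV ∧ Pending τ a b) τ ∧
      (∀ a b, Pending τ a b ↔ Pending σ a b) ∧
      m + 60 * P.potential τ.arr + 30 ≤
        P.mainCost (fun r => σ.arr .prevPLen [r, y']) + 60 * P.potential σ.arr) := by
  have hT := h.tables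
  refine (Runs.forBelow P.nSE (fun k ρ => LoopInv P (fun r a x b => 0 < P.EP x r b ∧ a < P.nV ∧
      (Pending σ a b ∨ a = y ∧ b = y' ∧ k ≤ r)) ρ ∧ (∀ a b, Pending ρ a b ↔ Pending σ a b) ∧
      ρ.arr .Z [y, y'] ≠ 1) (fun r => 7 + 208 * σ.arr .prevPLen [r, y'])
    (fun arr => 60 * P.potential arr) rfl
    (fun τ hF => by simpa using (hF.reg .numSE rfl).trans hT.numSE) ?_ ?_).mono ?_
  · exact ⟨(h.congr fun _ _ _ _ => by simp).setReg _ _ (by simp),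
      fun _ _ => pending_setReg (by simp), hZ⟩
  · rintro k hk τ hF hr ⟨hI, hP, hZτ⟩
    have ey : τ.reg .y = y := (hF.reg .y rfl).trans hy
    have ey' : τ.reg .yP = y' := (hF.reg .yP rfl).trans hy'
    have elen : τ.arr .prevPLen = σ.arr .prevPLen := hF.arr .prevPLen rfl
    have eprev : τ.arr .prevP = σ.arr .prevP := hF.arr .prevP rfl
    have hen := hT.prevP k hk y' hyn'
    refine (Runs.forBelow (σ.arr .prevPLen [k, y']) (fun j ρ =>
      LoopInv P (fun r a x b => 0 < P.EP x r b ∧ a < P.nV ∧ (Pending σ a b ∨ a = y ∧ b = y' ∧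
        (k < r ∨ r = k ∧ ∃ i, j ≤ i ∧ i < σ.arr .prevPLen [k, y'] ∧
          σ.arr .prevP [k, y', i] = x))) ρ ∧ (∀ a b, Pending ρ a b ↔ Pending σ a b) ∧
      ρ.arr .Z [y, y'] ≠ 1) (fun _ => 200) (fun arr => 60 * P.potential arr) rfl
      (fun ρ hF' => by simp [hF'.arr .prevPLen rfl, hF'.reg .r rfl, hF'.reg .yP rfl, hr, ey', elen])
      ?_ ?_).mono ?_
    · refine ⟨(hI.congr fun r a x b => ?_).setReg _ _ (by simp),
        fun a b => (pending_setReg (by simp)).trans (hP a b), hZτ⟩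
      refine and_congr_right fun hE => and_congr_right fun _ => or_congr_right <|
        and_congr_right fun _ => and_congr_right fun hb => ?_
      constructor
      · rintro (h | ⟨rfl, -⟩) <;> omega
      · intro h
        rcases h.eq_or_lt with rfl | h
        · obtain ⟨i, hi, e⟩ := hen.surj x (by rwa [hb] at hE)
          exact .inr ⟨rfl, i, by omega, hi, e⟩
        · exact .inl h
    · rintro j hj ρ hF' hi ⟨hI', hP', hZρ⟩
      obtain ⟨x, hx⟩ : ∃ x, σ.arr .prevP [k, y', j] = x := ⟨_, rfl⟩
      have hxE : 0 < P.EP x k y' := hx ▸ hen.mem j hj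
      refine (runs_mainBody (x := x) hI' ((hF'.reg .r rfl).trans hr) ((hF'.reg .y rfl).trans ey)
        ((hF'.reg .yP rfl).trans ey') hi (by rw [hF'.arr .prevP rfl, eprev, hx]) hZρ
        ⟨hxE, hyn, .inr ⟨rfl, rfl, .inr ⟨rfl, j, le_rfl, hj, hx⟩⟩⟩).mono ?_
      rintro ρ' m - ⟨g1, g2, g3, g4⟩
      refine ⟨⟨(g1.congr fun r a z b => ?_).setReg _ _ (by simp), fun a b =>
        (pending_setReg (by simp)).trans ((g2 a b).trans (hP' a b)), fun e => hZρ (g3 _ _ e)⟩, g4⟩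
      constructor
      · rintro ⟨h1, h2, h3 | ⟨rfl, rfl, h3⟩⟩
        · refine ⟨⟨h1, h2, .inl h3⟩, ?_⟩
          rintro ⟨-, rfl, -, rfl⟩
          exact hpend h3
        · rcases h3 with h3 | ⟨rfl, i, hi1, hi2, rfl⟩
          · exact ⟨⟨h1, h2, .inr ⟨rfl, rfl, .inl h3⟩⟩, by omega⟩
          · refine ⟨⟨h1, h2, .inr ⟨rfl, rfl, .inr ⟨rfl, i, by omega, hi2, rfl⟩⟩⟩, ?_⟩
            rintro ⟨-, -, e, -⟩
            have := hen.inj i hi2 j hj (e.trans hx.symm)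
            omega
      · rintro ⟨⟨h1, h2, h3 | ⟨rfl, rfl, h3⟩⟩, hne⟩
        · exact ⟨h1, h2, .inl h3⟩
        · refine ⟨h1, h2, .inr ⟨rfl, rfl, ?_⟩⟩
          rcases h3 with h3 | ⟨rfl, i, hi1, hi2, rfl⟩
          · exact .inl h3
          · refine .inr ⟨rfl, i, ?_, hi2, rfl⟩
            rcases hi1.eq_or_lt with rfl | h
            · exact absurd ⟨rfl, rfl, hx, rfl⟩ hne
            · exact h
    · rintro ρ m hF' ⟨⟨g1, g2, g3⟩, hm⟩
      refine ⟨⟨(g1.congr fun r a x b => ?_).setReg _ _ (by simp),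
        fun a b => (pending_setReg (by simp)).trans (g2 a b), g3⟩, ?_⟩
      · refine and_congr_right fun hE => and_congr_right fun _ => or_congr_right <|
          and_congr_right fun _ => and_congr_right fun hb => ?_
        constructor
        · exact .inl
        · rintro (h | ⟨-, i, h1, h2, -⟩) <;> omega
      · simp only [NExp.cost, List.length_cons, List.length_nil, Finset.sum_const,
          Finset.card_range, smul_eq_mul] at hm ⊢
        omega
  · rintro τ m hF ⟨⟨hI, hP, -⟩, hm⟩
    refine ⟨hI.congr fun r a x b => ?_, hP, ?_⟩
    · rw [hP]
      constructor
      · exact fun h => ⟨h.1, h.2.1, .inl h.2.2⟩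
      · rintro ⟨h1, h2, h3 | h3⟩
        · exact ⟨h1, h2, h3⟩
        · have := (P.EP_range _ _ _ h1).2.1
          omega
    · simp only [NumberedPair.mainCost, NExp.cost, Finset.sum_add_distrib, Finset.sum_const,
        Finset.card_range, smul_eq_mul] at hm ⊢
      omega

open Classical in
/-- The pairs of vertices whose deletion has been processed. -/
noncomputable def NumberedPair.processed (P : NumberedPair) (σ : State) : Finset (ℕ × ℕ) :=
  {p ∈ Finset.range P.nV ×ˢ Finset.range P.nVP | ¬ Pending σ p.1 p.2}

open Classical in
theorem NumberedPair.processed_subset (P : NumberedPair) (σ : State) :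
    P.processed σ ⊆ Finset.range P.nV ×ˢ Finset.range P.nVP :=
  fun _ hp => (Finset.mem_filter.1 hp).1

/-- Extracting a pair from the queue removes exactly this pair from the pending ones. -/
theorem WorkInv.dequeue {P : NumberedPair} {σ τ : State} (h : WorkInv P σ)
    (hlt : σ.reg .head < σ.reg .tail) (hhead : τ.reg .head = σ.reg .head + 1)
    (htail : τ.reg .tail = σ.reg .tail) (harr : τ.arr = σ.arr) :
    WorkInv P τ ∧ ∀ a b, Pending σ a b ↔ Pending τ a b ∨
      a = σ.arr .queueFst [σ.reg .head] ∧ b = σ.arr .queueSnd [σ.reg .head] := by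
  obtain ⟨c1, c2, c3, c4, c5, c6, c7, c8⟩ := h
  refine ⟨⟨by omega, by rwa [htail, harr], by rwa [htail, harr], by rwa [harr], by rwa [harr],
    by rwa [harr], by rwa [harr], by rwa [harr]⟩, fun a b => ?_⟩
  simp only [Pending, Queued, hhead, htail, harr]
  constructor
  · rintro (h | ⟨i, h1, h2, h3, h4⟩)
    · exact .inl (.inl h)
    · rcases h1.eq_or_lt with rfl | h1
      · exact .inr ⟨h3.symm, h4.symm⟩
      · exact .inl (.inr ⟨i, h1, h2, h3, h4⟩)
  · rintro ((h | ⟨i, h1, h2, h3, h4⟩) | ⟨rfl, rfl⟩)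
    · exact .inl h
    · exact .inr ⟨i, by omega, h2, h3, h4⟩
    · exact .inr ⟨_, le_rfl, hlt, rfl, rfl⟩

theorem WorkInv.not_pending_head {P : NumberedPair} {σ τ : State} (h : WorkInv P σ)
    (hlt : σ.reg .head < σ.reg .tail) (hhead : τ.reg .head = σ.reg .head + 1)
    (htail : τ.reg .tail = σ.reg .tail) (harr : τ.arr = σ.arr) :
    ¬ Pending τ (σ.arr .queueFst [σ.reg .head]) (σ.arr .queueSnd [σ.reg .head]) := by
  simp only [Pending, Queued, hhead, htail, harr]
  rintro (h' | ⟨i, h1, h2, h3, h4⟩)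
  · exact (h.queue _ hlt).2.2 h'
  · have := h.queue_inj _ hlt i h2 h3.symm h4.symm
    omega

/-- When the main loop ends, `Z` is the largest simulation. Each pair is extracted from the queue at
most once, so the costs of the iterations add up to a sum over all pairs. -/
theorem runs_mainLoop {P : NumberedPair} {σ : State}
    (h : LoopInv P (fun r a x b => 0 < P.EP x r b ∧ a < P.nV ∧ Pending σ a b) σ) :
    Runs (.while (.lt (.reg .head) (.reg .tail)) (.block [
      .set .y (.get .queueFst [.head]),
      .set .yP (.get .queueSnd [.head]),
      .set .head (.succ (.reg .head)),
      .forBelow .r (.reg .numSE) (.forBelow .i (.get .prevPLen [.r, .yP]) (.block [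
        .set .xP (.get .prevP [.r, .yP, .i]),
        .set .e (.get .edgeIdP [.xP, .r, .yP]),
        .set .u (.get .rcNextElemP [.y, .e]),
        .deleteElem,
        .put .rcNextElemP [.y, .e] (.lit 0),
        .updateRcPrev]))])) σ (fun τ m =>
      (∃ R, P.IsSim R ∧ (∀ R', P.IsSim R' → ∀ x x', R' x x' → R x x') ∧
        ∀ x < P.nV, ∀ x' < P.nVP, τ.arr .Z [x, x'] = 1 ↔ R x x') ∧
      m ≤ 3 + 60 * P.potential σ.arr + ∑ p ∈ Finset.range P.nV ×ˢ Finset.range P.nVP,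
        P.mainCost (fun r => σ.arr .prevPLen [r, p.2])) := by
  refine Runs.while (fun τ m =>
    LoopInv P (fun r a x b => 0 < P.EP x r b ∧ a < P.nV ∧ Pending τ a b) τ ∧
    m + 60 * P.potential τ.arr ≤ 60 * P.potential σ.arr + ∑ p ∈ P.processed τ,
      P.mainCost (fun r => σ.arr .prevPLen [r, p.2]))
    (60 * P.potential σ.arr + ∑ p ∈ Finset.range P.nV ×ˢ Finset.range P.nVP,
      P.mainCost (fun r => σ.arr .prevPLen [r, p.2])) ⟨h, by simp⟩ ?_ ?_ ?_
  · rintro τ m ⟨-, hm⟩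
    have := Finset.sum_le_sum_of_subset (f := fun p : ℕ × ℕ =>
      P.mainCost (fun r => σ.arr .prevPLen [r, p.2])) (P.processed_subset τ)
    omega
  · rintro τ m hF ⟨hI, hm⟩ hb
    have hlt : τ.reg .head < τ.reg .tail := by simpa using hb
    obtain ⟨y, hy⟩ : ∃ y, τ.arr .queueFst [τ.reg .head] = y := ⟨_, rfl⟩
    obtain ⟨y', hy'⟩ : ∃ y', τ.arr .queueSnd [τ.reg .head] = y' := ⟨_, rfl⟩
    obtain ⟨ρ, hρ⟩ : ∃ ρ, ((τ.setReg .y y).setReg .yP y').setReg .head (τ.reg .head + 1) = ρ :=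
      ⟨_, rfl⟩
    have hhead : ρ.reg .head = τ.reg .head + 1 := by simp [← hρ]
    have htail : ρ.reg .tail = τ.reg .tail := by simp [← hρ]
    have harr : ρ.arr = τ.arr := by simp [← hρ]
    have hq := hI.work.queue _ hlt
    obtain ⟨hWρ, hP⟩ := hI.work.dequeue hlt hhead htail harr
    have hnp := hI.work.not_pending_head hlt hhead htail harr
    rw [hy, hy'] at hP hnp hq
    have hIρ : LoopInv P (fun r a x b => 0 < P.EP x r b ∧ a < P.nV ∧
        (Pending ρ a b ∨ a = y ∧ b = y')) ρ := by
      obtain ⟨⟨t1, t2, t3, t4, t5, t6, t7⟩, -, ⟨N, hL⟩, hk, hf⟩ :=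
        hI.congr (fun r a x b => by rw [hP])
      refine ⟨⟨?_, ?_, ?_, ?_, ?_, ?_, ?_⟩, hWρ, ⟨N, hL.of_arr (fun _ _ _ _ => Iff.rfl)
        fun _ _ => by rw [harr]⟩, by rwa [harr], by rwa [harr]⟩
      · simpa [← hρ] using t1
      · simpa [← hρ] using t2
      · simpa [← hρ] using t3
      · simpa [← hρ] using t4
      · simpa [← hρ] using t5
      · rwa [harr]
      · rwa [harr]
    simp only [Cmd.block]
    rw [runs_seq, runs_set, runs_seq, runs_set, runs_seq, runs_set]
    simp only [NExp.eval, List.map_cons, List.map_nil, setReg_reg, setReg_arr, reduceCtorEq,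
      if_false, hy, hy', hρ]
    refine (runs_mainFor hIρ (by simp [← hρ]) (by simp [← hρ]) hq.1 hq.2.1
      (by rw [harr]; exact hq.2.2) hnp).mono ?_
    rintro τ' k - ⟨hI', hP', hk⟩
    refine ⟨hI', ?_⟩
    have hproc : P.processed τ' = insert (y, y') (P.processed τ) := by
      ext ⟨a, b⟩
      simp only [NumberedPair.processed, Finset.mem_filter, Finset.mem_product, Finset.mem_range,
        Finset.mem_insert, Prod.mk.injEq, hP, hP']
      constructor
      · tauto
      · rintro (⟨rfl, rfl⟩ | h)
        · exact ⟨⟨hq.1, hq.2.1⟩, hnp⟩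
        · tauto
    -- as `(y, y')` was pending, its cost has not been counted before
    have hnot : (y, y') ∉ P.processed τ := by
      simp [NumberedPair.processed, hP]
    rw [hproc, Finset.sum_insert hnot]
    rw [harr, hF.arr .prevPLen rfl] at hk
    simp only [Test.cost, NExp.cost, List.length_cons, List.length_nil]
    omega
  · rintro τ m hF ⟨hI, hm⟩ hb
    have hht : τ.reg .head = τ.reg .tail := by
      have := hI.work.head_le
      simp only [Test.Holds, NExp.eval] at hb
      omega
    have hpend : ∀ a b, Pending τ a b ↔ τ.arr .Z [a, b] = 1 := by
      intro a b
      refine or_iff_left ?_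
      rintro ⟨i, h1, h2, -⟩
      omega
    refine ⟨⟨fun x x' => x < P.nV ∧ x' < P.nVP ∧ τ.arr .Z [x, x'] = 1, ⟨?_, ?_, ?_⟩, ?_, ?_⟩, ?_⟩
    · exact fun x x' h => ⟨h.1, h.2.1⟩
    · exact fun x x' h => hI.work.label_le x h.1 x' h.2.1 h.2.2
    · rintro x x' r y ⟨-, hx', hz⟩ hE
      obtain ⟨y', ⟨h1, h2, h3⟩, h4⟩ := hI.forth x r y x' hx' hz hE
      exact ⟨y', ⟨h2, (P.EP_range _ _ _ h1).2.2, (hpend _ _).1 h3⟩, h4⟩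
    · exact fun R hR x x' h => ⟨(hR.range _ _ h).1, (hR.range _ _ h).2,
        hI.work.maximal R hR x x' h⟩
    · exact fun x hx x' hx' => ⟨fun h => ⟨hx, hx', h⟩, fun h => h.2.2⟩
    · have := Finset.sum_le_sum_of_subset (f := fun p : ℕ × ℕ =>
        P.mainCost (fun r => σ.arr .prevPLen [r, p.2])) (P.processed_subset τ)
      simp only [Test.cost, NExp.cost]
      omega

/-! ### Construction of `rcPrev` and `rcNext'` -/

/-- The first `n` elements of the vector `f` enumerate the set `Q` in ascending order with respect
to the degree `w`. -/
structure SortedVec (f : ℕ → ℕ) (n : ℕ) (Q : ℕ → Prop) (w : ℕ → ℝ) : Prop where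
  enum : Enumerates f n Q
  sorted : ∀ k < n, ∀ j < k, w (f j) ≤ w (f k)

theorem SortedVec.congr {f g : ℕ → ℕ} {n : ℕ} {Q R : ℕ → Prop} {w : ℕ → ℝ}
    (h : SortedVec f n Q w) (hfg : ∀ k < n, f k = g k) (hQR : ∀ x, Q x ↔ R x) :
    SortedVec g n R w :=
  ⟨h.enum.congr hfg hQR, fun k hk j hj => by
    rw [← hfg k hk, ← hfg j (hj.trans hk)]; exact h.sorted k hk j hj⟩

/-- The construction of the vector `rcPrev[r,y,x']`. -/
theorem runs_constructRcPrev {P : NumberedPair} {σ : State} {r y x' : ℕ}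
    (hr : σ.reg .r = r) (hy : σ.reg .y = y) (hx' : σ.reg .xP = x')
    (hprev : SortedVec (fun k => σ.arr .prev [r, y, k]) (σ.arr .prevLen [r, y])
      (fun x => 0 < P.E x r y) (fun x => P.E x r y)) :
    Runs (.block [
      .put .rcPrevLen [.r, .y, .xP] (.lit 0),
      .forBelow .i (.get .prevLen [.r, .y]) (.block [
        .set .x (.get .prev [.r, .y, .i]),
        .when (.eq (.get .Z [.x, .xP]) (.lit 1))
          (.push .rcPrev .rcPrevLen [.r, .y, .xP] .x)])]) σ (fun τ m =>
      SortedVec (fun k => τ.arr .rcPrev [r, y, x', k]) (τ.arr .rcPrevLen [r, y, x'])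
        (fun x => 0 < P.E x r y ∧ σ.arr .Z [x, x'] = 1) (fun x => P.E x r y) ∧
      τ.arr .rcPrevLen [r, y, x'] ≤ σ.arr .prevLen [r, y] ∧
      (∀ ix, ix ≠ [r, y, x'] → τ.arr .rcPrevLen ix = σ.arr .rcPrevLen ix) ∧
      (∀ a b c k, [a, b, c] ≠ [r, y, x'] →
        τ.arr .rcPrev [a, b, c, k] = σ.arr .rcPrev [a, b, c, k]) ∧
      m ≤ 20 + 50 * σ.arr .prevLen [r, y]) := by
  rw [runs_block_cons, runs_seq, runs_put]
  simp [hr, hy, hx']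
  obtain ⟨σ₁, hσ₁⟩ : ∃ σ₁, σ.setArr .rcPrevLen [r, y, x'] 0 = σ₁ := ⟨_, rfl⟩
  rw [hσ₁]
  have eZ : σ₁.arr .Z = σ.arr .Z := by simp [← hσ₁]
  have eprev : σ₁.arr .prev = σ.arr .prev := by simp [← hσ₁]
  have elen : σ₁.arr .prevLen = σ.arr .prevLen := by simp [← hσ₁]
  have erc : σ₁.arr .rcPrev = σ.arr .rcPrev := by simp [← hσ₁]
  have er : σ₁.reg .r = r := by simp [← hσ₁, hr]
  have ey : σ₁.reg .y = y := by simp [← hσ₁, hy]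
  have ex : σ₁.reg .xP = x' := by simp [← hσ₁, hx']
  refine (Runs.forBelow (σ.arr .prevLen [r, y]) (fun i τ =>
    SortedVec (fun k => τ.arr .rcPrev [r, y, x', k]) (τ.arr .rcPrevLen [r, y, x'])
        (fun x => (∃ k < i, σ.arr .prev [r, y, k] = x) ∧ σ.arr .Z [x, x'] = 1)
        (fun x => P.E x r y) ∧ τ.arr .rcPrevLen [r, y, x'] ≤ i ∧
      (∀ ix, ix ≠ [r, y, x'] → τ.arr .rcPrevLen ix = σ.arr .rcPrevLen ix) ∧
      (∀ a b c k, [a, b, c] ≠ [r, y, x'] →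
        τ.arr .rcPrev [a, b, c, k] = σ.arr .rcPrev [a, b, c, k])) (fun _ => 40) (fun _ => 0)
    rfl (fun τ hF => by simp [hF.reg .r rfl, hF.reg .y rfl, hF.arr .prevLen rfl, elen, er, ey])
    ?_ ?_).mono ?_
  · refine ⟨⟨⟨?_, ?_, ?_⟩, ?_⟩, ?_, ?_, ?_⟩
    · simp [← hσ₁]
    · simp [← hσ₁]
    · simp
    · simp [← hσ₁]
    · simp [← hσ₁]
    · intro ix hix
      simp [← hσ₁, hix]
    · simp [erc]
  · rintro i hi τ hF hτi ⟨⟨h1, h2⟩, h3, h4, h5⟩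
    have eZ' := (hF.arr .Z rfl).trans eZ
    have eprev' := (hF.arr .prev rfl).trans eprev
    have er' := (hF.reg .r rfl).trans er
    have ey' := (hF.reg .y rfl).trans ey
    have ex' := (hF.reg .xP rfl).trans ex
    simp [Cmd.push, hτi, eprev', er', ey', ex', eZ']
    refine ⟨fun hZ => ⟨⟨?_, ?_⟩, h3, ?_, ?_⟩, fun hZ => ⟨⟨?_, h2⟩, by omega, h4, ?_⟩⟩
    · refine h1.push (v := σ.arr .prev [r, y, i]) ?_ ?_ (by simp) ?_
      · rintro ⟨⟨k, hk, e⟩, -⟩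
        have := hprev.enum.inj k (hk.trans hi) i hi e
        omega
      · intro k hk
        have : k ≠ τ.arr .rcPrevLen [r, y, x'] := by omega
        simp [this]
      · intro x
        constructor
        · rintro ⟨⟨k, hk, rfl⟩, hz⟩
          rcases (show k ≤ i from hk).eq_or_lt with rfl | hk
          · exact .inr rfl
          · exact .inl ⟨⟨k, hk, rfl⟩, hz⟩
        · rintro (⟨⟨k, hk, rfl⟩, hz⟩ | rfl)
          · exact ⟨⟨k, by omega, rfl⟩, hz⟩
          · exact ⟨⟨i, by omega, rfl⟩, hZ⟩
    · intro k hk j hj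
      have hj' : j ≠ τ.arr .rcPrevLen [r, y, x'] := by omega
      simp only [Function.update_apply, List.cons.injEq, true_and, and_true, hj', if_false]
      split_ifs with e
      · obtain ⟨⟨l, hl, e'⟩, -⟩ := h1.mem j (by omega)
        rw [← e']
        exact hprev.sorted i hi l hl
      · exact h2 k (by omega) j hj
    · intro ix hix
      simp [hix, h4]
    · intro a b c k hne
      have : ¬ (a = r ∧ b = y ∧ c = x' ∧ k = τ.arr .rcPrevLen [r, y, x']) :=
        fun h => hne h.1 h.2.1 h.2.2.1
      rw [Function.update_of_ne (by simpa using this), h5 a b c k (by simpa using hne)]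
    · refine h1.congr (fun _ _ => rfl) fun x => and_congr_left fun hz => ?_
      constructor
      · exact fun ⟨k, hk, e⟩ => ⟨k, by omega, e⟩
      · rintro ⟨k, hk, rfl⟩
        rcases (show k ≤ i from hk).eq_or_lt with rfl | hk
        · exact absurd hz hZ
        · exact ⟨k, hk, rfl⟩
    · exact fun a b c k hne => h5 a b c k (by simpa using hne)
  · rintro τ m hF ⟨⟨h1, h2, h3, h4⟩, hm⟩
    refine ⟨h1.congr (fun _ _ => rfl) fun x => and_congr_left fun _ => ?_, h2, h3,
      fun a b c k hne => h4 a b c k (by simpa using hne), ?_⟩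
    · constructor
      · rintro ⟨k, hk, rfl⟩
        exact hprev.enum.mem k hk
      · exact hprev.enum.surj x
    · simp only [NExp.cost, List.length_cons, List.length_nil, Finset.sum_const,
        Finset.card_range, smul_eq_mul] at hm
      omega

/-- `appendElem` allocates the element with the next free address. -/
theorem runs_appendElem {σ : State} {r y x u : ℕ}
    (hr : σ.reg .r = r) (hy : σ.reg .y = y) (hx : σ.reg .xP = x) (hu : σ.reg .free = u) :
    Runs .appendElem σ (fun τ m => m ≤ 45 ∧ τ.reg .free = u + 1 ∧
      τ.arr .key = Function.update (σ.arr .key) [u] (σ.reg .yP) ∧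
      τ.arr .pred = Function.update (σ.arr .pred) [u] (σ.arr .rcLast [r, y, x]) ∧
      τ.arr .succ = (if σ.arr .rcLast [r, y, x] = 0 then Function.update (σ.arr .succ) [u] 0 else
        Function.update (Function.update (σ.arr .succ) [u] 0) [σ.arr .rcLast [r, y, x]] u) ∧
      τ.arr .rcFirst = (if σ.arr .rcLast [r, y, x] = 0 then
        Function.update (σ.arr .rcFirst) [r, y, x] u else σ.arr .rcFirst) ∧
      τ.arr .rcLast = Function.update (σ.arr .rcLast) [r, y, x] u) := by
  by_cases h : σ.arr .rcLast [r, y, x] = 0 <;> simp [Cmd.appendElem, hr, hy, hx, hu, h]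

/-- The construction of the list `rcNext'[r,y,x']`, whose elements obtain consecutive addresses.
Their order is that of `Next'[r,x']`. -/
theorem runs_constructRcNext {P : NumberedPair} {σ : State} {r y x lo : ℕ}
    (hr : σ.reg .r = r) (hy : σ.reg .y = y) (hx : σ.reg .xP = x) (hlo : σ.reg .free = lo)
    (hlo0 : 0 < lo)
    (hnext : SortedVec (fun k => σ.arr .nextP [r, x, k]) (σ.arr .nextPLen [r, x])
      (fun z => 0 < P.EP x r z) (fun z => P.EP x r z)) :
    Runs (.block [
      .put .rcFirst [.r, .y, .xP] (.lit 0),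
      .put .rcLast [.r, .y, .xP] (.lit 0),
      .forBelow .i (.get .nextPLen [.r, .xP]) (.block [
        .set .yP (.get .nextP [.r, .xP, .i]),
        .when (.eq (.get .Z [.y, .yP]) (.lit 1)) .appendElem])]) σ (fun τ m => ∃ hi,
      τ.reg .free = hi ∧ lo ≤ hi ∧ hi ≤ lo + σ.arr .nextPLen [r, x] ∧
      IsDll (fun u => lo ≤ u ∧ u < hi) (τ.arr .rcFirst [r, y, x]) (τ.arr .rcLast [r, y, x])
        (fun u => τ.arr .succ [u]) (fun u => τ.arr .pred [u]) ∧
      (∀ u, lo ≤ u → u < hi →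
        0 < P.EP x r (τ.arr .key [u]) ∧ σ.arr .Z [y, τ.arr .key [u]] = 1) ∧
      (∀ z, 0 < P.EP x r z → σ.arr .Z [y, z] = 1 → ∃ u, lo ≤ u ∧ u < hi ∧ τ.arr .key [u] = z) ∧
      (∀ u v, lo ≤ u → u < v → v < hi → τ.arr .key [u] ≠ τ.arr .key [v] ∧
        P.EP x r (τ.arr .key [u]) ≤ P.EP x r (τ.arr .key [v])) ∧
      (∀ u < lo, τ.arr .key [u] = σ.arr .key [u] ∧ τ.arr .succ [u] = σ.arr .succ [u] ∧
        τ.arr .pred [u] = σ.arr .pred [u]) ∧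
      (∀ ix ≠ [r, y, x], τ.arr .rcFirst ix = σ.arr .rcFirst ix ∧
        τ.arr .rcLast ix = σ.arr .rcLast ix) ∧
      m ≤ 40 + 100 * σ.arr .nextPLen [r, x]) := by
  rw [runs_block_cons, runs_seq, runs_put, runs_block_cons, runs_seq, runs_put]
  simp [hr, hy, hx]
  obtain ⟨σ₁, hσ₁⟩ : ∃ σ₁, (σ.setArr .rcFirst [r, y, x] 0).setArr .rcLast [r, y, x] 0 = σ₁ :=
    ⟨_, rfl⟩
  rw [hσ₁]
  have eZ : σ₁.arr .Z = σ.arr .Z := by simp [← hσ₁]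
  have enext : σ₁.arr .nextP = σ.arr .nextP := by simp [← hσ₁]
  have elen : σ₁.arr .nextPLen = σ.arr .nextPLen := by simp [← hσ₁]
  have er : σ₁.reg .r = r := by simp [← hσ₁, hr]
  have ey : σ₁.reg .y = y := by simp [← hσ₁, hy]
  have ex : σ₁.reg .xP = x := by simp [← hσ₁, hx]
  refine (Runs.forBelow (σ.arr .nextPLen [r, x]) (fun j τ => ∃ hi,
      τ.reg .free = hi ∧ lo ≤ hi ∧ hi ≤ lo + j ∧
      IsDll (fun u => lo ≤ u ∧ u < hi) (τ.arr .rcFirst [r, y, x]) (τ.arr .rcLast [r, y, x])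
        (fun u => τ.arr .succ [u]) (fun u => τ.arr .pred [u]) ∧
      (∀ u, lo ≤ u → u < hi → (∃ k < j, σ.arr .nextP [r, x, k] = τ.arr .key [u]) ∧
        σ.arr .Z [y, τ.arr .key [u]] = 1) ∧
      (∀ k < j, σ.arr .Z [y, σ.arr .nextP [r, x, k]] = 1 →
        ∃ u, lo ≤ u ∧ u < hi ∧ τ.arr .key [u] = σ.arr .nextP [r, x, k]) ∧
      (∀ u v, lo ≤ u → u < v → v < hi → τ.arr .key [u] ≠ τ.arr .key [v] ∧
        P.EP x r (τ.arr .key [u]) ≤ P.EP x r (τ.arr .key [v])) ∧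
      (∀ u < lo, τ.arr .key [u] = σ.arr .key [u] ∧ τ.arr .succ [u] = σ.arr .succ [u] ∧
        τ.arr .pred [u] = σ.arr .pred [u]) ∧
      (∀ ix ≠ [r, y, x], τ.arr .rcFirst ix = σ.arr .rcFirst ix ∧
        τ.arr .rcLast ix = σ.arr .rcLast ix)) (fun _ => 70) (fun _ => 0)
    rfl (fun τ hF => by simp [hF.reg .r rfl, hF.reg .xP rfl, hF.arr .nextPLen rfl, elen, er, ex])
    ?_ ?_).mono ?_
  · refine ⟨lo, by simp [← hσ₁, hlo], le_rfl, by omega, ?_, ?_, by simp, ?_, ?_, ?_⟩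
    · have : (fun u => lo ≤ u ∧ u < lo) = fun _ => False := by funext u; simp
      rw [this]
      simpa [← hσ₁] using IsDll.empty _ _
    · intro u h1 h2; omega
    · intro u v h1 h2 h3; omega
    · simp [← hσ₁]
    · intro ix hix
      simp [← hσ₁, hix]
  · rintro j hj τ hF hτj ⟨hi, h1, h2, h3, h4, h5, h6, h7, h8, h9⟩
    have eZ' := (hF.arr .Z rfl).trans eZ
    have enext' := (hF.arr .nextP rfl).trans enext
    have er' := (hF.reg .r rfl).trans er
    have ey' := (hF.reg .y rfl).trans ey
    have ex' := (hF.reg .xP rfl).trans ex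
    obtain ⟨z, hz⟩ : ∃ z, σ.arr .nextP [r, x, j] = z := ⟨_, rfl⟩
    have hl0 : τ.arr .rcLast [r, y, x] < hi := by
      rcases h4.last.1 with h | h <;> omega
    rw [runs_seq, runs_set, runs_ite]
    simp only [NExp.eval, List.map_cons, List.map_nil, er', ex', hτj, enext', hz, Test.Holds,
      setReg_reg, setReg_arr, ey', eZ', if_true, reduceCtorEq, if_false, runs_skip, Test.cost,
      NExp.cost, List.length_cons, List.length_nil]
    refine ⟨fun hZ => (runs_appendElem (r := r) (y := y) (x := x) (u := hi) (by simp [er'])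
      (by simp [ey']) (by simp [ex']) (by simp [h1])).mono ?_, fun hZ => ⟨?_, by omega⟩⟩
    · rintro ρ n - ⟨a1, a2, a3, a4, a5, a6, a7⟩
      have earr : (τ.setReg .yP z).arr = τ.arr := rfl
      rw [earr] at a3 a4 a5 a6 a7
      simp only [setReg_reg, if_true] at a3
      have hkey : ∀ u, ρ.arr .key [u] = if u = hi then z else τ.arr .key [u] := by
        intro u
        simp [a3, Function.update_apply]
      have hlt : ∀ u, lo ≤ u → u < hi →
          τ.arr .key [u] ≠ z ∧ P.EP x r (τ.arr .key [u]) ≤ P.EP x r z := by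
        intro u k1 k2
        obtain ⟨⟨k, hk, e⟩, -⟩ := h5 u k1 k2
        have hs := hnext.sorted j hj k hk
        simp only [e, hz] at hs
        refine ⟨fun e' => ?_, hs⟩
        have := hnext.enum.inj k (hk.trans hj) j hj (e.trans (e'.trans hz.symm))
        omega
      refine ⟨⟨hi + 1, by simpa using a2, by omega, by omega, ?_, ?_, ?_, ?_, ?_, ?_⟩, by omega⟩
      · have hset : (fun u => lo ≤ u ∧ u < hi + 1) = fun u => (lo ≤ u ∧ u < hi) ∨ u = hi := by
          funext u
          exact propext (by omega)
        rw [hset]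
        have el : ρ.arr .rcLast [r, y, x] = hi := by rw [a7]; simp
        rw [el]
        refine h4.append (by omega) (fun v hv => hv.2) ?_ ?_ (fun v hv => ?_) ?_ (fun v hv => ?_)
        · rw [a6]
          split_ifs <;> simp
        · simp only [a5]
          split_ifs with e
          · simp
          · rw [Function.update_of_ne (by simp; omega)]
            simp
        · have hv' : v ≠ hi := by omega
          have hv0 : v ≠ 0 := by omega
          simp only [a5]
          split_ifs with e1 e2 e2
          · omega
          · simp [hv']
          · rw [e2]; simp
          · rw [Function.update_of_ne (by simpa using e2)]
            simp [hv']
        · simp [a4]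
        · have hv' : v ≠ hi := by omega
          simp [a4, hv']
      · intro u k1 k2
        simp only [hkey]
        split_ifs with e
        · exact ⟨⟨j, by omega, hz⟩, hZ⟩
        · obtain ⟨⟨k, hk, e'⟩, hZ'⟩ := h5 u k1 (by omega)
          exact ⟨⟨k, by omega, e'⟩, hZ'⟩
      · intro k hk hZ'
        simp only [hkey]
        rcases (show k ≤ j by omega).eq_or_lt with rfl | hk
        · exact ⟨hi, by omega, by omega, by simp [hz]⟩
        · obtain ⟨u, k1, k2, e⟩ := h6 k hk hZ'
          exact ⟨u, k1, by omega, by rw [if_neg (by omega), e]⟩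
      · intro u v k1 k2 k3
        simp only [hkey]
        rw [if_neg (by omega : u ≠ hi)]
        split_ifs with e
        · exact hlt u k1 (by omega)
        · exact h7 u v k1 k2 (by omega)
      · intro u hu
        obtain ⟨k1, k2, k3⟩ := h8 u hu
        have hne : u ≠ hi := by omega
        refine ⟨?_, ?_, ?_⟩
        · simp only [hkey]
          rw [if_neg hne, k1]
        · simp only [a5]
          split_ifs with e
          · simp [hne, k2]
          · have : u ≠ τ.arr .rcLast [r, y, x] := by
              have := h4.last.1
              omega
            simp [hne, this, k2]
        · simp [a4, hne, k3]
      · intro ix hix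
        obtain ⟨k1, k2⟩ := h9 ix hix
        refine ⟨?_, ?_⟩
        · simp only [a6]
          split_ifs <;> simp [hix, k1]
        · simp [a7, hix, k2]
    · refine ⟨hi, by simpa using h1, h2, by omega, h4, ?_, ?_, h7, h8, h9⟩
      · intro u k1 k2
        obtain ⟨⟨k, hk, e⟩, hZ'⟩ := h5 u k1 k2
        exact ⟨⟨k, by omega, e⟩, hZ'⟩
      · intro k hk hZ'
        rcases (show k ≤ j by omega).eq_or_lt with rfl | hk
        · rw [hz] at hZ'
          exact absurd hZ' hZ
        · exact h6 k hk hZ'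
  · rintro τ m hF ⟨⟨hi, h1, h2, h3, h4, h5, h6, h7, h8, h9⟩, hm⟩
    subst h1
    refine ⟨h2, h3, h4, fun u k1 k2 => ?_, fun z hz hZ => ?_, h7, h8, h9, ?_⟩
    · obtain ⟨⟨k, hk, e⟩, hZ⟩ := h5 u k1 k2
      exact ⟨e ▸ hnext.enum.mem k hk, hZ⟩
    · obtain ⟨k, hk, rfl⟩ := hnext.enum.surj z hz
      exact h6 k hk hZ
    · simp only [NExp.cost, List.length_cons, List.length_nil, Finset.sum_const,
        Finset.card_range, smul_eq_mul] at hm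
      omega

/-- The traversal of a list with the addresses `lo, ..., hi - 1` that stores references to its
elements in `rcNextElem'`. -/
theorem runs_storeRefs {P : NumberedPair} {σ : State} {r y x lo hi : ℕ}
    (hr : σ.reg .r = r) (hy : σ.reg .y = y) (hx : σ.reg .xP = x) (hlh : lo ≤ hi)
    (hinj : ∀ x r y x₂ r₂ y₂, 0 < P.EP x r y → 0 < P.EP x₂ r₂ y₂ →
      σ.arr .edgeIdP [x, r, y] = σ.arr .edgeIdP [x₂, r₂, y₂] → x = x₂ ∧ r = r₂ ∧ y = y₂)
    (hd : IsDll (fun u => lo ≤ u ∧ u < hi) (σ.arr .rcFirst [r, y, x]) (σ.arr .rcLast [r, y, x])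
        (fun u => σ.arr .succ [u]) (fun u => σ.arr .pred [u]))
    (hedge : ∀ u, lo ≤ u → u < hi → 0 < P.EP x r (σ.arr .key [u]))
    (hkey : ∀ u v, lo ≤ u → u < v → v < hi → σ.arr .key [u] ≠ σ.arr .key [v]) :
    Runs (.block [
      .set .u (.get .rcFirst [.r, .y, .xP]),
      .while (.lt (.lit 0) (.reg .u)) (.block [
        .set .yP (.get .key [.u]),
        .set .e (.get .edgeIdP [.xP, .r, .yP]),
        .put .rcNextElemP [.y, .e] (.reg .u),
        .set .u (.get .succ [.u])])]) σ (fun τ m =>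
      (∀ u, lo ≤ u → u < hi →
        τ.arr .rcNextElemP [y, σ.arr .edgeIdP [x, r, σ.arr .key [u]]] = u) ∧
      (∀ ix, (∀ z, 0 < P.EP x r z → ix ≠ [y, σ.arr .edgeIdP [x, r, z]]) →
        τ.arr .rcNextElemP ix = σ.arr .rcNextElemP ix) ∧
      m ≤ 10 + 20 * (hi - lo)) := by
  rw [runs_block_cons, runs_seq, runs_set]
  simp only [NExp.eval, List.map_cons, List.map_nil, hr, hy, hx, NExp.cost, List.length_cons,
    List.length_nil]
  refine Runs.while (fun τ m =>
    (τ.reg .u = 0 ∨ lo ≤ τ.reg .u ∧ τ.reg .u < hi) ∧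
    (∀ v, lo ≤ v → v < hi → τ.reg .u = 0 ∨ v < τ.reg .u →
      τ.arr .rcNextElemP [y, σ.arr .edgeIdP [x, r, σ.arr .key [v]]] = v) ∧
    (∀ ix, (∀ z, 0 < P.EP x r z → ix ≠ [y, σ.arr .edgeIdP [x, r, z]]) →
        τ.arr .rcNextElemP ix = σ.arr .rcNextElemP ix) ∧
    m ≤ 20 * (hi - lo) ∧ (τ.reg .u ≠ 0 → m ≤ 20 * (τ.reg .u - lo)))
    (20 * (hi - lo)) ?_ (fun _ _ h => h.2.2.2.1) ?_ ?_
  · obtain ⟨f, hf⟩ : ∃ f, σ.arr .rcFirst [r, y, x] = f := ⟨_, rfl⟩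
    have h1 := hd.first
    rw [hf] at h1
    simp only [setReg_reg, if_true, setReg_arr, hf]
    refine ⟨?_, ?_, by simp, by omega, by omega⟩
    · rcases h1 with ⟨h, -⟩ | ⟨h, -⟩
      · exact .inl h
      · exact .inr h
    · intro v k1 k2 k3
      have := hd.pos v ⟨k1, k2⟩
      rcases h1 with ⟨-, h⟩ | ⟨h, h', h''⟩
      · have := h v ⟨k1, k2⟩
        omega
      · have := h'' v ⟨k1, k2⟩ this
        omega
  · rintro τ m hF ⟨h1, h2, h3, h4, h5⟩ hb
    have hb' : 0 < τ.reg .u := by simpa using hb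
    obtain ⟨u, hu⟩ : ∃ u, τ.reg .u = u := ⟨_, rfl⟩
    rw [hu] at h1 h2 h5 hb'
    have hu' : lo ≤ u ∧ u < hi := h1.resolve_left (by omega)
    have er : τ.reg .r = r := (hF.reg .r rfl).trans (by simp [hr])
    have ey : τ.reg .y = y := (hF.reg .y rfl).trans (by simp [hy])
    have ex : τ.reg .xP = x := (hF.reg .xP rfl).trans (by simp [hx])
    have ek : τ.arr .key = σ.arr .key := hF.arr .key rfl
    have es : τ.arr .succ = σ.arr .succ := hF.arr .succ rfl
    have ee : τ.arr .edgeIdP = σ.arr .edgeIdP := hF.arr .edgeIdP rfl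
    have hs := hd.succ u hu'
    obtain ⟨w, hw⟩ : ∃ w, σ.arr .succ [u] = w := ⟨_, rfl⟩
    simp only [hw] at hs
    simp [hu, er, ey, ex, ek, es, ee, hw]
    have hne : ∀ v, lo ≤ v → v < hi → v ≠ u →
        σ.arr .edgeIdP [x, r, σ.arr .key [v]] ≠ σ.arr .edgeIdP [x, r, σ.arr .key [u]] := by
      intro v k1 k2 k3 e
      have e' := (hinj _ _ _ _ _ _ (hedge v k1 k2) (hedge u hu'.1 hu'.2) e).2.2
      rcases Nat.lt_or_gt_of_ne k3 with h | h
      · exact hkey v u k1 h hu'.2 e'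
      · exact hkey u v hu'.1 h k2 e'.symm
    refine ⟨?_, ?_, ?_, ?_, ?_⟩
    · rcases hs with ⟨h, -⟩ | ⟨h, -⟩
      · exact .inl h
      · exact .inr h
    · intro v k1 k2 k3
      by_cases e : v = u
      · rw [e]; simp
      · rw [Function.update_of_ne (by simpa using hne v k1 k2 e)]
        refine h2 v k1 k2 (.inr ?_)
        rcases hs with ⟨h, h'⟩ | ⟨h, h', h''⟩
        · have := h' v ⟨k1, k2⟩
          omega
        · by_contra hc
          have := h'' v ⟨k1, k2⟩ (by omega)
          omega
    · intro ix hix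
      rw [Function.update_of_ne (hix _ (hedge u hu'.1 hu'.2)), h3 ix hix]
    · have := h5 (by omega)
      omega
    · intro hw0
      have := h5 (by omega)
      rcases hs with ⟨h, -⟩ | ⟨-, h, -⟩ <;> omega
  · rintro τ m hF ⟨h1, h2, h3, h4, h5⟩ hb
    have hb' : τ.reg .u = 0 := by simpa using hb
    refine ⟨fun u k1 k2 => h2 u k1 k2 (.inl hb'), h3, ?_⟩
    simp only [Test.cost, NExp.cost]
    omega

/-- The invariant of the loop that constructs `rcPrev[r,y,x']` and `rcNext'[r,y,x']`, when this
has been done for the triples `(r,y,x')` in `D`. -/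
structure RcInv (P : NumberedPair) (D : Set (ℕ × ℕ × ℕ)) (σ : State) : Prop where
  free_pos : 0 < σ.reg .free
  lists : ∃ N, RcLists P (fun r y x z => (r, y, x) ∈ D ∧ 0 < P.EP x r z ∧ σ.arr .Z [y, z] = 1)
    N D σ ∧ ∀ r y x u, N r y x u → u < σ.reg .free
  rcPrev : ∀ r y x', (r, y, x') ∈ D → SortedVec (fun k => σ.arr .rcPrev [r, y, x', k])
    (σ.arr .rcPrevLen [r, y, x']) (fun x => 0 < P.E x r y ∧ σ.arr .Z [x, x'] = 1)
    (fun x => P.E x r y)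
  rcPrevLen_le : ∀ r y x', (r, y, x') ∈ D → σ.arr .rcPrevLen [r, y, x'] ≤ σ.arr .prevLen [r, y]

/-- `constructRc` deals with one further triple `(r,y,x)`. It overwrites no reference to an element
of another list, because the IDs of the edges are distinct. -/
theorem runs_constructRc {P : NumberedPair} {σ : State} {D : Set (ℕ × ℕ × ℕ)} {r y x : ℕ}
    (h : RcInv P D σ) (hD : (r, y, x) ∉ D)
    (hr : σ.reg .r = r) (hy : σ.reg .y = y) (hx : σ.reg .xP = x)
    (hinj : ∀ x r y x₂ r₂ y₂, 0 < P.EP x r y → 0 < P.EP x₂ r₂ y₂ →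
      σ.arr .edgeIdP [x, r, y] = σ.arr .edgeIdP [x₂, r₂, y₂] → x = x₂ ∧ r = r₂ ∧ y = y₂)
    (hprev : SortedVec (fun k => σ.arr .prev [r, y, k]) (σ.arr .prevLen [r, y])
      (fun x => 0 < P.E x r y) (fun x => P.E x r y))
    (hnext : SortedVec (fun k => σ.arr .nextP [r, x, k]) (σ.arr .nextPLen [r, x])
      (fun z => 0 < P.EP x r z) (fun z => P.EP x r z)) :
    Runs .constructRc σ (fun τ m => RcInv P (insert (r, y, x) D) τ ∧
      m ≤ 70 + 50 * σ.arr .prevLen [r, y] + 120 * σ.arr .nextPLen [r, x]) := by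
  obtain ⟨h1, ⟨N, hL, hN⟩, h3, h4⟩ := h
  rw [Cmd.constructRc, runs_block_cons_cons]
  refine Runs.seq (runs_constructRcPrev hr hy hx hprev) ?_
  rintro σ₁ m₁ hF₁ ⟨a1, a2, a3, a4, a5⟩
  rw [runs_block_cons_cons_cons]
  have enext : σ₁.arr .nextP = σ.arr .nextP := hF₁.arr .nextP rfl
  have enextL : σ₁.arr .nextPLen = σ.arr .nextPLen := hF₁.arr .nextPLen rfl
  have efree : σ₁.reg .free = σ.reg .free := hF₁.reg .free rfl
  refine Runs.seq (runs_constructRcNext (P := P) (r := r) (y := y) (x := x)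
    ((hF₁.reg .r rfl).trans hr) ((hF₁.reg .y rfl).trans hy) ((hF₁.reg .xP rfl).trans hx) efree h1
    (by rw [enext, enextL]; exact hnext)) ?_
  rintro σ₂ m₂ hF₂ ⟨hi, b1, b2, b3, b4, b5, b6, b7, b8, b9, b10⟩
  have eid : σ₂.arr .edgeIdP = σ.arr .edgeIdP :=
    (hF₂.arr .edgeIdP rfl).trans (hF₁.arr .edgeIdP rfl)
  refine (runs_storeRefs (P := P) (r := r) (y := y) (x := x) (lo := σ.reg .free) (hi := hi)
    ((hF₂.reg .r rfl).trans ((hF₁.reg .r rfl).trans hr))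
    ((hF₂.reg .y rfl).trans ((hF₁.reg .y rfl).trans hy))
    ((hF₂.reg .xP rfl).trans ((hF₁.reg .xP rfl).trans hx)) b2 (by rwa [eid]) b4
    (fun u k1 k2 => (b5 u k1 k2).1) (fun u v k1 k2 k3 => (b7 u v k1 k2 k3).1)).mono ?_
  rintro τ m₃ hF₃ ⟨c1, c2, c3⟩
  have eZ : τ.arr .Z = σ.arr .Z :=
    (hF₃.arr .Z rfl).trans ((hF₂.arr .Z rfl).trans (hF₁.arr .Z rfl))
  have eid' : τ.arr .edgeIdP = σ.arr .edgeIdP := (hF₃.arr .edgeIdP rfl).trans eid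
  have eprev : τ.arr .prevLen = σ.arr .prevLen :=
    (hF₃.arr .prevLen rfl).trans ((hF₂.arr .prevLen rfl).trans (hF₁.arr .prevLen rfl))
  have ercp : τ.arr .rcPrev = σ₁.arr .rcPrev := (hF₃.arr .rcPrev rfl).trans (hF₂.arr .rcPrev rfl)
  have ercl : τ.arr .rcPrevLen = σ₁.arr .rcPrevLen :=
    (hF₃.arr .rcPrevLen rfl).trans (hF₂.arr .rcPrevLen rfl)
  have eref : σ₂.arr .rcNextElemP = σ.arr .rcNextElemP :=
    (hF₂.arr .rcNextElemP rfl).trans (hF₁.arr .rcNextElemP rfl)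
  have ekey : τ.arr .key = σ₂.arr .key := hF₃.arr .key rfl
  have efree' : τ.reg .free = hi := (hF₃.reg .free rfl).trans b1
  rw [hF₁.arr .key rfl, hF₁.arr .succ rfl, hF₁.arr .pred rfl] at b8
  rw [hF₁.arr .rcFirst rfl, hF₁.arr .rcLast rfl] at b9
  rw [hF₁.arr .Z rfl] at b5 b6
  rw [eid] at c1 c2
  rw [eref] at c2
  rw [enextL] at b3 b10
  have hlo : ∀ a b c u, N a b c u → u < σ.reg .free := hN
  have hND : ∀ a b c u, N a b c u → (a, b, c) ∈ D := fun a b c u k => (hL.entry a b c u k).1.1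
  have hne : ∀ a b c, (a, b, c) ∈ D → [a, b, c] ≠ [r, y, x] := by
    intro a b c k e
    simp only [List.cons.injEq, and_true] at e
    obtain ⟨rfl, rfl, rfl⟩ := e
    exact hD k
  -- the references to the elements of the other lists are not overwritten
  have hkeep : ∀ a b c z, (a, b, c) ∈ D → 0 < P.EP c a z →
      τ.arr .rcNextElemP [b, σ.arr .edgeIdP [c, a, z]] =
        σ.arr .rcNextElemP [b, σ.arr .edgeIdP [c, a, z]] := by
    intro a b c z hk hz
    refine c2 _ fun z' hz' e => ?_
    simp only [List.cons.injEq, and_true] at e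
    obtain ⟨rfl, rfl, -⟩ := hinj _ _ _ _ _ _ hz hz' e.2
    exact hne a b c hk (by rw [e.1])
  refine ⟨⟨by omega, ⟨fun a b c u => N a b c u ∨ a = r ∧ b = y ∧ c = x ∧ σ.reg .free ≤ u ∧ u < hi,
    ⟨?_, ?_, ?_, ?_, fun a b c z k => k.2.1, fun a b c z k => k.1, ?_⟩, ?_⟩, ?_, ?_⟩, by omega⟩
  · rintro a b c a₂ b₂ c₂ u (k | ⟨rfl, rfl, rfl, k1, k2⟩) (k' | ⟨rfl, rfl, rfl, k1', k2'⟩)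
    · exact hL.disj _ _ _ _ _ _ _ k k'
    · have := hlo _ _ _ _ k
      omega
    · have := hlo _ _ _ _ k'
      omega
    · exact ⟨rfl, rfl, rfl⟩
  · intro a b c k
    rw [hF₃.arr .rcFirst rfl, hF₃.arr .rcLast rfl, hF₃.arr .succ rfl, hF₃.arr .pred rfl]
    rcases k with e | k
    · simp only [Prod.mk.injEq] at e
      obtain ⟨rfl, rfl, rfl⟩ := e
      have : (fun u => N a b c u ∨ a = a ∧ b = b ∧ c = c ∧ σ.reg .free ≤ u ∧ u < hi) =
          fun u => σ.reg .free ≤ u ∧ u < hi := by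
        funext u
        refine propext ⟨?_, fun k => .inr ⟨rfl, rfl, rfl, k⟩⟩
        rintro (k | k)
        · exact absurd (hND _ _ _ _ k) hD
        · exact k.2.2.2
      rw [this]
      exact b4
    · have hn := hne a b c k
      have : (fun u => N a b c u ∨ a = r ∧ b = y ∧ c = x ∧ σ.reg .free ≤ u ∧ u < hi) =
          N a b c := by
        funext u
        refine propext ⟨?_, .inl⟩
        rintro (k | ⟨rfl, rfl, rfl, -⟩)
        · exact k
        · exact absurd rfl hn
      rw [this]
      exact (hL.dll a b c k).congr (b9 _ hn).1 (b9 _ hn).2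
        (fun v hv => (b8 v (hlo _ _ _ _ hv)).2.1) (fun v hv => (b8 v (hlo _ _ _ _ hv)).2.2)
  · rintro a b c u (k | ⟨rfl, rfl, rfl, k1, k2⟩)
    · obtain ⟨⟨g1, g2, g3⟩, g4⟩ := hL.entry a b c u k
      rw [ekey, (b8 u (hlo _ _ _ _ k)).1, eid', eZ, hkeep a b c _ g1 g2]
      exact ⟨⟨.inr g1, g2, g3⟩, g4⟩
    · rw [ekey, eid', eZ]
      exact ⟨⟨.inl rfl, b5 u k1 k2⟩, c1 u k1 k2⟩
  · rintro a b c z ⟨k, hz, hZ⟩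
    rw [eZ] at hZ
    rw [ekey, eid']
    rcases k with e | k
    · simp only [Prod.mk.injEq] at e
      obtain ⟨rfl, rfl, rfl⟩ := e
      obtain ⟨u, k1, k2, rfl⟩ := b6 z hz hZ
      rw [c1 u k1 k2]
      exact ⟨.inr ⟨rfl, rfl, rfl, k1, k2⟩, rfl⟩
    · obtain ⟨g1, g2⟩ := hL.complete a b c z ⟨k, hz, hZ⟩
      rw [hkeep a b c z k hz, (b8 _ (hlo _ _ _ _ g1)).1]
      exact ⟨.inl g1, g2⟩
  · rintro a b c u v (k | ⟨rfl, rfl, rfl, k1, k2⟩) (k' | ⟨e1, e2, e3, k1', k2'⟩) huv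
    · rw [ekey, (b8 u (hlo _ _ _ _ k)).1, (b8 v (hlo _ _ _ _ k')).1]
      exact hL.sorted a b c u v k k' huv
    · subst e1 e2 e3
      exact absurd (hND _ _ _ _ k) hD
    · exact absurd (hND _ _ _ _ k') hD
    · rw [ekey]
      exact (b7 u v k1 huv k2').2
  · rintro a b c u (k | ⟨-, -, -, -, k⟩)
    · have := hlo _ _ _ _ k
      omega
    · omega
  · intro a b c k
    rw [ercp, ercl, eZ]
    rcases k with e | k
    · simp only [Prod.mk.injEq] at e
      obtain ⟨rfl, rfl, rfl⟩ := e
      exact a1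
    · have hn := hne a b c k
      rw [a3 _ hn]
      exact (h3 a b c k).congr (fun j _ => (a4 a b c j hn).symm) (fun _ => Iff.rfl)
  · intro a b c k
    rw [ercl, eprev]
    rcases k with e | k
    · simp only [Prod.mk.injEq] at e
      obtain ⟨rfl, rfl, rfl⟩ := e
      exact a2
    · rw [a3 _ (hne a b c k)]
      exact h4 a b c k

/-! ### Sorting -/

/-- The inner loop of insertion sort moves the elements of larger degree than the element at
position `i` one position to the right. On exit `j` is the position where that element belongs. -/
theorem runs_insertLoop {a : Arr} {r₁ r₂ : Reg} {deg : Reg → RExp} {σ : State}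
    {p q i : ℕ} {w : ℕ → ℝ} {Q : ℕ → Prop} {f : ℕ → ℕ}
    (h₁ : r₁ ∉ [Reg.i, .cur, .j, .go, .jPred, .other])
    (h₂ : r₂ ∉ [Reg.i, .cur, .j, .go, .jPred, .other])
    (hp : σ.reg r₁ = p) (hq : σ.reg r₂ = q)
    (hcost : ∀ v, (deg v).cost = 4)
    (hdeg : ∀ τ v, τ.reg r₁ = p → τ.reg r₂ = q → τ.rarr = σ.rarr → Q (τ.reg v) →
      (deg v).eval τ = w (τ.reg v))
    (hf : ∀ k, σ.arr a [p, q, k] = f k) (hQ : ∀ k ≤ i, Q (f k))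
    (hcur : σ.reg .cur = f i) (hj : σ.reg .j = i) (hgo : σ.reg .go = 1) :
    Runs (.while (.eq (.reg .go) (.lit 1))
      (.ite (.eq (.reg .j) (.lit 0))
        (.set .go (.lit 0))
        (.block [
          .set .jPred (.pred (.reg .j)),
          .set .other (.get a ([r₁, r₂] ++ [.jPred])),
          .ite (.rle (deg .other) (deg .cur))
            (.set .go (.lit 0))
            (.block [
              .put a ([r₁, r₂] ++ [.j]) (.reg .other),
              .set .j (.reg .jPred)])]))) σ (fun τ m => ∃ j ≤ i, τ.reg .j = j ∧
      (∀ k < j, τ.arr a [p, q, k] = f k) ∧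
      (∀ k, j < k → k ≤ i → τ.arr a [p, q, k] = f (k - 1)) ∧
      (∀ k, i < k → τ.arr a [p, q, k] = f k) ∧
      (∀ k, j ≤ k → k < i → w (f i) < w (f k)) ∧
      (j = 0 ∨ w (f (j - 1)) ≤ w (f i)) ∧
      (∀ p' q' k, [p', q'] ≠ [p, q] → τ.arr a [p', q', k] = σ.arr a [p', q', k]) ∧
      m ≤ 40 * i + 40) := by
  simp only [List.mem_cons, List.not_mem_nil, or_false, not_or] at h₁ h₂
  obtain ⟨u1, u2, u3, u4, u5, u6⟩ := h₁
  obtain ⟨v1, v2, v3, v4, v5, v6⟩ := h₂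
  refine Runs.while (fun τ m => ∃ j ≤ i, τ.reg .j = j ∧
      (∀ k < j, τ.arr a [p, q, k] = f k) ∧
      (∀ k, j < k → k ≤ i → τ.arr a [p, q, k] = f (k - 1)) ∧
      (∀ k, i < k → τ.arr a [p, q, k] = f k) ∧
      (∀ k, j ≤ k → k < i → w (f i) < w (f k)) ∧
      (∀ p' q' k, [p', q'] ≠ [p, q] → τ.arr a [p', q', k] = σ.arr a [p', q', k]) ∧
      (τ.reg .go = 1 ∧ m ≤ 40 * (i - j) ∨ τ.reg .go ≠ 1 ∧ m ≤ 40 * (i - j) + 35 ∧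
        (j = 0 ∨ w (f (j - 1)) ≤ w (f i)))) (40 * i + 35) ?_ ?_ ?_ ?_
  · refine ⟨i, le_rfl, hj, fun k _ => hf k, fun k _ _ => by omega, fun k _ => hf k,
      fun k _ _ => by omega, fun _ _ _ _ => rfl, .inl ⟨hgo, by omega⟩⟩
  · rintro τ m ⟨j, -, -, -, -, -, -, -, h⟩
    omega
  · rintro τ m hF ⟨j, hji, hτj, g1, g2, g3, g4, g5, g6⟩ hb
    have hgo' : τ.reg .go = 1 := by simpa using hb
    have hm := (g6.resolve_right fun h => h.1 hgo').2
    have ep : τ.reg r₁ = p :=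
      (hF.reg r₁ (by simp [Cmd.writesReg, u3, u4, u5, u6])).trans hp
    have eq : τ.reg r₂ = q :=
      (hF.reg r₂ (by simp [Cmd.writesReg, v3, v4, v5, v6])).trans hq
    have ecur : τ.reg .cur = f i := (hF.reg .cur (by simp [Cmd.writesReg])).trans hcur
    have er : τ.rarr = σ.rarr := by
      funext b
      exact hF.rarr b (by simp [Cmd.writesRArr])
    rw [runs_ite]
    refine ⟨fun h0 => ?_, fun h0 => ?_⟩
    · have hj0 : j = 0 := by simpa [hτj] using h0
      subst hj0
      rw [runs_set]
      refine ⟨0, hji, by simpa using hτj, g1, g2, g3, g4, g5,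
        .inr ⟨by simp [NExp.eval], ?_, .inl rfl⟩⟩
      simp only [Test.cost, NExp.cost]
      omega
    · have hj0 : j ≠ 0 := by simpa [hτj] using h0
      simp only [Cmd.block]
      rw [runs_seq, runs_set, runs_seq, runs_set]
      have eo : τ.arr a [p, q, j - 1] = f (j - 1) := g1 _ (by omega)
      simp only [NExp.eval, List.map_cons, List.map_nil, List.cons_append,
        List.nil_append, setReg_reg, setReg_arr, u5, v5, hτj, ep, eq, eo, if_true, if_false]
      obtain ⟨ρ, hρ⟩ : ∃ ρ, (τ.setReg .jPred (j - 1)).setReg .other (f (j - 1)) = ρ := ⟨_, rfl⟩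
      rw [hρ]
      have e1 : ρ.reg .other = f (j - 1) := by simp [← hρ]
      have e2 : ρ.reg .cur = f i := by simp [← hρ, ecur]
      have e3 : ρ.reg r₁ = p := by simp [← hρ, u5, u6, ep]
      have e4 : ρ.reg r₂ = q := by simp [← hρ, v5, v6, eq]
      have e5 : ρ.rarr = σ.rarr := by simp [← hρ, er]
      have e6 : ρ.reg .j = j := by simp [← hρ, hτj]
      have e7 : ρ.reg .jPred = j - 1 := by simp [← hρ]
      have e8 : ρ.arr = τ.arr := by simp [← hρ]
      have e9 : ρ.reg .go = 1 := by simp [← hρ, hgo']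
      have d1 := hdeg ρ .other e3 e4 e5 (e1 ▸ hQ _ (by omega))
      have d2 := hdeg ρ .cur e3 e4 e5 (e2 ▸ hQ _ le_rfl)
      rw [e1] at d1
      rw [e2] at d2
      rw [runs_ite]
      simp only [Test.Holds, d1, d2, not_le, runs_set, runs_seq, runs_put]
      refine ⟨fun hle => ?_, fun hlt => ?_⟩
      · refine ⟨j, hji, by simpa using e6, ?_, ?_, ?_, g4, ?_,
          .inr ⟨by simp [NExp.eval], ?_, .inr hle⟩⟩
        · simpa only [setReg_arr, e8] using g1
        · simpa only [setReg_arr, e8] using g2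
        · simpa only [setReg_arr, e8] using g3
        · simpa only [setReg_arr, e8] using g5
        · simp only [Test.cost, NExp.cost, hcost, List.length_cons, List.length_nil]
          omega
      · simp only [NExp.eval, setArr_reg, e7, e1, e6, e3, e4, List.map_cons,
          List.map_nil]
        refine ⟨j - 1, by omega, by simp, ?_, ?_, ?_, ?_, ?_, .inl ⟨by simpa using e9, ?_⟩⟩
        · intro k hk
          have : k ≠ j := by omega
          simp [e8, this, g1 k (by omega)]
        · intro k hk hki
          by_cases e : k = j
          · simp [e]
          · simp [e8, e, g2 k (by omega) hki]
        · intro k hk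
          have : k ≠ j := by omega
          simp [e8, this, g3 k hk]
        · intro k hk hki
          by_cases e : k = j - 1
          · rwa [e]
          · exact g4 k (by omega) hki
        · intro p' q' k hne
          have : [p', q', k] ≠ [p, q, j] := fun e => hne (by simp_all)
          simp [e8, this, g5 p' q' k hne]
        · simp only [Test.cost, NExp.cost, hcost, List.length_cons, List.length_nil]
          omega
  · rintro τ m hF ⟨j, hji, hτj, g1, g2, g3, g4, g5, g6⟩ hb
    have hgo' : τ.reg .go ≠ 1 := by simpa using hb
    obtain ⟨-, hm, g7⟩ := g6.resolve_left fun h => hgo' h.1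
    refine ⟨j, hji, hτj, g1, g2, g3, g4, g7, g5, ?_⟩
    simp only [Test.cost, NExp.cost]
    omega

/-- Insertion sort. The degrees `deg` only have to agree with `w` on elements of the vector, and the
other vectors of the family are left unchanged. -/
theorem runs_sortVec {a aLen : Arr} {r₁ r₂ : Reg} {deg : Reg → RExp} {σ : State}
    {p q : ℕ} {w : ℕ → ℝ} {Q : ℕ → Prop}
    (h₁ : r₁ ∉ [Reg.i, .cur, .j, .go, .jPred, .other])
    (h₂ : r₂ ∉ [Reg.i, .cur, .j, .go, .jPred, .other]) (ha : aLen ≠ a)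
    (hp : σ.reg r₁ = p) (hq : σ.reg r₂ = q)
    (hcost : ∀ v, (deg v).cost = 4)
    (hdeg : ∀ τ v, τ.reg r₁ = p → τ.reg r₂ = q → τ.rarr = σ.rarr → Q (τ.reg v) →
      (deg v).eval τ = w (τ.reg v))
    (hvec : Enumerates (fun k => σ.arr a [p, q, k]) (σ.arr aLen [p, q]) Q) :
    Runs (.sortVec a aLen [r₁, r₂] deg) σ (fun τ m =>
      SortedVec (fun k => τ.arr a [p, q, k]) (σ.arr aLen [p, q]) Q w ∧
      (∀ p' q' k, [p', q'] ≠ [p, q] → τ.arr a [p', q', k] = σ.arr a [p', q', k]) ∧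
      m ≤ 20 + 80 * σ.arr aLen [p, q] + 40 * (σ.arr aLen [p, q] * σ.arr aLen [p, q])) := by
  simp only [List.mem_cons, List.not_mem_nil, or_false, not_or] at h₁ h₂
  have h₁' := h₁
  have h₂' := h₂
  obtain ⟨u1, u2, u3, u4, u5, u6⟩ := h₁
  obtain ⟨v1, v2, v3, v4, v5, v6⟩ := h₂
  obtain ⟨n, hn⟩ : ∃ n, σ.arr aLen [p, q] = n := ⟨_, rfl⟩
  rw [hn] at hvec ⊢
  have hwr : ∀ v, v ≠ .i ∧ v ≠ .cur ∧ v ≠ .j ∧ v ≠ .go ∧ v ≠ .jPred ∧ v ≠ .other →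
      (Cmd.sortVec a aLen [r₁, r₂] deg).writesReg v = false := by
    rintro v ⟨w1, w2, w3, w4, w5, w6⟩
    simp [Cmd.sortVec, Cmd.forBelow, Cmd.writesReg, w1, w2, w3, w4, w5, w6]
  have hwa : (Cmd.sortVec a aLen [r₁, r₂] deg).writesArr aLen = false := by
    simp [Cmd.sortVec, Cmd.forBelow, Cmd.writesArr, ha]
  have hwr' : ∀ b, (Cmd.sortVec a aLen [r₁, r₂] deg).writesRArr b = false := by
    simp [Cmd.sortVec, Cmd.forBelow, Cmd.writesRArr]
  rw [Cmd.sortVec] at *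
  refine (Runs.forBelow n (fun i τ =>
    Enumerates (fun k => τ.arr a [p, q, k]) n Q ∧
    (∀ k < i, ∀ j < k, w (τ.arr a [p, q, j]) ≤ w (τ.arr a [p, q, k])) ∧
    (∀ p' q' k, [p', q'] ≠ [p, q] → τ.arr a [p', q', k] = σ.arr a [p', q', k]))
    (fun i => 40 * n + 70) (fun _ => 0) (by simp [Cmd.writesReg])
    (fun τ hF => ?_) ⟨hvec, by simp, fun _ _ _ _ => rfl⟩ ?_).mono ?_
  · simp [hF.reg _ (hwr _ h₁'), hF.reg _ (hwr _ h₂'), hF.arr _ hwa, hp, hq, hn]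
  · rintro i hi τ hF hτi ⟨g1, g2, g3⟩
    have ep : τ.reg r₁ = p := (hF.reg _ (hwr _ h₁')).trans hp
    have eq : τ.reg r₂ = q := (hF.reg _ (hwr _ h₂')).trans hq
    have er : τ.rarr = σ.rarr := funext fun b => hF.rarr b (hwr' b)
    obtain ⟨f, hf⟩ : ∃ f : ℕ → ℕ, ∀ k, τ.arr a [p, q, k] = f k := ⟨_, fun _ => rfl⟩
    simp only [hf] at g1 g2
    rw [runs_block_cons_cons_cons]
    refine Runs.seq (Q₁ := fun ρ m => ρ.reg r₁ = p ∧ ρ.reg r₂ = q ∧ ρ.reg .cur = f i ∧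
      ρ.reg .j = i ∧ ρ.reg .go = 1 ∧ ρ.reg .i = i ∧ ρ.arr = τ.arr ∧ m ≤ 10) ?_ ?_
    · simp [ep, eq, hτi, hf, u2, u3, u4, v2, v3, v4]
    · rintro ρ m hFρ ⟨k1, k2, k3, k4, k5, k6, k7, k8⟩
      have er' : ρ.rarr = σ.rarr := by
        rw [← er]
        funext b
        exact hFρ.rarr b (by simp [Cmd.writesRArr])
      rw [runs_block_cons]
      refine Runs.seq (runs_insertLoop (Q := Q) (w := w) (f := f) (i := i) (by simpa using h₁')
        (by simpa using h₂') k1 k2 hcost (fun τ' v a1 a2 a3 => hdeg τ' v a1 a2 (a3.trans er'))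
        (by rw [k7]; exact hf) (fun k hk => g1.mem k (by omega)) k3 k4 k5) ?_
      rintro τ' m' hF' ⟨j, hji, b1, b2, b3, b4, b5, b6, b7, b8⟩
      have c1 : τ'.reg r₁ = p :=
        (hF'.reg r₁ (by simp [Cmd.writesReg, u3, u4, u5, u6])).trans k1
      have c2 : τ'.reg r₂ = q :=
        (hF'.reg r₂ (by simp [Cmd.writesReg, v3, v4, v5, v6])).trans k2
      have c3 : τ'.reg .cur = f i := (hF'.reg .cur (by simp [Cmd.writesReg])).trans k3
      rw [Cmd.block, runs_put]
      simp only [List.map_cons, List.map_nil, List.cons_append,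
        List.nil_append, NExp.eval, c1, c2, c3, b1, setReg_arr, setArr_arr, if_true]
      obtain ⟨g, hg⟩ : ∃ g : ℕ → ℕ, ∀ k,
        Function.update (τ'.arr a) [p, q, j] (f i) [p, q, k] = g k := ⟨_, fun _ => rfl⟩
      have d1 : ∀ k < j, g k = f k := by
        intro k hk
        rw [← hg, Function.update_of_ne (by simp; omega), b2 k hk]
      have d2 : g j = f i := by rw [← hg]; simp
      have d3 : ∀ k, j < k → k ≤ i → g k = f (k - 1) := by
        intro k hk hki
        rw [← hg, Function.update_of_ne (by simp; omega), b3 k hk hki]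
      have d4 : ∀ k, i < k → g k = f k := by
        intro k hk
        rw [← hg, Function.update_of_ne (by simp; omega), b4 k hk]
      simp only [hg]
      refine ⟨⟨g1.insert hi hji d1 d2 d3 d4, ?_, ?_⟩, ?_⟩
      · intro k hk l hl
        rcases lt_trichotomy k j with hkj | rfl | hkj
        · rw [d1 k hkj, d1 l (by omega)]
          exact g2 k (by omega) l hl
        · rw [d2, d1 l hl]
          refine le_trans ?_ (b6.resolve_left (by omega))
          rcases (show l ≤ k - 1 by omega).eq_or_lt with e | hlt
          · rw [e]
          · exact g2 (k - 1) (by omega) l hlt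
        · rw [d3 k hkj (by omega)]
          rcases lt_trichotomy l j with hlj | rfl | hlj
          · rw [d1 l hlj]
            exact g2 (k - 1) (by omega) l (by omega)
          · rw [d2]
            exact (b5 (k - 1) (by omega) (by omega)).le
          · rw [d3 l hlj (by omega)]
            exact g2 (k - 1) (by omega) (l - 1) (by omega)
      · intro p' q' k hne
        have : [p', q', k] ≠ [p, q, j] := fun e => hne (by simp_all)
        rw [Function.update_of_ne this, b7 p' q' k hne, k7, g3 p' q' k hne]
      · simp only [NExp.cost, List.length_cons, List.length_nil]
        omega
  · rintro τ m hF ⟨⟨g1, g2, g3⟩, hm⟩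
    refine ⟨⟨g1, g2⟩, g3, ?_⟩
    simp only [NExp.cost, List.length_cons, List.length_nil, Finset.sum_const,
      Finset.card_range, smul_eq_mul] at hm
    nlinarith

/-! ### Loops up to the contents of registers -/

theorem runs_block_singleton {σ : State} {c : Cmd} {Q : State → ℕ → Prop} :
    Runs (.block [c]) σ Q ↔ Runs c σ Q := Iff.rfl

/-- Loop rule for a loop up to the content of a register whose iterations all satisfy the same
bound on the number of steps. -/
theorem Runs.forReg {v w : Reg} {c : Cmd} {σ : State} {Q : State → ℕ → Prop} (n K : ℕ)
    (I : ℕ → State → Prop) (hv : c.writesReg v = false)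
    (hw : (Cmd.forBelow v (.reg w) c).writesReg w = false) (hn : σ.reg w = n)
    (h0 : I 0 (σ.setReg v 0))
    (hstep : ∀ k < n, ∀ τ, Frame (.forBelow v (.reg w) c) σ τ → τ.reg v = k → I k τ →
      Runs c τ (fun τ' m => I (k + 1) (τ'.setReg v (k + 1)) ∧ m ≤ K))
    (hpost : ∀ τ m, Frame (.forBelow v (.reg w) c) σ τ → I n τ → m ≤ 5 + n * (K + 6) → Q τ m) :
    Runs (.forBelow v (.reg w) c) σ Q := by
  refine (Runs.forBelow n I (fun _ => K) (fun _ => 0) hv (fun τ hF => (hF.reg w hw).trans hn) h0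
    fun k hk τ hF hvk hI => (hstep k hk τ hF hvk hI).mono fun τ' m _ h => ⟨h.1, h.2⟩).mono ?_
  rintro τ m hF ⟨hI, hm⟩
  refine hpost τ m hF hI ?_
  simpa [NExp.cost] using hm

/-- Variant of `Runs.forBelow₂` for loops up to the contents of registers. -/
theorem Runs.forReg₂ {v₁ v₂ w₁ w₂ : Reg} {c : Cmd} {σ : State} {Q : State → ℕ → Prop}
    (n₁ n₂ : ℕ) (I : Set (ℕ × ℕ) → State → Prop) (f : ℕ → ℕ → ℕ)
    (hv₁ : (Cmd.forBelow v₂ (.reg w₂) c).writesReg v₁ = false) (hv₂ : c.writesReg v₂ = false)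
    (hw₁ : (Cmd.forBelow v₁ (.reg w₁) (.forBelow v₂ (.reg w₂) c)).writesReg w₁ = false)
    (hw₂ : (Cmd.forBelow v₁ (.reg w₁) (.forBelow v₂ (.reg w₂) c)).writesReg w₂ = false)
    (hn₁ : σ.reg w₁ = n₁) (hn₂ : σ.reg w₂ = n₂)
    (hset : ∀ D τ k, I D τ → I D (τ.setReg v₁ k) ∧ I D (τ.setReg v₂ k)) (h0 : I ∅ σ)
    (hstep : ∀ a < n₁, ∀ b < n₂, ∀ D τ,
      Frame (.forBelow v₁ (.reg w₁) (.forBelow v₂ (.reg w₂) c)) σ τ →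
      τ.reg v₁ = a → τ.reg v₂ = b → (a, b) ∉ D → (∀ p ∈ D, p.1 < n₁ ∧ p.2 < n₂) → I D τ →
      Runs c τ (fun τ' m => I (insert (a, b) D) τ' ∧ m ≤ f a b))
    (hpost : ∀ τ m, Frame (.forBelow v₁ (.reg w₁) (.forBelow v₂ (.reg w₂) c)) σ τ →
      I {p | p.1 < n₁ ∧ p.2 < n₂} τ →
      m ≤ 5 + ∑ a ∈ Finset.range n₁, (11 + ∑ b ∈ Finset.range n₂, (f a b + 6)) → Q τ m) :
    Runs (.forBelow v₁ (.reg w₁) (.forBelow v₂ (.reg w₂) c)) σ Q := by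
  refine (Runs.forBelow₂ n₁ n₂ I f (fun _ => 0) hv₁ hv₂ (fun τ hF => (hF.reg _ hw₁).trans hn₁)
    (fun τ hF => (hF.reg _ hw₂).trans hn₂) hset h0 hstep).mono ?_
  rintro τ m hF ⟨hI, hm⟩
  refine hpost τ m hF hI ?_
  simp only [NExp.cost, Finset.sum_add_distrib, Finset.sum_const, Finset.card_range,
    smul_eq_mul] at hm ⊢
  linarith

/-- Variant of `Runs.forBelow₃` for loops up to the contents of registers. -/
theorem Runs.forReg₃ {v₁ v₂ v₃ w₁ w₂ w₃ : Reg} {c : Cmd} {σ : State} {Q : State → ℕ → Prop}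
    (n₁ n₂ n₃ : ℕ) (I : Set (ℕ × ℕ × ℕ) → State → Prop) (f : ℕ → ℕ → ℕ → ℕ)
    (Φ : (Arr → List ℕ → ℕ) → ℕ)
    (hv₁ : (Cmd.forBelow v₂ (.reg w₂) (.forBelow v₃ (.reg w₃) c)).writesReg v₁ = false)
    (hv₂ : (Cmd.forBelow v₃ (.reg w₃) c).writesReg v₂ = false) (hv₃ : c.writesReg v₃ = false)
    (hw : ∀ w ∈ [w₁, w₂, w₃], (Cmd.forBelow v₁ (.reg w₁) (.forBelow v₂ (.reg w₂)
      (.forBelow v₃ (.reg w₃) c))).writesReg w = false)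
    (hn₁ : σ.reg w₁ = n₁) (hn₂ : σ.reg w₂ = n₂) (hn₃ : σ.reg w₃ = n₃)
    (hset : ∀ D τ k, I D τ →
      I D (τ.setReg v₁ k) ∧ I D (τ.setReg v₂ k) ∧ I D (τ.setReg v₃ k)) (h0 : I ∅ σ)
    (hstep : ∀ a < n₁, ∀ b < n₂, ∀ d < n₃, ∀ D τ,
      Frame (.forBelow v₁ (.reg w₁) (.forBelow v₂ (.reg w₂) (.forBelow v₃ (.reg w₃) c))) σ τ →
      τ.reg v₁ = a → τ.reg v₂ = b → τ.reg v₃ = d → (a, b, d) ∉ D →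
      (∀ p ∈ D, p.1 < n₁ ∧ p.2.1 < n₂ ∧ p.2.2 < n₃) → I D τ →
      Runs c τ (fun τ' m => I (insert (a, b, d) D) τ' ∧ m + Φ τ'.arr ≤ f a b d + Φ τ.arr))
    (hpost : ∀ τ m,
      Frame (.forBelow v₁ (.reg w₁) (.forBelow v₂ (.reg w₂) (.forBelow v₃ (.reg w₃) c))) σ τ →
      I {p | p.1 < n₁ ∧ p.2.1 < n₂ ∧ p.2.2 < n₃} τ →
      m + Φ τ.arr ≤ (5 + ∑ a ∈ Finset.range n₁, (11 + ∑ b ∈ Finset.range n₂,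
        (11 + ∑ d ∈ Finset.range n₃, (f a b d + 6)))) + Φ σ.arr → Q τ m) :
    Runs (.forBelow v₁ (.reg w₁) (.forBelow v₂ (.reg w₂) (.forBelow v₃ (.reg w₃) c))) σ Q := by
  refine (Runs.forBelow₃ n₁ n₂ n₃ I f Φ hv₁ hv₂ hv₃
    (fun τ hF => (hF.reg _ (hw w₁ (by simp))).trans hn₁)
    (fun τ hF => (hF.reg _ (hw w₂ (by simp))).trans hn₂)
    (fun τ hF => (hF.reg _ (hw w₃ (by simp))).trans hn₃) hset h0 hstep).mono ?_
  rintro τ m hF ⟨hI, hm⟩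
  refine hpost τ m hF hI ?_
  simp only [NExp.cost, Finset.sum_add_distrib, Finset.sum_const, Finset.card_range,
    smul_eq_mul] at hm ⊢
  linarith

/-! ### Construction of the tables -/

/-- A list of all nonzero edges with their degrees, each edge once. -/
structure EdgeList (n : ℕ) (src lbl dst : ℕ → ℕ) (deg : ℕ → ℝ) (E : ℕ → ℕ → ℕ → ℝ) : Prop where
  pos : ∀ i < n, 0 < E (src i) (lbl i) (dst i)
  deg_eq : ∀ i < n, deg i = E (src i) (lbl i) (dst i)
  inj : ∀ i < n, ∀ j < n, src i = src j → lbl i = lbl j → dst i = dst j → i = j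
  surj : ∀ x r y, 0 < E x r y → ∃ i < n, src i = x ∧ lbl i = r ∧ dst i = y

/-- The state holds the pair of graphs as the input of the algorithm. -/
structure Loaded (P : NumberedPair) (nE nEP : ℕ) (σ : State) : Prop where
  numV : σ.reg .numV = P.nV
  numVP : σ.reg .numVP = P.nVP
  numSE : σ.reg .numSE = P.nSE
  numSV : σ.reg .numSV = P.nSV
  numE : σ.reg .numE = nE
  numEP : σ.reg .numEP = nEP
  edges : EdgeList nE (fun i => σ.arr .srcE [i]) (fun i => σ.arr .lblE [i])
    (fun i => σ.arr .dstE [i]) (fun i => σ.rarr .degE [i]) P.E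
  edgesP : EdgeList nEP (fun i => σ.arr .srcEP [i]) (fun i => σ.arr .lblEP [i])
    (fun i => σ.arr .dstEP [i]) (fun i => σ.rarr .degEP [i]) P.EP
  L : ∀ x < P.nV, ∀ s < P.nSV, σ.rarr .L [x, s] = P.L x s
  LP : ∀ x < P.nVP, ∀ s < P.nSV, σ.rarr .LP [x, s] = P.LP x s

/-- The index pairs `[p, q]` with `p < S` and `q < N`. -/
def pairs (S N : ℕ) : Finset (List ℕ) :=
  (Finset.range S ×ˢ Finset.range N).image fun p => [p.1, p.2]

theorem mem_pairs {S N p q : ℕ} : [p, q] ∈ pairs S N ↔ p < S ∧ q < N := by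
  simp [pairs]

theorem sum_pairs (S N : ℕ) (f : List ℕ → ℕ) :
    ∑ ix ∈ pairs S N, f ix = ∑ p ∈ Finset.range S, ∑ q ∈ Finset.range N, f [p, q] := by
  rw [pairs, Finset.sum_image (by intro a _ b _ h; simpa [Prod.ext_iff] using h),
    Finset.sum_product]

/-- A family of vectors indexed by pairs, with elements described by `Q` and total length `t`. -/
structure VecFamily (vec len : List ℕ → ℕ) (S N : ℕ) (Q : ℕ → ℕ → ℕ → Prop) (t : ℕ) : Prop where
  enum : ∀ p < S, ∀ q < N, Enumerates (fun k => vec [p, q, k]) (len [p, q]) (Q p q)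
  sum : ∑ ix ∈ pairs S N, len ix = t

theorem VecFamily.empty {vec len : List ℕ → ℕ} {S N : ℕ} {Q : ℕ → ℕ → ℕ → Prop}
    (h : ∀ p < S, ∀ q < N, len [p, q] = 0) (hQ : ∀ p q x, ¬ Q p q x) :
    VecFamily vec len S N Q 0 where
  enum p hp q hq := by
    rw [h p hp q hq]
    exact ⟨by simp, by simp, fun x hx => absurd hx (hQ _ _ _)⟩
  sum := by
    refine Finset.sum_eq_zero fun ix hix => ?_
    simp only [pairs, Finset.mem_image, Finset.mem_product, Finset.mem_range, Prod.exists] at hix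
    obtain ⟨p, q, h', rfl⟩ := hix
    exact h p h'.1 q h'.2

/-- Appending `x` to the vector with index `[p, q]`. -/
theorem VecFamily.push {vec len : List ℕ → ℕ} {S N p q x n t : ℕ} {Q Q' : ℕ → ℕ → ℕ → Prop}
    (h : VecFamily vec len S N Q t) (hp : p < S) (hq : q < N) (hn : len [p, q] = n)
    (hx : ¬ Q p q x) (hQ : ∀ a b c, Q' a b c ↔ Q a b c ∨ a = p ∧ b = q ∧ c = x) :
    VecFamily (Function.update vec [p, q, n] x) (Function.update len [p, q] (n + 1)) S N Q'
      (t + 1) where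
  enum a ha b hb := by
    by_cases e : a = p ∧ b = q
    · obtain ⟨rfl, rfl⟩ := e
      rw [Function.update_self, ← hn]
      refine (h.enum a ha b hb).push hx (fun k hk => ?_) (by simp) (fun c => by simp [hQ])
      rw [Function.update_of_ne (by simp; omega)]
    · rw [Function.update_of_ne (by simpa using e)]
      refine (h.enum a ha b hb).congr (fun k hk => ?_) fun c => ?_
      · have : [a, b, k] ≠ [p, q, n] := fun h => e (by simp_all)
        rw [Function.update_of_ne this]
      · rw [hQ]
        tauto
  sum := by
    have := sum_update_add (mem_pairs.2 ⟨hp, hq⟩) len (n + 1)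
    rw [hn, h.sum] at this
    omega

theorem VecFamily.congr {vec len : List ℕ → ℕ} {S N t : ℕ} {Q Q' : ℕ → ℕ → ℕ → Prop}
    (h : VecFamily vec len S N Q t) (hQ : ∀ a b c, Q' a b c ↔ Q a b c) :
    VecFamily vec len S N Q' t :=
  ⟨fun p hp q hq => (h.enum p hp q hq).congr (fun _ _ => rfl) fun _ => (hQ _ _ _).symm, h.sum⟩

/-- The first part of `constructArrays`: all vectors become empty. The zeros that are written to the
matrices of degrees need no specification, as only degrees of nonzero edges are ever read. -/
theorem runs_clear {P : NumberedPair} {σ : State} {nE nEP : ℕ} (h : Loaded P nE nEP σ) :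
    Runs (.forBelow .r (.reg .numSE) (.block [
      .forBelow .y (.reg .numV) (.block [
        .put .prevLen [.r, .y] (.lit 0),
        .forBelow .x (.reg .numV) (.rput .E [.x, .r, .y] .zero)]),
      .forBelow .yP (.reg .numVP) (.block [
        .put .nextPLen [.r, .yP] (.lit 0),
        .put .prevPLen [.r, .yP] (.lit 0),
        .forBelow .xP (.reg .numVP) (.rput .EP [.xP, .r, .yP] .zero)])])) σ (fun τ m =>
      (∀ r < P.nSE, (∀ y < P.nV, τ.arr .prevLen [r, y] = 0) ∧
        ∀ y < P.nVP, τ.arr .nextPLen [r, y] = 0 ∧ τ.arr .prevPLen [r, y] = 0) ∧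
      m ≤ 5 + P.nSE * ((5 + P.nV * (9 + (5 + P.nV * (5 + 6)) + 6)) +
        (5 + P.nVP * (13 + (5 + P.nVP * (5 + 6)) + 6)) + 6)) := by
  refine Runs.forReg P.nSE _ (fun k τ =>
    ∀ r < k, (∀ y < P.nV, τ.arr .prevLen [r, y] = 0) ∧
        ∀ y < P.nVP, τ.arr .nextPLen [r, y] = 0 ∧ τ.arr .prevPLen [r, y] = 0)
    rfl rfl h.numSE (by simp) ?_ fun τ m _ hI hm => ⟨hI, hm⟩
  intro k hk τ hF hr hI
  have enV : τ.reg .numV = P.nV := (hF.reg .numV rfl).trans h.numV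
  have enVP : τ.reg .numVP = P.nVP := (hF.reg .numVP rfl).trans h.numVP
  rw [runs_block_cons, runs_seq]
  refine Runs.forReg P.nV (9 + (5 + P.nV * (5 + 6))) (fun j ρ =>
    (∀ y < j, ρ.arr .prevLen [k, y] = 0) ∧
    ∀ p q, p ≠ k → ρ.arr .prevLen [p, q] = τ.arr .prevLen [p, q])
    rfl rfl enV (by simp) ?_ ?_
  · rintro j hj ρ hF' hy ⟨g1, g2⟩
    have er : ρ.reg .r = k := (hF'.reg .r rfl).trans hr
    rw [runs_block_cons, runs_seq, runs_put, runs_block_singleton]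
    refine Runs.forReg P.nV 5 (fun _ _ => True) rfl rfl ((hF'.reg .numV rfl).trans enV) trivial
      (fun _ _ _ _ _ _ => ?_) fun ρ' m hF'' _ hm => ?_
    · rw [runs_rput]
      simp [RExp.cost]
    have e : ρ'.arr .prevLen = Function.update (ρ.arr .prevLen) [k, j] 0 := by
      rw [hF''.arr .prevLen rfl]
      simp [er, hy, NExp.eval]
    refine ⟨⟨fun y hyj => ?_, fun p q hp => ?_⟩, ?_⟩
    · simp only [setReg_arr, e, Function.update_apply]
      split_ifs with e'
      · rfl
      · refine g1 y ?_
        simp only [List.cons.injEq, true_and, and_true] at e'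
        omega
    · simp [e, hp, g2 p q hp]
    · simp only [NExp.cost, List.length_cons, List.length_nil]
      omega
  · rintro ρ m hF₁ ⟨g1, g2⟩ hm
    rw [runs_block_singleton]
    refine Runs.forReg P.nVP (13 + (5 + P.nVP * (5 + 6))) (fun j ρ' =>
      (∀ y < j, ρ'.arr .nextPLen [k, y] = 0 ∧ ρ'.arr .prevPLen [k, y] = 0) ∧
      ∀ p q, p ≠ k → ρ'.arr .nextPLen [p, q] = τ.arr .nextPLen [p, q] ∧
        ρ'.arr .prevPLen [p, q] = τ.arr .prevPLen [p, q])
      rfl rfl ((hF₁.reg .numVP rfl).trans enVP)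
      ⟨by simp, by simp [hF₁.arr .nextPLen rfl, hF₁.arr .prevPLen rfl]⟩ ?_ ?_
    · rintro j hj ρ₁ hF' hy ⟨k1, k2⟩
      have er : ρ₁.reg .r = k := (hF'.reg .r rfl).trans ((hF₁.reg .r rfl).trans hr)
      rw [runs_block_cons, runs_seq, runs_put, runs_block_cons, runs_seq, runs_put,
        runs_block_singleton]
      refine Runs.forReg P.nVP 5 (fun _ _ => True) rfl rfl
        ((hF'.reg .numVP rfl).trans ((hF₁.reg .numVP rfl).trans enVP)) trivial
        (fun _ _ _ _ _ _ => ?_) fun ρ' m hF'' _ hm => ?_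
      · rw [runs_rput]
        simp [RExp.cost]
      have e : ρ'.arr .nextPLen = Function.update (ρ₁.arr .nextPLen) [k, j] 0 := by
        rw [hF''.arr .nextPLen rfl]
        simp [er, hy, NExp.eval]
      have e2 : ρ'.arr .prevPLen = Function.update (ρ₁.arr .prevPLen) [k, j] 0 := by
        rw [hF''.arr .prevPLen rfl]
        simp [er, hy, NExp.eval]
      refine ⟨⟨fun y hyj => ?_, fun p q hp => ?_⟩, ?_⟩
      · simp only [setReg_arr, e, e2, Function.update_apply]
        split_ifs with e'
        · exact ⟨rfl, rfl⟩
        · refine k1 y ?_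
          simp only [List.cons.injEq, true_and, and_true] at e'
          omega
      · simp [e, e2, hp, k2 p q hp]
      · simp only [NExp.cost, List.length_cons, List.length_nil]
        omega
    · rintro ρ' m' hF₂ ⟨k1, k2⟩ hm'
      refine ⟨fun r hr' => ?_, by omega⟩
      simp only [setReg_arr, hF₂.arr .prevLen rfl]
      by_cases e : r = k
      · rw [e]
        exact ⟨g1, k1⟩
      · refine ⟨fun y hy => ?_, fun y hy => ?_⟩
        · rw [g2 r y e]
          exact (hI r (by omega)).1 y hy
        · rw [(k2 r y e).1, (k2 r y e).2]
          exact (hI r (by omega)).2 y hy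

theorem Loaded.of_frame {P : NumberedPair} {nE nEP : ℕ} {c : Cmd} {σ τ : State}
    (h : Loaded P nE nEP σ) (hF : Frame c σ τ)
    (h₁ : ∀ v ∈ [Reg.numV, .numVP, .numSE, .numSV, .numE, .numEP], c.writesReg v = false)
    (h₂ : ∀ a ∈ [Arr.srcE, .lblE, .dstE, .srcEP, .lblEP, .dstEP], c.writesArr a = false)
    (h₃ : ∀ a ∈ [RArr.degE, .degEP, .L, .LP], c.writesRArr a = false) :
    Loaded P nE nEP τ := by
  simp only [List.mem_cons, List.not_mem_nil, or_false, forall_eq_or_imp, forall_eq] at h₁ h₂ h₃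
  obtain ⟨a1, a2, a3, a4, a5, a6, a7, a8, a9, a10⟩ := h
  rw [← hF.reg _ h₁.1] at a1
  rw [← hF.reg _ h₁.2.1] at a2
  rw [← hF.reg _ h₁.2.2.1] at a3
  rw [← hF.reg _ h₁.2.2.2.1] at a4
  rw [← hF.reg _ h₁.2.2.2.2.1] at a5
  rw [← hF.reg _ h₁.2.2.2.2.2] at a6
  rw [← hF.arr _ h₂.1, ← hF.arr _ h₂.2.1, ← hF.arr _ h₂.2.2.1, ← hF.rarr _ h₃.1] at a7
  rw [← hF.arr _ h₂.2.2.2.1, ← hF.arr _ h₂.2.2.2.2.1, ← hF.arr _ h₂.2.2.2.2.2,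
    ← hF.rarr _ h₃.2.1] at a8
  rw [← hF.rarr _ h₃.2.2.1] at a9
  rw [← hF.rarr _ h₃.2.2.2] at a10
  exact ⟨a1, a2, a3, a4, a5, a6, a7, a8, a9, a10⟩

theorem EdgeList.iff_exists {n : ℕ} {src lbl dst : ℕ → ℕ} {deg : ℕ → ℝ} {E : ℕ → ℕ → ℕ → ℝ}
    (h : EdgeList n src lbl dst deg E) (x r y : ℕ) :
    0 < E x r y ↔ ∃ i < n, src i = x ∧ lbl i = r ∧ dst i = y := by
  refine ⟨h.surj x r y, ?_⟩
  rintro ⟨i, hi, rfl, rfl, rfl⟩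
  exact h.pos i hi

/-- The second part of `constructArrays`: the edges of the first graph are entered. -/
theorem runs_enterEdges {P : NumberedPair} {σ : State} {nE nEP : ℕ} (h : Loaded P nE nEP σ)
    (h0 : ∀ r < P.nSE, ∀ y < P.nV, σ.arr .prevLen [r, y] = 0) :
    Runs (.forBelow .e (.reg .numE) (.block [
      .set .x (.get .srcE [.e]),
      .set .r (.get .lblE [.e]),
      .set .y (.get .dstE [.e]),
      .rput .E [.x, .r, .y] (.get .degE [.e]),
      .push .prev .prevLen [.r, .y] .x])) σ (fun τ m =>
      (∀ x r y, 0 < P.E x r y → τ.rarr .E [x, r, y] = P.E x r y) ∧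
      VecFamily (τ.arr .prev) (τ.arr .prevLen) P.nSE P.nV (fun r y x => 0 < P.E x r y) nE ∧
      m ≤ 5 + nE * (40 + 6)) := by
  have hE := h.edges
  obtain ⟨src, hsrc⟩ : ∃ f : ℕ → ℕ, (fun i => σ.arr .srcE [i]) = f := ⟨_, rfl⟩
  obtain ⟨lbl, hlbl⟩ : ∃ f : ℕ → ℕ, (fun i => σ.arr .lblE [i]) = f := ⟨_, rfl⟩
  obtain ⟨dst, hdst⟩ : ∃ f : ℕ → ℕ, (fun i => σ.arr .dstE [i]) = f := ⟨_, rfl⟩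
  obtain ⟨deg, hdeg⟩ : ∃ f : ℕ → ℝ, (fun i => σ.rarr .degE [i]) = f := ⟨_, rfl⟩
  rw [hsrc, hlbl, hdst, hdeg] at hE
  refine Runs.forReg nE 40 (fun i τ =>
    (∀ k < i, τ.rarr .E [src k, lbl k, dst k] = deg k) ∧
    VecFamily (τ.arr .prev) (τ.arr .prevLen) P.nSE P.nV
      (fun r y x => ∃ k < i, src k = x ∧ lbl k = r ∧ dst k = y) i) rfl rfl h.numE
    ⟨by simp, .empty h0 (by simp)⟩ ?_ ?_
  · rintro k hk τ hF he ⟨g1, g2⟩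
    have s1 : τ.arr .srcE [k] = src k := by rw [hF.arr .srcE rfl, ← hsrc]
    have s2 : τ.arr .lblE [k] = lbl k := by rw [hF.arr .lblE rfl, ← hlbl]
    have s3 : τ.arr .dstE [k] = dst k := by rw [hF.arr .dstE rfl, ← hdst]
    have s4 : τ.rarr .degE [k] = deg k := by rw [hF.rarr .degE rfl, ← hdeg]
    obtain ⟨hx, hr, hy⟩ := P.E_range _ _ _ (hE.pos k hk)
    simp only [Cmd.push, Cmd.block, runs_seq, runs_set, runs_put, runs_rput]
    simp [he, s1, s2, s3, s4]
    refine ⟨fun j hj => ?_, ?_⟩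
    · rw [Function.update_apply]
      split_ifs with e
      · simp only [List.cons.injEq, and_true] at e
        rw [hE.inj j (by omega) k hk e.1 e.2.1 e.2.2]
      · refine g1 j ?_
        have : j ≠ k := by rintro rfl; exact e rfl
        omega
    · refine g2.push hr hy rfl ?_ fun a b c => ?_
      · rintro ⟨j, hj, e1, e2, e3⟩
        have := hE.inj j (by omega) k hk e1 e2 e3
        omega
      · constructor
        · rintro ⟨j, hj, rfl, rfl, rfl⟩
          rcases Nat.lt_or_eq_of_le hj with hj | rfl
          · exact .inl ⟨j, hj, rfl, rfl, rfl⟩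
          · exact .inr ⟨rfl, rfl, rfl⟩
        · rintro (⟨j, hj, h⟩ | ⟨rfl, rfl, rfl⟩)
          · exact ⟨j, by omega, h⟩
          · exact ⟨k, by omega, rfl, rfl, rfl⟩
  · rintro τ m hF ⟨g1, g2⟩ hm
    refine ⟨fun x r y hpos => ?_, g2.congr fun r y x => hE.iff_exists x r y, hm⟩
    obtain ⟨i, hi, rfl, rfl, rfl⟩ := hE.surj x r y hpos
    rw [g1 i hi, hE.deg_eq i hi]

/-- The third part of `constructArrays`: the edges of the second graph are entered. -/
theorem runs_enterEdgesP {P : NumberedPair} {σ : State} {nE nEP : ℕ} (h : Loaded P nE nEP σ)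
    (h0 : ∀ r < P.nSE, ∀ y < P.nVP, σ.arr .nextPLen [r, y] = 0 ∧ σ.arr .prevPLen [r, y] = 0) :
    Runs (.forBelow .e (.reg .numEP) (.block [
      .set .xP (.get .srcEP [.e]),
      .set .r (.get .lblEP [.e]),
      .set .yP (.get .dstEP [.e]),
      .rput .EP [.xP, .r, .yP] (.get .degEP [.e]),
      .put .edgeIdP [.xP, .r, .yP] (.reg .e),
      .push .nextP .nextPLen [.r, .xP] .yP,
      .push .prevP .prevPLen [.r, .yP] .xP])) σ (fun τ m =>
      (∀ x r y, 0 < P.EP x r y → τ.rarr .EP [x, r, y] = P.EP x r y) ∧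
      (∀ x r y x₂ r₂ y₂, 0 < P.EP x r y → 0 < P.EP x₂ r₂ y₂ →
        τ.arr .edgeIdP [x, r, y] = τ.arr .edgeIdP [x₂, r₂, y₂] → x = x₂ ∧ r = r₂ ∧ y = y₂) ∧
      VecFamily (τ.arr .nextP) (τ.arr .nextPLen) P.nSE P.nVP (fun r x y => 0 < P.EP x r y) nEP ∧
      VecFamily (τ.arr .prevP) (τ.arr .prevPLen) P.nSE P.nVP (fun r y x => 0 < P.EP x r y) nEP ∧
      m ≤ 5 + nEP * (60 + 6)) := by
  have hE := h.edgesP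
  obtain ⟨src, hsrc⟩ : ∃ f : ℕ → ℕ, (fun i => σ.arr .srcEP [i]) = f := ⟨_, rfl⟩
  obtain ⟨lbl, hlbl⟩ : ∃ f : ℕ → ℕ, (fun i => σ.arr .lblEP [i]) = f := ⟨_, rfl⟩
  obtain ⟨dst, hdst⟩ : ∃ f : ℕ → ℕ, (fun i => σ.arr .dstEP [i]) = f := ⟨_, rfl⟩
  obtain ⟨deg, hdeg⟩ : ∃ f : ℕ → ℝ, (fun i => σ.rarr .degEP [i]) = f := ⟨_, rfl⟩
  rw [hsrc, hlbl, hdst, hdeg] at hE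
  refine Runs.forReg nEP 60 (fun i τ =>
    (∀ k < i, τ.rarr .EP [src k, lbl k, dst k] = deg k ∧
      τ.arr .edgeIdP [src k, lbl k, dst k] = k) ∧
    VecFamily (τ.arr .nextP) (τ.arr .nextPLen) P.nSE P.nVP
      (fun r x y => ∃ k < i, src k = x ∧ lbl k = r ∧ dst k = y) i ∧
    VecFamily (τ.arr .prevP) (τ.arr .prevPLen) P.nSE P.nVP
      (fun r y x => ∃ k < i, src k = x ∧ lbl k = r ∧ dst k = y) i) rfl rfl h.numEP
    ⟨by simp, .empty (fun r hr y hy => (h0 r hr y hy).1) (by simp),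
      .empty (fun r hr y hy => (h0 r hr y hy).2) (by simp)⟩ ?_ ?_
  · rintro k hk τ hF he ⟨g1, g2, g3⟩
    have s1 : τ.arr .srcEP [k] = src k := by rw [hF.arr .srcEP rfl, ← hsrc]
    have s2 : τ.arr .lblEP [k] = lbl k := by rw [hF.arr .lblEP rfl, ← hlbl]
    have s3 : τ.arr .dstEP [k] = dst k := by rw [hF.arr .dstEP rfl, ← hdst]
    have s4 : τ.rarr .degEP [k] = deg k := by rw [hF.rarr .degEP rfl, ← hdeg]
    obtain ⟨hx, hr, hy⟩ := P.EP_range _ _ _ (hE.pos k hk)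
    have hnew : ¬ ∃ j < k, src j = src k ∧ lbl j = lbl k ∧ dst j = dst k := by
      rintro ⟨j, hj, e1, e2, e3⟩
      have := hE.inj j (by omega) k hk e1 e2 e3
      omega
    have hQ : ∀ a b c, (∃ j ≤ k, src j = a ∧ lbl j = b ∧ dst j = c) ↔
        (∃ j < k, src j = a ∧ lbl j = b ∧ dst j = c) ∨ a = src k ∧ b = lbl k ∧ c = dst k := by
      intro a b c
      constructor
      · rintro ⟨j, hj, rfl, rfl, rfl⟩
        rcases Nat.lt_or_eq_of_le hj with hj | rfl
        · exact .inl ⟨j, hj, rfl, rfl, rfl⟩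
        · exact .inr ⟨rfl, rfl, rfl⟩
      · rintro (⟨j, hj, h⟩ | ⟨rfl, rfl, rfl⟩)
        · exact ⟨j, by omega, h⟩
        · exact ⟨k, by omega, rfl, rfl, rfl⟩
    simp only [Cmd.push, Cmd.block, runs_seq, runs_set, runs_put, runs_rput]
    simp [he, s1, s2, s3, s4]
    refine ⟨fun j hj => ?_, ?_, ?_⟩
    · rw [Function.update_apply, Function.update_apply]
      split_ifs with e
      · simp only [List.cons.injEq, and_true] at e
        rw [hE.inj j (by omega) k hk e.1 e.2.1 e.2.2]
        exact ⟨rfl, rfl⟩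
      · refine g1 j ?_
        have : j ≠ k := by rintro rfl; exact e rfl
        omega
    · refine g2.push hr hx rfl hnew fun a b c => ?_
      rw [hQ]
      exact or_congr_right (by omega)
    · refine g3.push hr hy rfl hnew fun a b c => ?_
      rw [hQ]
      exact or_congr_right (by omega)
  · rintro τ m hF ⟨g1, g2, g3⟩ hm
    refine ⟨fun x r y hpos => ?_, fun x r y x₂ r₂ y₂ hpos hpos₂ => ?_,
      g2.congr fun r x y => hE.iff_exists x r y, g3.congr fun r y x => hE.iff_exists x r y, hm⟩
    · obtain ⟨i, hi, rfl, rfl, rfl⟩ := hE.surj x r y hpos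
      rw [(g1 i hi).1, hE.deg_eq i hi]
    · obtain ⟨i, hi, rfl, rfl, rfl⟩ := hE.surj x r y hpos
      obtain ⟨j, hj, rfl, rfl, rfl⟩ := hE.surj _ _ _ hpos₂
      rw [(g1 i hi).2, (g1 j hj).2]
      rintro rfl
      exact ⟨rfl, rfl, rfl⟩

/-- The tables are in place, and the vectors `Prev[r,y]` and `Next'[r,x']` are constructed. -/
structure Constructed (P : NumberedPair) (nE nEP : ℕ) (σ : State) : Prop where
  loaded : Loaded P nE nEP σ
  tables : Tables P σ
  prev : VecFamily (σ.arr .prev) (σ.arr .prevLen) P.nSE P.nV (fun r y x => 0 < P.E x r y) nE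
  nextP : VecFamily (σ.arr .nextP) (σ.arr .nextPLen) P.nSE P.nVP (fun r x y => 0 < P.EP x r y) nEP
  prevP_sum : ∑ ix ∈ pairs P.nSE P.nVP, σ.arr .prevPLen ix = nEP

theorem runs_constructArrays {P : NumberedPair} {σ : State} {nE nEP : ℕ}
    (h : Loaded P nE nEP σ) :
    Runs .constructArrays σ (fun τ m => Constructed P nE nEP τ ∧
      m ≤ 15 + P.nSE * ((5 + P.nV * (9 + (5 + P.nV * (5 + 6)) + 6)) +
        (5 + P.nVP * (13 + (5 + P.nVP * (5 + 6)) + 6)) + 6) + nE * 46 + nEP * 66) := by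
  rw [Cmd.constructArrays, runs_block_cons]
  refine Runs.seq (runs_clear h) ?_
  rintro τ₁ m₁ hF₁ ⟨hc, hm₁⟩
  have h₁ := h.of_frame hF₁ (by decide) (by decide) (by decide)
  rw [runs_block_cons]
  refine Runs.seq (runs_enterEdges h₁ fun r hr => (hc r hr).1) ?_
  rintro τ₂ m₂ hF₂ ⟨e1, e2, hm₂⟩
  have h₂ := h₁.of_frame hF₂ (by decide) (by decide) (by decide)
  rw [runs_block_singleton]
  refine (runs_enterEdgesP h₂ fun r hr y hy => ?_).mono ?_
  · rw [hF₂.arr .nextPLen rfl, hF₂.arr .prevPLen rfl]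
    exact (hc r hr).2 y hy
  rintro τ₃ m₃ hF₃ ⟨k1, k2, k3, k4, hm₃⟩
  have h₃ := h₂.of_frame hF₃ (by decide) (by decide) (by decide)
  refine ⟨⟨h₃, ⟨h₃.numV, h₃.numVP, h₃.numSE, ?_, k1, k2, k4.enum⟩, ?_, k3, k4.sum⟩, by omega⟩
  · rw [hF₃.rarr .E rfl]
    exact e1
  · rw [hF₃.arr .prev rfl, hF₃.arr .prevLen rfl]
    exact e2

theorem runs_initZ {P : NumberedPair} {σ : State} {nE nEP : ℕ} (h : Loaded P nE nEP σ) :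
    Runs .initZ σ (fun τ m =>
      (∀ x < P.nV, ∀ x' < P.nVP,
        τ.arr .Z [x, x'] = 1 ↔ ∀ s < P.nSV, P.L x s ≤ P.LP x' s) ∧
      m ≤ 5 + P.nV * (11 + P.nVP * (4 + (5 + P.nSV * (11 + 6)) + 6))) := by
  refine Runs.forReg₂ P.nV P.nVP (fun D τ => ∀ x x', (x, x') ∈ D →
      (τ.arr .Z [x, x'] = 1 ↔ ∀ s < P.nSV, P.L x s ≤ P.LP x' s))
    (fun _ _ => 4 + (5 + P.nSV * (11 + 6))) rfl rfl rfl rfl h.numV h.numVP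
    (fun D τ k hI => ⟨hI, hI⟩) (by simp) ?_ ?_
  · rintro a ha b hb D τ hF hx hxP hD - hI
    rw [runs_block_cons, runs_seq, runs_put, runs_block_singleton]
    have hL : ∀ s < P.nSV, τ.rarr .L [a, s] = P.L a s := by
      rw [hF.rarr .L rfl]
      exact h.L a ha
    have hLP : ∀ s < P.nSV, τ.rarr .LP [b, s] = P.LP b s := by
      rw [hF.rarr .LP rfl]
      exact h.LP b hb
    refine Runs.forReg P.nSV 11 (fun k ρ =>
      (ρ.arr .Z [a, b] = 1 ↔ ∀ s < k, P.L a s ≤ P.LP b s) ∧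
      ∀ p q, [p, q] ≠ [a, b] → ρ.arr .Z [p, q] = τ.arr .Z [p, q]) rfl rfl
      ((hF.reg .numSV rfl).trans h.numSV) ?_ ?_ ?_
    · refine ⟨by simp [hx, hxP], fun p q hpq => ?_⟩
      simp only [setReg_arr, setArr_arr, if_true]
      rw [Function.update_of_ne (by simpa [hx, hxP] using hpq)]
    · rintro k hk ρ hF' hs ⟨k1, k2⟩
      have ex : ρ.reg .x = a := (hF'.reg .x rfl).trans hx
      have exP : ρ.reg .xP = b := (hF'.reg .xP rfl).trans hxP
      have eL : ρ.rarr .L [a, k] = P.L a k := by rw [hF'.rarr .L rfl]; exact hL k hk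
      have eLP : ρ.rarr .LP [b, k] = P.LP b k := by rw [hF'.rarr .LP rfl]; exact hLP k hk
      have hsplit : (∀ s < k + 1, P.L a s ≤ P.LP b s) ↔
          (∀ s < k, P.L a s ≤ P.LP b s) ∧ P.L a k ≤ P.LP b k :=
        ⟨fun H => ⟨fun s hs => H s (by omega), H k (by omega)⟩, fun H s hs => by
          rcases Nat.lt_succ_iff_lt_or_eq.1 hs with h' | rfl
          exacts [H.1 s h', H.2]⟩
      rw [runs_ite]
      refine ⟨fun hb => ?_, fun hb => ?_⟩
      · rw [runs_skip]
        have hb' : P.L a k ≤ P.LP b k := by simpa [ex, exP, hs, eL, eLP] using hb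
        refine ⟨⟨?_, k2⟩, by simp⟩
        rw [hsplit, setReg_arr, k1]
        simp [hb']
      · rw [runs_put]
        have hb' : ¬ P.L a k ≤ P.LP b k := by simpa [ex, exP, hs, eL, eLP] using hb
        refine ⟨⟨?_, fun p q hpq => ?_⟩, by simp⟩
        · rw [hsplit]
          simp [ex, exP, hb']
        · simp only [setReg_arr, setArr_arr, if_true]
          rw [Function.update_of_ne (by simpa [ex, exP] using hpq)]
          exact k2 p q hpq
    · rintro ρ m hF' ⟨k1, k2⟩ hm
      refine ⟨fun x x' hxx => ?_, ?_⟩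
      · rcases Set.mem_insert_iff.1 hxx with e | hxx
        · simp only [Prod.mk.injEq] at e
          rw [e.1, e.2]
          exact k1
        · have hne : [x, x'] ≠ [a, b] := by
            rintro e
            simp only [List.cons.injEq, and_true] at e
            rw [e.1, e.2] at hxx
            exact hD hxx
          rw [k2 x x' hne]
          exact hI x x' hxx
      · simp only [NExp.cost, List.length_cons, List.length_nil]
        omega
  · rintro τ m hF hI hm
    refine ⟨fun x hx x' hx' => hI x x' ⟨hx, hx'⟩, ?_⟩
    simpa using hm

/-! ### Initialization -/

/-- Sorting all vectors `a[p,q]` of a family. -/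
theorem runs_sortVecs {a aLen : Arr} {r₁ r₂ w₁ w₂ : Reg} {deg : Reg → RExp} {σ : State}
    {S N B t : ℕ} {w : ℕ → ℕ → ℕ → ℝ} {R : ℕ → ℕ → ℕ → Prop} {Q : State → ℕ → Prop}
    (h₁ : r₁ ∉ [Reg.i, .cur, .j, .go, .jPred, .other])
    (h₂ : r₂ ∉ [Reg.i, .cur, .j, .go, .jPred, .other]) (ha : aLen ≠ a)
    (hv₁ : (Cmd.forBelow r₂ (.reg w₂) (.sortVec a aLen [r₁, r₂] deg)).writesReg r₁ = false)
    (hv₂ : (Cmd.sortVec a aLen [r₁, r₂] deg).writesReg r₂ = false)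
    (hw : ∀ w ∈ [w₁, w₂], (Cmd.forBelow r₁ (.reg w₁) (.forBelow r₂ (.reg w₂)
      (.sortVec a aLen [r₁, r₂] deg))).writesReg w = false)
    (hn₁ : σ.reg w₁ = S) (hn₂ : σ.reg w₂ = N) (hcost : ∀ v, (deg v).cost = 4)
    (hdeg : ∀ p q τ v, τ.reg r₁ = p → τ.reg r₂ = q → τ.rarr = σ.rarr → R p q (τ.reg v) →
      (deg v).eval τ = w p q (τ.reg v))
    (hvec : VecFamily (σ.arr a) (σ.arr aLen) S N R t) (hB : ∀ p q x, R p q x → x < B)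
    (hpost : ∀ τ m, Frame (.forBelow r₁ (.reg w₁) (.forBelow r₂ (.reg w₂)
        (.sortVec a aLen [r₁, r₂] deg))) σ τ →
      (∀ p < S, ∀ q < N, SortedVec (fun k => τ.arr a [p, q, k]) (σ.arr aLen [p, q]) (R p q)
        (w p q)) →
      m ≤ 5 + S * (11 + 26 * N) + (80 + 40 * B) * t → Q τ m) :
    Runs (.forBelow r₁ (.reg w₁) (.forBelow r₂ (.reg w₂) (.sortVec a aLen [r₁, r₂] deg))) σ Q := by
  refine Runs.forReg₂ S N (fun D τ =>
      (∀ p q, (p, q) ∈ D → SortedVec (fun k => τ.arr a [p, q, k]) (σ.arr aLen [p, q]) (R p q)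
        (w p q)) ∧
      ∀ p q k, (p, q) ∉ D → τ.arr a [p, q, k] = σ.arr a [p, q, k])
    (fun p q => 20 + 80 * σ.arr aLen [p, q] + 40 * (σ.arr aLen [p, q] * σ.arr aLen [p, q]))
    hv₁ hv₂ (hw _ (by simp)) (hw _ (by simp)) hn₁ hn₂ (fun D τ k hI => ⟨hI, hI⟩) (by simp) ?_ ?_
  · rintro p hp q hq D τ hF hrp hrq hD - ⟨g1, g2⟩
    have eL : τ.arr aLen = σ.arr aLen := hF.arr _ (by
      simp [Cmd.sortVec, Cmd.forBelow, Cmd.block, Cmd.writesArr, ha])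
    have eR : τ.rarr = σ.rarr := funext fun b => hF.rarr _ (by
      simp [Cmd.sortVec, Cmd.forBelow, Cmd.block, Cmd.writesRArr])
    refine (runs_sortVec (σ := τ) (w := w p q) (Q := R p q) h₁ h₂ ha hrp hrq hcost
      (fun ρ v e1 e2 e3 => hdeg p q ρ v e1 e2 (e3.trans eR)) ?_).mono ?_
    · rw [eL]
      exact (hvec.enum p hp q hq).congr (fun k _ => (g2 p q k hD).symm) fun _ => Iff.rfl
    · rw [eL]
      rintro ρ m hF' ⟨k1, k2, k3⟩
      refine ⟨⟨fun p' q' hD' => ?_, fun p' q' k hD' => ?_⟩, k3⟩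
      · by_cases e : p' = p ∧ q' = q
        · obtain ⟨rfl, rfl⟩ := e
          exact k1
        · have hD'' : (p', q') ∈ D := by simpa [Set.mem_insert_iff, e] using hD'
          exact (g1 p' q' hD'').congr (fun k _ => (k2 p' q' k (by simpa using e)).symm)
            fun _ => Iff.rfl
      · simp only [Set.mem_insert_iff, Prod.mk.injEq, not_or] at hD'
        rw [k2 p' q' k (by simpa using hD'.1), g2 p' q' k hD'.2]
  · rintro τ m hF ⟨g1, -⟩ hm
    refine hpost τ m hF (fun p hp q hq => g1 p q ⟨hp, hq⟩) (hm.trans ?_)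
    have hle : ∀ p ∈ Finset.range S, ∀ q ∈ Finset.range N,
        20 + 80 * σ.arr aLen [p, q] + 40 * (σ.arr aLen [p, q] * σ.arr aLen [p, q]) + 6 ≤
          26 + (80 + 40 * B) * σ.arr aLen [p, q] := by
      intro p hp q hq
      have := (hvec.enum p (by simpa using hp) q (by simpa using hq)).le_of_lt (hB p q)
      have := Nat.mul_le_mul_right (σ.arr aLen [p, q]) this
      linarith
    have hs := hvec.sum
    rw [sum_pairs] at hs
    calc _ ≤ 5 + ∑ p ∈ Finset.range S, (11 + ∑ q ∈ Finset.range N,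
          (26 + (80 + 40 * B) * σ.arr aLen [p, q])) := by
          exact Nat.add_le_add_left (Finset.sum_le_sum fun p hp => Nat.add_le_add_left
            (Finset.sum_le_sum fun q hq => hle p hp q hq) _) _
      _ = _ := by
          simp only [Finset.sum_add_distrib, Finset.sum_const, Finset.card_range, smul_eq_mul,
            ← Finset.mul_sum, hs]
          ring

theorem RcInv.setReg {P : NumberedPair} {D : Set (ℕ × ℕ × ℕ)} {σ : State} (h : RcInv P D σ)
    (v : Reg) (k : ℕ) (hv : v ≠ .free) : RcInv P D (σ.setReg v k) := by
  obtain ⟨h1, ⟨N, hL, hN⟩, h3, h4⟩ := h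
  have e : (σ.setReg v k).reg .free = σ.reg .free := by simp [hv.symm]
  exact ⟨by rwa [e], ⟨N, hL.of_arr (fun _ _ _ _ => Iff.rfl) fun _ _ => rfl, by rwa [e]⟩, h3, h4⟩

theorem RcInv.empty {P : NumberedPair} {σ : State} (h : 0 < σ.reg .free) : RcInv P ∅ σ where
  free_pos := h
  lists := ⟨fun _ _ _ _ => False, by constructor <;> simp, by simp⟩
  rcPrev := by simp
  rcPrevLen_le := by simp

/-- When `rcPrev` and `rcNext'` are constructed and the queue is empty, the invariant holds. -/
theorem RcInv.workInv {P : NumberedPair} {σ : State} (h : RcInv P P.allTriples σ)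
    (hhead : σ.reg .head = 0) (htail : σ.reg .tail = 0)
    (hZ : ∀ x < P.nV, ∀ x' < P.nVP,
      σ.arr .Z [x, x'] = 1 ↔ ∀ s < P.nSV, P.L x s ≤ P.LP x' s) : WorkInv P σ where
  head_le := by rw [hhead, htail]
  queue i hi := by rw [htail] at hi; omega
  queue_inj i hi := by rw [htail] at hi; omega
  rc_mem r hr y hy x' hx' k hk := ((h.rcPrev r y x' ⟨hr, hy, hx'⟩).enum.mem k hk).1
  rc_sorted r hr y hy x' hx' := (h.rcPrev r y x' ⟨hr, hy, hx'⟩).sorted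
  rc_complete x' hx' x r y hz hE := by
    obtain ⟨-, hr, hy⟩ := P.E_range _ _ _ hE
    exact (h.rcPrev r y x' ⟨hr, hy, hx'⟩).enum.surj x ⟨hE, hz⟩
  label_le x hx x' hx' := (hZ x hx x' hx').1
  maximal R hR x x' hxx := by
    obtain ⟨hx, hx'⟩ := hR.range x x' hxx
    exact (hZ x hx x' hx').2 (hR.label_le x x' hxx)

/-- The first calls of `UpdateRcPrev`, for all triples `(r,y,x')`, establish the invariant of the
main loop. -/
theorem runs_updateAll {P : NumberedPair} {σ : State} (hT : Tables P σ) (hW : WorkInv P σ)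
    (hL : ∃ N, RcLists P (fun r a x b => 0 < P.EP x r b ∧ a < P.nV ∧ Pending σ a b) N
      P.allTriples σ) :
    Runs (.forBelow .r (.reg .numSE) (.forBelow .y (.reg .numV) (.forBelow .xP (.reg .numVP)
      .updateRcPrev))) σ (fun τ m =>
      LoopInv P (fun r a x b => 0 < P.EP x r b ∧ a < P.nV ∧ Pending τ a b) τ ∧
      m + 60 * P.potential τ.arr ≤
        5 + P.nSE * (11 + P.nV * (11 + P.nVP * 106)) + 60 * P.potential σ.arr) := by
  refine Runs.forReg₃ P.nSE P.nV P.nVP (fun D τ =>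
    Tables P τ ∧ WorkInv P τ ∧
    (∃ N, RcLists P (fun r a x b => 0 < P.EP x r b ∧ a < P.nV ∧ Pending τ a b) N
      P.allTriples τ) ∧
    ∀ r y x', (r, y, x') ∈ D → ∀ x, τ.arr .Z [x, x'] = 1 → 0 < P.E x r y →
      ∃ y', (0 < P.EP x' r y' ∧ y < P.nV ∧ Pending τ y y') ∧ P.E x r y ≤ P.EP x' r y')
    (fun _ _ _ => 100) (fun arr => 60 * P.potential arr) rfl rfl rfl (by decide)
    hT.numSE hT.numV hT.numVP ?_ ⟨hT, hW, hL, by simp⟩ ?_ ?_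
  · rintro D τ k ⟨t, w, ⟨N, l⟩, f⟩
    have key : ∀ v ∉ [Reg.head, .tail, .numV, .numVP, .numSE], Tables P (τ.setReg v k) ∧
        WorkInv P (τ.setReg v k) ∧
        (∃ N, RcLists P (fun r a x b => 0 < P.EP x r b ∧ a < P.nV ∧ Pending (τ.setReg v k) a b) N
          P.allTriples (τ.setReg v k)) ∧
        ∀ r y x', (r, y, x') ∈ D → ∀ x, (τ.setReg v k).arr .Z [x, x'] = 1 → 0 < P.E x r y →
          ∃ y', (0 < P.EP x' r y' ∧ y < P.nV ∧ Pending (τ.setReg v k) y y') ∧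
            P.E x r y ≤ P.EP x' r y' := by
      intro v hv
      simp only [List.mem_cons, List.not_mem_nil, or_false, not_or, ← ne_eq] at hv
      obtain ⟨v1, v2, v3, v4, v5⟩ := hv
      obtain ⟨t1, t2, t3, t4, t5, t6, t7⟩ := t
      obtain ⟨w', hP⟩ := w.congr (τ := τ.setReg v k) (by simp [v1.symm, v2.symm]) fun _ _ => rfl
      refine ⟨⟨by simpa [v3.symm] using t1, by simpa [v4.symm] using t2,
        by simpa [v5.symm] using t3, t4, t5, t6, t7⟩, w',
        ⟨N, l.of_arr (fun _ _ _ _ => by rw [hP]) fun _ _ => rfl⟩, ?_⟩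
      simpa only [hP, setReg_arr] using f
    exact ⟨key _ (by decide), key _ (by decide), key _ (by decide)⟩
  · rintro r hr y hy x' hx' D τ hF er ey ex - - ⟨t, w, ⟨N, l⟩, f⟩
    have hD : (r, y, x') ∈ P.allTriples := ⟨hr, hy, hx'⟩
    obtain ⟨hlast0, hlast⟩ := l.last hD
    refine (runs_updateRcPrev t w er ey ex hr hy hx' (fun y' hz hE => ⟨hE, hy, .inl hz⟩)
      (fun y' hB => hB.1) hlast0 hlast).mono ?_
    rintro ρ m hFρ ⟨g1, g2, g3, g4, g5⟩
    refine ⟨⟨t.of_frame hFρ rfl rfl rfl rfl rfl rfl rfl rfl, g1, ⟨N, l.of_arr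
      (fun _ _ _ _ => by rw [g2]) ?_⟩, fun a b c hD' z hz hE => ?_⟩, g5⟩
    · simp only [List.mem_cons, List.not_mem_nil, or_false, forall_eq_or_imp, forall_eq]
      exact ⟨hFρ.arr _ rfl, hFρ.arr _ rfl, hFρ.arr _ rfl, hFρ.arr _ rfl, hFρ.arr _ rfl,
        hFρ.arr _ rfl, hFρ.arr _ rfl⟩
    · simp only [g2]
      rcases Set.mem_insert_iff.1 hD' with e | hD'
      · simp only [Prod.mk.injEq] at e
        obtain ⟨rfl, rfl, rfl⟩ := e
        exact g4 z hz hE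
      · exact f a b c hD' z (g3 _ _ hz) hE
  · rintro τ m hF ⟨t, w, l, f⟩ hm
    refine ⟨⟨t, w, l, fun r x y y' hz hE hy => ⟨hE, hy, .inl hz⟩, fun x r y x' hx' hz hE => ?_⟩,
      ?_⟩
    · obtain ⟨-, hr, hy⟩ := P.E_range _ _ _ hE
      exact f r y x' ⟨hr, hy, hx'⟩ x hz hE
    · simpa using hm

theorem NumberedPair.potential_eq (P : NumberedPair) (arr : Arr → List ℕ → ℕ) :
    P.potential arr = ∑ r ∈ Finset.range P.nSE, ∑ y ∈ Finset.range P.nV,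
      ∑ x' ∈ Finset.range P.nVP, arr .rcPrevLen [r, y, x'] := by
  rw [potential, triples, Finset.sum_image
    (by intro a _ b _ h; simpa [Prod.ext_iff] using h), Finset.sum_product]
  exact Finset.sum_congr rfl fun _ _ => Finset.sum_product _ _ _

/-- The construction of `rcPrev` and `rcNext'` for all triples `(r,y,x')`. -/
theorem runs_constructAllRc {P : NumberedPair} {σ : State} {nE nEP : ℕ} (hT : Tables P σ)
    (hprev : ∀ r < P.nSE, ∀ y < P.nV, SortedVec (fun k => σ.arr .prev [r, y, k])
      (σ.arr .prevLen [r, y]) (fun x => 0 < P.E x r y) (fun x => P.E x r y))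
    (hnext : ∀ r < P.nSE, ∀ x < P.nVP, SortedVec (fun k => σ.arr .nextP [r, x, k])
      (σ.arr .nextPLen [r, x]) (fun z => 0 < P.EP x r z) (fun z => P.EP x r z))
    (hsprev : ∑ ix ∈ pairs P.nSE P.nV, σ.arr .prevLen ix = nE)
    (hsnext : ∑ ix ∈ pairs P.nSE P.nVP, σ.arr .nextPLen ix = nEP)
    (hfree : σ.reg .free = 1) :
    Runs (.forBelow .r (.reg .numSE) (.forBelow .y (.reg .numV) (.forBelow .xP (.reg .numVP)
      .constructRc))) σ (fun τ m => RcInv P P.allTriples τ ∧ P.potential τ.arr ≤ P.nVP * nE ∧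
      m ≤ 5 + P.nSE * (11 + P.nV * (11 + 76 * P.nVP)) + 50 * (P.nVP * nE) +
        120 * (P.nV * nEP)) := by
  rw [sum_pairs] at hsprev hsnext
  refine Runs.forReg₃ P.nSE P.nV P.nVP (fun D τ => RcInv P D τ)
    (fun r y x => 70 + 50 * σ.arr .prevLen [r, y] + 120 * σ.arr .nextPLen [r, x])
    (fun _ => 0) rfl rfl rfl (by decide) hT.numSE hT.numV hT.numVP
    (fun D τ k hI => ⟨hI.setReg _ _ (by decide), hI.setReg _ _ (by decide),
      hI.setReg _ _ (by decide)⟩) (.empty (by omega)) ?_ ?_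
  · rintro r hr y hy x hx D τ hF er ey ex hD - hI
    have e1 : τ.arr .prev = σ.arr .prev := hF.arr _ rfl
    have e2 : τ.arr .prevLen = σ.arr .prevLen := hF.arr _ rfl
    have e3 : τ.arr .nextP = σ.arr .nextP := hF.arr _ rfl
    have e4 : τ.arr .nextPLen = σ.arr .nextPLen := hF.arr _ rfl
    have e5 : τ.arr .edgeIdP = σ.arr .edgeIdP := hF.arr _ rfl
    refine (runs_constructRc hI hD er ey ex (by rw [e5]; exact hT.edgeId_inj)
      (by rw [e1, e2]; exact hprev r hr y hy) (by rw [e3, e4]; exact hnext r hr x hx)).mono ?_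
    rintro ρ m - ⟨h, hm⟩
    rw [e2, e4] at hm
    exact ⟨h, hm⟩
  · rintro τ m hF hI hm
    refine ⟨hI, ?_, ?_⟩
    · rw [NumberedPair.potential_eq, ← hsprev, Finset.mul_sum]
      refine Finset.sum_le_sum fun r hr => ?_
      rw [Finset.mul_sum]
      refine Finset.sum_le_sum fun y hy => ?_
      rw [← hF.arr .prevLen rfl]
      refine (Finset.sum_le_card_nsmul _ _ (τ.arr .prevLen [r, y]) fun x hx => ?_).trans
        (by simp)
      simp only [Finset.mem_range] at hr hy hx
      exact hI.rcPrevLen_le r y x ⟨hr, hy, hx⟩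
    · refine (le_of_eq_of_le (by simp) hm).trans (le_of_eq ?_)
      have e : ∀ r ∈ Finset.range P.nSE, (11 + ∑ y ∈ Finset.range P.nV,
          (11 + ∑ x ∈ Finset.range P.nVP,
            (70 + 50 * σ.arr .prevLen [r, y] + 120 * σ.arr .nextPLen [r, x] + 6))) =
          11 + P.nV * (11 + 76 * P.nVP) +
          50 * P.nVP * (∑ y ∈ Finset.range P.nV, σ.arr .prevLen [r, y]) +
          120 * P.nV * (∑ x ∈ Finset.range P.nVP, σ.arr .nextPLen [r, x]) := by
        intro r _
        simp only [Finset.sum_add_distrib, Finset.sum_const, Finset.card_range, smul_eq_mul,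
          ← Finset.mul_sum]
        ring
      rw [Finset.sum_congr rfl e]
      simp only [Finset.sum_add_distrib, Finset.sum_const, Finset.card_range, smul_eq_mul,
        ← Finset.mul_sum, hsprev, hsnext]
      ring

/-- A bound for the number of steps of `Initialize`, where `S` and `K` are the numbers of edge
labels and of vertex labels, `a` and `b` the numbers of vertices, `e` and `f` the numbers of
edges. -/
def initCost (S K a b e f : ℕ) : ℕ :=
  70 + S * (60 + a * (70 + 11 * a) + b * (70 + 11 * b) + 182 * (a * b)) +
    a * (25 + b * (20 + 17 * K)) + 130 * e + 150 * f + 40 * (b * f) + 40 * (a * e) +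
    130 * (a * f) + 110 * (b * e)

/-- `Initialize` establishes the invariant of the main loop; the potential that is left over counts
towards its cost. -/
theorem runs_initializeAll {P : NumberedPair} {σ : State} {nE nEP : ℕ} (h : Loaded P nE nEP σ) :
    Runs .initializeAll σ (fun τ m =>
      LoopInv P (fun r a x b => 0 < P.EP x r b ∧ a < P.nV ∧ Pending τ a b) τ ∧
      ∑ r ∈ Finset.range P.nSE, ∑ y ∈ Finset.range P.nVP, τ.arr .prevPLen [r, y] = nEP ∧
      m + 60 * P.potential τ.arr ≤ initCost P.nSE P.nSV P.nV P.nVP nE nEP) := by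
  rw [Cmd.initializeAll, runs_block_cons]
  refine Runs.seq (runs_constructArrays h) ?_
  rintro σ₁ m₁ - ⟨⟨hload, hT, hprev, hnext, hsum⟩, hm₁⟩
  rw [runs_block_cons]
  refine Runs.seq (runs_initZ hload) ?_
  rintro σ₂ m₂ hF₂ ⟨hZ, hm₂⟩
  rw [runs_block_cons, runs_seq, runs_set, runs_block_cons, runs_seq, runs_set]
  obtain ⟨σ₃, hσ₃⟩ : ∃ τ, (σ₂.setReg .head (NExp.eval σ₂ (.lit 0))).setReg .tail
    (NExp.eval (σ₂.setReg .head (NExp.eval σ₂ (.lit 0))) (.lit 0)) = τ := ⟨_, rfl⟩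
  have f1 : σ₃.reg .head = 0 := by simp [← hσ₃]
  have f2 : σ₃.reg .tail = 0 := by simp [← hσ₃]
  have f3 : ∀ v, v ≠ .head → v ≠ .tail → σ₃.reg v = σ₂.reg v := by
    intro v h1 h2
    simp [← hσ₃, h1, h2]
  have f4 : σ₃.arr = σ₂.arr := by rw [← hσ₃]; rfl
  have f5 : σ₃.rarr = σ₂.rarr := by rw [← hσ₃]; rfl
  have hT₂ : Tables P σ₂ := hT.of_frame hF₂ rfl rfl rfl rfl rfl rfl rfl rfl
  have hT₃ : Tables P σ₃ := by
    obtain ⟨t1, t2, t3, t4, t5, t6, t7⟩ := hT₂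
    rw [← f3 _ (by decide) (by decide)] at t1 t2 t3
    rw [← f5] at t4 t5
    rw [← f4] at t6 t7
    exact ⟨t1, t2, t3, t4, t5, t6, t7⟩
  have hnumEP : σ₃.reg .numEP = nEP :=
    (f3 _ (by decide) (by decide)).trans ((hF₂.reg _ rfl).trans hload.numEP)
  rw [← f4] at hZ
  rw [← hF₂.arr .prev rfl, ← hF₂.arr .prevLen rfl, ← f4] at hprev
  rw [← hF₂.arr .nextP rfl, ← hF₂.arr .nextPLen rfl, ← f4] at hnext
  rw [← hF₂.arr .prevPLen rfl, ← f4, sum_pairs] at hsum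
  clear hT hT₂ hload
  rw [hσ₃, runs_block_cons, runs_seq]
  refine runs_sortVecs (R := fun r x y => 0 < P.EP x r y) (w := fun r x y => P.EP x r y)
    (B := P.nVP) (by decide) (by decide) (by decide) rfl rfl (by decide) hT₃.numSE hT₃.numVP
    (fun _ => rfl) ?_ hnext (fun r x y hE => (P.EP_range _ _ _ hE).2.2) ?_
  · intro r x τ v e1 e2 e3 hE
    simp only [RExp.eval, List.map_cons, List.map_nil, e1, e2, e3]
    exact hT₃.EP _ _ _ hE
  rintro σ₄ m₄ hF₄ hnext₄ hm₄
  have hT₄ : Tables P σ₄ := hT₃.of_frame hF₄ rfl rfl rfl rfl rfl rfl rfl rfl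
  rw [← hF₄.arr .prev rfl, ← hF₄.arr .prevLen rfl] at hprev
  rw [runs_block_cons, runs_seq]
  refine runs_sortVecs (R := fun r y x => 0 < P.E x r y) (w := fun r y x => P.E x r y)
    (B := P.nV) (by decide) (by decide) (by decide) rfl rfl (by decide) hT₄.numSE hT₄.numV
    (fun _ => rfl) ?_ hprev (fun r y x hE => (P.E_range _ _ _ hE).1) ?_
  · intro r y τ v e1 e2 e3 hE
    simp only [RExp.eval, List.map_cons, List.map_nil, e1, e2, e3]
    exact hT₄.E _ _ _ hE
  rintro σ₅ m₅ hF₅ hprev₅ hm₅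
  have hT₅ : Tables P σ₅ := hT₄.of_frame hF₅ rfl rfl rfl rfl rfl rfl rfl rfl
  rw [runs_block_cons, runs_seq]
  -- only the number of steps of this loop matters: the entries of `rcNextElem'` that are
  -- read have been overwritten by `constructRc`
  refine Runs.forReg₂ P.nV nEP (fun _ _ => True) (fun _ _ => 4) rfl rfl rfl rfl hT₅.numV
    ((hF₅.reg _ rfl).trans ((hF₄.reg _ rfl).trans hnumEP)) (fun _ _ _ _ => ⟨trivial, trivial⟩)
    trivial (fun _ _ _ _ _ _ _ _ _ _ _ _ => by rw [runs_put]; simp) ?_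
  rintro σ₆ m₆ hF₆ - hm₆
  have hT₆ : Tables P σ₆ := hT₅.of_frame hF₆ rfl rfl rfl rfl rfl rfl rfl rfl
  rw [runs_block_cons, runs_seq, runs_set, runs_block_cons]
  have g1 : ∀ r < P.nSE, ∀ y < P.nV, SortedVec (fun k => σ₆.arr .prev [r, y, k])
      (σ₆.arr .prevLen [r, y]) (fun x => 0 < P.E x r y) (fun x => P.E x r y) := by
    rw [hF₆.arr .prev rfl, hF₆.arr .prevLen rfl, hF₅.arr .prevLen rfl]
    exact hprev₅
  have g2 : ∀ r < P.nSE, ∀ x < P.nVP, SortedVec (fun k => σ₆.arr .nextP [r, x, k])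
      (σ₆.arr .nextPLen [r, x]) (fun z => 0 < P.EP x r z) (fun z => P.EP x r z) := by
    rw [hF₆.arr .nextP rfl, hF₆.arr .nextPLen rfl, hF₅.arr .nextP rfl, hF₅.arr .nextPLen rfl,
      hF₄.arr .nextPLen rfl]
    exact hnext₄
  have g3 : ∑ ix ∈ pairs P.nSE P.nV, σ₆.arr .prevLen ix = nE := by
    rw [hF₆.arr .prevLen rfl, hF₅.arr .prevLen rfl]
    exact hprev.sum
  have g4 : ∑ ix ∈ pairs P.nSE P.nVP, σ₆.arr .nextPLen ix = nEP := by
    rw [hF₆.arr .nextPLen rfl, hF₅.arr .nextPLen rfl, hF₄.arr .nextPLen rfl]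
    exact hnext.sum
  refine Runs.seq (runs_constructAllRc (P := P) (nE := nE) (nEP := nEP) ⟨by simpa using hT₆.1,
    by simpa using hT₆.2, by simpa using hT₆.3, hT₆.4, hT₆.5, hT₆.6, hT₆.7⟩ g1 g2 g3 g4
    (by simp)) ?_
  rintro σ₇ m₇ hF₇ ⟨hrc, hpot, hm₇⟩
  have hhead : σ₇.reg .head = 0 := by
    rw [hF₇.reg .head rfl, ← f1, ← hF₄.reg .head rfl, ← hF₅.reg .head rfl, ← hF₆.reg .head rfl]
    simp
  have htail : σ₇.reg .tail = 0 := by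
    rw [hF₇.reg .tail rfl, ← f2, ← hF₄.reg .tail rfl, ← hF₅.reg .tail rfl, ← hF₆.reg .tail rfl]
    simp
  have hT₇ : Tables P σ₇ := Tables.of_frame (σ := σ₆.setReg .free (NExp.eval σ₆ (.lit 1)))
    ⟨by simpa using hT₆.1, by simpa using hT₆.2, by simpa using hT₆.3, hT₆.4, hT₆.5, hT₆.6, hT₆.7⟩
    hF₇ rfl rfl rfl rfl rfl rfl rfl rfl
  rw [← hF₄.arr .Z rfl, ← hF₅.arr .Z rfl, ← hF₆.arr .Z rfl] at hZ
  have eZ : σ₇.arr .Z = σ₆.arr .Z := hF₇.arr .Z rfl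
  rw [← eZ] at hZ
  have hpend : ∀ a b, Pending σ₇ a b ↔ σ₇.arr .Z [a, b] = 1 := by
    intro a b
    refine or_iff_left ?_
    rintro ⟨i, -, hi, -⟩
    omega
  obtain ⟨N, hL, -⟩ := hrc.lists
  rw [runs_block_singleton]
  refine (runs_updateAll hT₇ (hrc.workInv hhead htail hZ) ⟨N, hL.of_arr (fun r y x z => ?_)
    fun _ _ => rfl⟩).mono ?_
  · rw [hpend]
    constructor
    · rintro ⟨hE, hy, hz⟩
      obtain ⟨hx, hr, -⟩ := P.EP_range _ _ _ hE
      exact ⟨⟨hr, hy, hx⟩, hE, hz⟩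
    · rintro ⟨⟨-, hy, -⟩, hE, hz⟩
      exact ⟨hE, hy, hz⟩
  rintro τ m hF ⟨hI, hm⟩
  refine ⟨hI, ?_, ?_⟩
  · rw [hF.arr .prevPLen rfl, hF₇.arr .prevPLen rfl, setReg_arr, hF₆.arr .prevPLen rfl,
      hF₅.arr .prevPLen rfl, hF₄.arr .prevPLen rfl]
    exact hsum
  · simp only [NExp.cost, Finset.sum_const, Finset.card_range, smul_eq_mul] at hm₆ ⊢
    rw [initCost]
    nlinarith

/-! ### The whole program -/

/-- The returned list consists of the pairs for which `Z` holds. -/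
theorem runs_returnZ {σ : State} {a b : ℕ} (ha : σ.reg .numV = a) (hb : σ.reg .numVP = b) :
    Runs .returnZ σ (fun τ m =>
      (∀ x x', (∃ i < τ.reg .outLen, τ.arr .outFst [i] = x ∧ τ.arr .outSnd [i] = x') ↔
        (x < a ∧ x' < b) ∧ σ.arr .Z [x, x'] = 1) ∧ m ≤ 7 + a * (11 + b * 20)) := by
  rw [Cmd.returnZ, runs_block_cons, runs_seq, runs_set, runs_block_singleton]
  refine Runs.forReg₂ a b (fun D τ => ∀ x x',
    (∃ i < τ.reg .outLen, τ.arr .outFst [i] = x ∧ τ.arr .outSnd [i] = x') ↔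
      (x, x') ∈ D ∧ σ.arr .Z [x, x'] = 1) (fun _ _ => 14) rfl rfl rfl rfl (by simpa using ha)
      (by simpa using hb) (fun D τ k hI => by simpa using hI) (by simp) ?_ ?_
  · rintro p hp q hq D τ hF ex exP hD - hI
    have eZ : τ.arr .Z [p, q] = σ.arr .Z [p, q] := by rw [hF.arr .Z rfl]; rfl
    obtain ⟨n, hn⟩ : ∃ n, τ.reg .outLen = n := ⟨_, rfl⟩
    rw [hn] at hI
    rw [Cmd.when, runs_ite]
    refine ⟨fun hz => ?_, fun hz => ?_⟩
    · have hz : σ.arr .Z [p, q] = 1 := by simpa [ex, exP, eZ] using hz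
      simp only [Cmd.block, runs_seq, runs_put, runs_set]
      refine ⟨fun x x' => ?_, by simp⟩
      simp only [setReg_reg, setReg_arr, setArr_arr, setArr_reg, NExp.eval, hn, ex, exP,
        List.map_cons, List.map_nil, if_true, reduceCtorEq, if_false, Function.update_apply,
        List.cons.injEq, and_true, Set.mem_insert_iff, Prod.mk.injEq]
      constructor
      · rintro ⟨i, hi, h⟩
        rcases Nat.lt_succ_iff_lt_or_eq.1 hi with hi | rfl
        · rw [if_neg (by omega), if_neg (by omega)] at h
          have := (hI x x').1 ⟨i, hi, h⟩
          exact ⟨.inr this.1, this.2⟩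
        · rw [if_pos rfl, if_pos rfl] at h
          obtain ⟨rfl, rfl⟩ := h
          exact ⟨.inl ⟨rfl, rfl⟩, hz⟩
      · rintro ⟨⟨rfl, rfl⟩ | h, h'⟩
        · exact ⟨n, by omega, by simp⟩
        · obtain ⟨i, hi, k⟩ := (hI x x').2 ⟨h, h'⟩
          exact ⟨i, by omega, by rwa [if_neg (by omega), if_neg (by omega)]⟩
    · have hz : σ.arr .Z [p, q] ≠ 1 := by simpa [ex, exP, eZ] using hz
      rw [runs_skip]
      refine ⟨fun x x' => ?_, by simp⟩
      rw [hn, hI, Set.mem_insert_iff, Prod.mk.injEq]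
      refine ⟨fun h => ⟨.inr h.1, h.2⟩, ?_⟩
      rintro ⟨⟨rfl, rfl⟩ | h, h'⟩
      · exact absurd h' hz
      · exact ⟨h, h'⟩
  · rintro τ m hF hI hm
    refine ⟨fun x x' => (hI x x').trans Iff.rfl, ?_⟩
    simp only [NExp.cost, Finset.sum_const, Finset.card_range, smul_eq_mul, Nat.reduceAdd] at hm ⊢
    omega

/-- Every edge into `y'` is handled once for each of the `nV` pairs `(y,y')`. -/
theorem NumberedPair.sum_mainCost (P : NumberedPair) (len : ℕ → ℕ → ℕ) :
    ∑ p ∈ Finset.range P.nV ×ˢ Finset.range P.nVP, P.mainCost (fun r => len r p.2) =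
      P.nV * P.nVP * (40 + 13 * P.nSE) +
        208 * P.nV * ∑ r ∈ Finset.range P.nSE, ∑ y ∈ Finset.range P.nVP, len r y := by
  rw [Finset.sum_product, Finset.sum_comm (s := Finset.range P.nSE)]
  simp only [mainCost, Finset.sum_add_distrib, Finset.sum_const, Finset.card_range, smul_eq_mul,
    ← Finset.mul_sum]
  ring

/-- Total correctness of the program for numbered graphs, with a bound on the number of steps. -/
theorem runs_computeSimulationEfficiently {P : NumberedPair} {σ : State} {nE nEP : ℕ}
    (h : Loaded P nE nEP σ) :
    Runs .computeSimulationEfficiently σ (fun τ m =>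
      (∃ R, P.IsSim R ∧ (∀ R', P.IsSim R' → ∀ x x', R' x x' → R x x') ∧
        ∀ x x', (∃ i < τ.reg .outLen, τ.arr .outFst [i] = x ∧ τ.arr .outSnd [i] = x') ↔
          R x x') ∧
      m ≤ initCost P.nSE P.nSV P.nV P.nVP nE nEP + P.nV * P.nVP * (60 + 13 * P.nSE) +
        208 * (P.nV * nEP) + 11 * P.nV + 10) := by
  rw [Cmd.computeSimulationEfficiently, runs_block_cons]
  refine Runs.seq (runs_initializeAll h) ?_
  rintro σ₁ m₁ - ⟨hI, hs, hm₁⟩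
  rw [runs_block_cons]
  refine Runs.seq (runs_mainLoop hI) ?_
  rintro σ₂ m₂ hF₂ ⟨⟨R, hR, hmax, hZ⟩, hm₂⟩
  rw [P.sum_mainCost (fun r y => σ₁.arr .prevPLen [r, y]), hs] at hm₂
  rw [runs_block_singleton]
  refine (runs_returnZ ((hF₂.reg _ rfl).trans hI.tables.numV)
    ((hF₂.reg _ rfl).trans hI.tables.numVP)).mono ?_
  rintro τ m₃ - ⟨hout, hm₃⟩
  refine ⟨⟨R, hR, hmax, fun x x' => (hout x x').trans ⟨fun k => (hZ x k.1.1 x' k.1.2).1 k.2,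
    fun k => ?_⟩⟩, ?_⟩
  · obtain ⟨hx, hx'⟩ := hR.range x x' k
    exact ⟨⟨hx, hx'⟩, (hZ x hx x' hx').2 k⟩
  · nlinarith

/-- With `n = a + b` and `m = e + f`, all terms of the bound are at most `max 1 ((m + n) * n)`,
provided that a graph without vertices has no edges. -/
theorem initCost_add_le {S K a b e f : ℕ} (he : e ≤ e * a) (hf : f ≤ f * b) :
    initCost S K a b e f + a * b * (60 + 13 * S) + 208 * (a * f) + 11 * a + 10 ≤
      (1200 + 430 * S + 17 * K) * max 1 (((e + f) + (a + b)) * (a + b)) := by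
  obtain ⟨X, hX⟩ : ∃ X, max 1 (((e + f) + (a + b)) * (a + b)) = X := ⟨_, rfl⟩
  have h1 : 1 ≤ X := hX ▸ le_max_left _ _
  have h2 : e * a + e * b + f * a + f * b + a * a + 2 * (a * b) + b * b ≤ X := by
    refine le_of_eq_of_le ?_ (hX ▸ le_max_right _ _)
    ring
  rw [hX]
  have ha : a ≤ a * a := Nat.le_mul_self a
  have hb : b ≤ b * b := Nat.le_mul_self b
  have k0 : a ≤ X ∧ a * a ≤ X ∧ b ≤ X ∧ b * b ≤ X ∧ a * b ≤ X ∧ e ≤ X ∧ f ≤ X ∧ e * a ≤ X ∧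
      e * b ≤ X ∧ f * a ≤ X ∧ f * b ≤ X := by
    refine ⟨?_, ?_, ?_, ?_, ?_, ?_, ?_, ?_, ?_, ?_, ?_⟩ <;> omega
  obtain ⟨k1, k2, k3, k4, k5, k6, k7, k8, k9, k10, k11⟩ := k0
  have hS : S * (60 + a * (70 + 11 * a) + b * (70 + 11 * b) + 195 * (a * b)) ≤ S * (430 * X) := by
    refine Nat.mul_le_mul_left S ?_
    linarith
  have hK : K * (a * b) ≤ K * X := Nat.mul_le_mul_left K k5
  rw [initCost]
  linarith

/-! ### Numbered graphs from fuzzy graphs -/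

theorem Numbering.exists_of_lt {α : Type*} [Fintype α] (ν : Numbering α) {a : ℕ}
    (h : a < Fintype.card α) : ∃ x, (ν x : ℕ) = a :=
  ⟨ν.symm ⟨a, h⟩, by simp⟩

namespace FuzzyGraph

theorem numEdges_eq_length {V SE SV : Type*} {G : FuzzyGraph V SE SV} {es : List (V × SE × V)}
    (hes : es.Nodup) (hmem : ∀ x r y, (x, r, y) ∈ es ↔ 0 < G.E x r y) :
    G.numEdges = es.length := by
  classical
  have : {t : V × SE × V | 0 < G.E t.1 t.2.1 t.2.2} = (es.toFinset : Set (V × SE × V)) := by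
    ext ⟨x, r, y⟩
    simp [hmem]
  rw [numEdges, this, Set.ncard_coe_finset, List.toFinset_card_of_nodup hes]

/-- A graph without vertices has no edges. -/
theorem numEdges_le_mul {V SE SV : Type*} [Fintype V] (G : FuzzyGraph V SE SV) :
    G.numEdges ≤ G.numEdges * Fintype.card V := by
  rcases isEmpty_or_nonempty V with _ | _
  · have : {t : V × SE × V | 0 < G.E t.1 t.2.1 t.2.2} = ∅ := Set.eq_empty_of_isEmpty _
    simp [numEdges, this]
  · exact Nat.le_mul_of_pos_right _ Fintype.card_pos

section

variable {V SE SV : Type*} [Fintype V] [Fintype SE]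

/-- The degrees of the edges in terms of the numbers of vertices and labels; they are `0` for
numbers out of range. -/
noncomputable def numE (νV : Numbering V) (νE : Numbering SE) (G : FuzzyGraph V SE SV)
    (a r b : ℕ) : ℝ :=
  if h : a < Fintype.card V ∧ r < Fintype.card SE ∧ b < Fintype.card V then
    G.E (νV.symm ⟨a, h.1⟩) (νE.symm ⟨r, h.2.1⟩) (νV.symm ⟨b, h.2.2⟩) else 0

variable {νV : Numbering V} {νE : Numbering SE} {G : FuzzyGraph V SE SV}

theorem numE_apply (x : V) (r : SE) (y : V) : G.numE νV νE (νV x) (νE r) (νV y) = G.E x r y := by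
  simp [numE]

theorem range_of_numE_pos {a r b : ℕ} (h : 0 < G.numE νV νE a r b) :
    a < Fintype.card V ∧ r < Fintype.card SE ∧ b < Fintype.card V := by
  by_contra h'
  simp [numE, h'] at h

end

section

variable {V SE SV : Type*} [Fintype V] [Fintype SV]

/-- The degrees of the vertex labels in terms of the numbers of vertices and labels; they are `0`
for numbers out of range. -/
noncomputable def numL (νV : Numbering V) (νL : Numbering SV) (G : FuzzyGraph V SE SV)
    (a s : ℕ) : ℝ :=
  if h : a < Fintype.card V ∧ s < Fintype.card SV then
    G.L (νV.symm ⟨a, h.1⟩) (νL.symm ⟨s, h.2⟩) else 0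

variable {νV : Numbering V} {νL : Numbering SV} {G : FuzzyGraph V SE SV}

theorem numL_apply (x : V) (s : SV) : G.numL νV νL (νV x) (νL s) = G.L x s := by
  simp [numL]

end

end FuzzyGraph

section Transfer

variable {V V' SE SV : Type*} [Fintype V] [Fintype V'] [Fintype SE] [Fintype SV]
  {νV : Numbering V} {νV' : Numbering V'} {νE : Numbering SE} {νL : Numbering SV}
  {G : FuzzyGraph V SE SV} {G' : FuzzyGraph V' SE SV}

/-- The pair of numbered graphs given by two fuzzy graphs and numberings. -/
noncomputable def numberedPair (νV : Numbering V) (νV' : Numbering V') (νE : Numbering SE)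
    (νL : Numbering SV) (G : FuzzyGraph V SE SV) (G' : FuzzyGraph V' SE SV) : NumberedPair where
  nV := Fintype.card V
  nVP := Fintype.card V'
  nSE := Fintype.card SE
  nSV := Fintype.card SV
  E := G.numE νV νE
  EP := G'.numE νV' νE
  L := G.numL νV νL
  LP := G'.numL νV' νL
  E_range _ _ _ := FuzzyGraph.range_of_numE_pos
  EP_range _ _ _ := FuzzyGraph.range_of_numE_pos

theorem GraphLoaded.edgeList {nV nE : Reg} {src lbl dst : Arr} {deg lab : RArr} {σ : State}
    (h : GraphLoaded νV νE νL G nV nE src lbl dst deg lab σ) :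
    σ.reg nE = G.numEdges ∧ EdgeList G.numEdges (fun i => σ.arr src [i]) (fun i => σ.arr lbl [i])
      (fun i => σ.arr dst [i]) (fun i => σ.rarr deg [i]) (G.numE νV νE) := by
  obtain ⟨es, hes, hmem, hlen, harr⟩ := h.edges
  rw [FuzzyGraph.numEdges_eq_length hes hmem]
  refine ⟨hlen, fun i hi => ?_, fun i hi => ?_, fun i hi j hj e1 e2 e3 => ?_, fun a r b hE => ?_⟩
  · obtain ⟨h1, h2, h3, -⟩ := harr i hi
    rw [h1, h2, h3, FuzzyGraph.numE_apply]
    exact (hmem _ _ _).1 (List.getElem_mem hi)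
  · obtain ⟨h1, h2, h3, h4⟩ := harr i hi
    rw [h1, h2, h3, h4, FuzzyGraph.numE_apply]
  · obtain ⟨h1, h2, h3, -⟩ := harr i hi
    obtain ⟨k1, k2, k3, -⟩ := harr j hj
    simp only [h1, k1, h2, k2, h3, k3] at e1 e2 e3
    refine (hes.getElem_inj_iff (hi := hi) (hj := hj)).1 (Prod.ext ?_ (Prod.ext ?_ ?_))
    · exact νV.injective (Fin.ext e1)
    · exact νE.injective (Fin.ext e2)
    · exact νV.injective (Fin.ext e3)
  · obtain ⟨ha, hr, hb⟩ := FuzzyGraph.range_of_numE_pos hE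
    obtain ⟨x, rfl⟩ := νV.exists_of_lt ha
    obtain ⟨p, rfl⟩ := νE.exists_of_lt hr
    obtain ⟨y, rfl⟩ := νV.exists_of_lt hb
    rw [FuzzyGraph.numE_apply] at hE
    obtain ⟨i, hi, e⟩ := List.getElem_of_mem ((hmem x p y).2 hE)
    obtain ⟨h1, h2, h3, -⟩ := harr i hi
    exact ⟨i, hi, by rw [h1, e], by rw [h2, e], by rw [h3, e]⟩

theorem GraphLoaded.labels_eq {nV nE : Reg} {src lbl dst : Arr} {deg lab : RArr} {σ : State}
    (h : GraphLoaded νV νE νL G nV nE src lbl dst deg lab σ) {a s : ℕ} (ha : a < Fintype.card V)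
    (hs : s < Fintype.card SV) : σ.rarr lab [a, s] = G.numL νV νL a s := by
  obtain ⟨x, rfl⟩ := νV.exists_of_lt ha
  obtain ⟨p, rfl⟩ := νL.exists_of_lt hs
  rw [h.labels, FuzzyGraph.numL_apply]

theorem InputLoaded.loaded {σ : State} (h : InputLoaded νV νV' νE νL G G' σ) :
    Loaded (numberedPair νV νV' νE νL G G') G.numEdges G'.numEdges σ where
  numV := h.left.card_eq
  numVP := h.right.card_eq
  numSE := h.numSE_eq
  numSV := h.numSV_eq
  numE := h.left.edgeList.1
  numEP := h.right.edgeList.1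
  edges := h.left.edgeList.2
  edgesP := h.right.edgeList.2
  L _ hx _ hs := h.left.labels_eq hx hs
  LP _ hx _ hs := h.right.labels_eq hx hs

theorem NumberedPair.IsSim.isSimulation {R : ℕ → ℕ → Prop}
    (h : (numberedPair νV νV' νE νL G G').IsSim R) :
    IsSimulation G G' {p | R (νV p.1) (νV' p.2)} where
  label_le x x' hR s := by
    have := h.label_le _ _ hR (νL s) (νL s).isLt
    simp only [numberedPair, FuzzyGraph.numL_apply] at this
    exact_mod_cast this
  forth x x' r y hR hE := by
    have hE' : 0 < (numberedPair νV νV' νE νL G G').E (νV x) (νE r) (νV y) := by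
      simp only [numberedPair, FuzzyGraph.numE_apply]
      exact_mod_cast hE
    obtain ⟨b, hb, hle⟩ := h.forth _ _ _ _ hR hE'
    obtain ⟨y', rfl⟩ := νV'.exists_of_lt (h.range _ _ hb).2
    refine ⟨y', hb, ?_⟩
    simp only [numberedPair, FuzzyGraph.numE_apply] at hle
    exact_mod_cast hle

theorem IsSimulation.isSim {Z : Set (V × V')} (h : IsSimulation G G' Z) :
    (numberedPair νV νV' νE νL G G').IsSim
      fun a b => ∃ x x', (x, x') ∈ Z ∧ (νV x : ℕ) = a ∧ (νV' x' : ℕ) = b where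
  range := by
    rintro _ _ ⟨x, x', -, rfl, rfl⟩
    exact ⟨(νV x).isLt, (νV' x').isLt⟩
  label_le := by
    rintro _ _ ⟨x, x', hZ, rfl, rfl⟩ s hs
    obtain ⟨p, rfl⟩ := νL.exists_of_lt hs
    simp only [numberedPair, FuzzyGraph.numL_apply]
    exact_mod_cast h.label_le x x' hZ p
  forth := by
    rintro _ _ r b ⟨x, x', hZ, rfl, rfl⟩ hE
    obtain ⟨-, hr, hb⟩ := NumberedPair.E_range _ _ _ _ hE
    obtain ⟨p, rfl⟩ := νE.exists_of_lt hr
    obtain ⟨y, rfl⟩ := νV.exists_of_lt hb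
    simp only [numberedPair, FuzzyGraph.numE_apply] at hE
    obtain ⟨y', hy', hle⟩ := h.forth x x' p y hZ (by exact_mod_cast hE)
    refine ⟨νV' y', ⟨y, y', hy', rfl, rfl⟩, ?_⟩
    simp only [numberedPair, FuzzyGraph.numE_apply]
    exact_mod_cast hle

end Transfer

end FuzzySim

theorem mainTheorem1 (SE SV : Type*) [Fintype SE] [Fintype SV] :
    ∃ C : ℕ, ∀ (V V' : Type*) [Fintype V] [Fintype V']
      (G : FuzzySim.FuzzyGraph V SE SV) (G' : FuzzySim.FuzzyGraph V' SE SV)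
      (νV : FuzzySim.Numbering V) (νV' : FuzzySim.Numbering V')
      (νE : FuzzySim.Numbering SE) (νL : FuzzySim.Numbering SV)
      (σ : FuzzySim.State),
      FuzzySim.InputLoaded νV νV' νE νL G G' σ →
      ∃ (τ : FuzzySim.State) (t : ℕ),
        FuzzySim.Exec FuzzySim.Cmd.computeSimulationEfficiently σ τ t ∧
        (∃ Z : Set (V × V'), IsGreatest {Z' | FuzzySim.IsSimulation G G' Z'} Z ∧
          FuzzySim.Returns νV νV' τ Z) ∧
        t ≤ C * max 1 (((G.numEdges + G'.numEdges) + (Fintype.card V + Fintype.card V')) *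
          (Fintype.card V + Fintype.card V')) := by
  refine ⟨1200 + 430 * Fintype.card SE + 17 * Fintype.card SV, ?_⟩
  intro V V' _ _ G G' νV νV' νE νL σ h
  obtain ⟨τ, t, hex, ⟨R, hR, hmax, hout⟩, ht⟩ :=
    FuzzySim.runs_computeSimulationEfficiently h.loaded
  refine ⟨τ, t, hex, ⟨{p | R (νV p.1) (νV' p.2)}, ⟨hR.isSimulation, fun Z' hZ' p hp => ?_⟩,
    fun a b => ?_⟩,
    ht.trans (FuzzySim.initCost_add_le G.numEdges_le_mul G'.numEdges_le_mul)⟩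
  · exact hmax _ hZ'.isSim _ _ ⟨p.1, p.2, hp, rfl, rfl⟩
  · rw [hout]
    constructor
    · intro hab
      obtain ⟨ha, hb⟩ := hR.range a b hab
      obtain ⟨x, rfl⟩ := νV.exists_of_lt ha
      obtain ⟨x', rfl⟩ := νV'.exists_of_lt hb
      exact ⟨x, x', hab, rfl, rfl⟩
    · rintro ⟨x, x', hxx, rfl, rfl⟩
      exact hxx
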